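/- Let $(p_n)_{n\ge 0}$ be positive reals with $p_0=1$, non-increasing and tending to $0$, such that $p_{n+1}\le\lambda p_n$ for all $n$, where $0<\lambda<\lambda_0:=(\sqrt6-1)/5$. Consider the infinite step billiard in the table $P=\bigcup_{n\ge0}[n,n+1]\times[0,p_n]$. *Surface and flow.* For $k\in\mathbb Z$ put $h_k=p_k$ if $k\ge0$ and $h_{k}=p_{-k-1}$ if $k<0$. The invariant surface $S(\vartheta)$, $\vartheta\in(0,\pi/2)$, is $\bigcup_{k\in\mathbb Z}[k,k+1]\times[-h_k,h_k]$ with $(X,-h_k)\sim(X,h_k)$ for $X\in[k,k+1]$ and $(n,Y)\sim(-n,Y)$ for $n\ge1$, $p_n\le|Y|\le p_{n-1}$, with the quotient topology. The flow $\phi_t$ is the unit speed motion in direction $(\cos\vartheta,\sin\vartheta)$ on it; trajectories hitting a side or a vertex are continued from above (vertical intervals are closed below and open above), so that every trajectory is defined for all times $t\in\mathbb R$ (at a conical point $V_k=(\pm k,\pm p_k)$, $k\ge1$, three trajectories pass). Orbits are full orbits. A semi-orbit is unbounded if $|X|$ is unbounded on it; it escapes if $|X|\to\infty$ along it, and it is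 oscillating if it is unbounded and does not escape. Let $L=\{0\}\times[-1,1)$, a closed curve in $S(\vartheta)$. Let $E^{(n)}_\vartheta\subset L$ be the set of points whose forward orbit reaches $\{n\}\times[-p_n,p_n)$ without first colliding with a vertical wall, and $E_\vartheta=\bigcap_n E^{(n)}_\vartheta$. An escape orbit is the orbit of a point of $E_\vartheta$. *Typical directions.* Call $\vartheta\in(0,\pi/2)$ typical if: all forward and all backward semi-orbits are unbounded; $E_\vartheta^{(n)}$ is a single right-open interval of the closed curve $L$ for infinitely many $n$; there is exactly one escape orbit; and this orbit, denoted $\eta_\vartheta$, meets no point of $S(\vartheta)$ lying over a vertex of the table (the vertices being $(0,0)$, $(n,p_n)$ and $(n+1,p_n)$, $n\ge0$). **Proposition.** Lebesgue-almost every $\vartheta\in(0,\pi/2)$ is typical. For every typical $\vartheta$: (i) $\eta_\vartheta$ is oscillating in the past. (ii) $\eta_\vartheta$ is contained in the $\omega$-limit set of every orbit other than $\eta_\vartheta$. (iii) There is exactly one orbit that escapes in the past, and $\eta_\vartheta$ is contained in the $\alpha$-limit set of every other orbit. (iv) With these exceptions, every semi-orbit stays close to $\eta_\vartheta$ for arbitrarily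 long times. Precisely, let $w\in\eta_\vartheta$, $T>0$, and let $W$ be an open neighbourhood of the diagonal of $S(\vartheta)\times S(\vartheta)$ (for instance, all pairs at distance less than $\varepsilon$ for a metric inducing the topology). If $z\notin\eta_\vartheta$, there is $t_0\ge T$ such that $(\phi_{t_0+s}z,\phi_sw)\in W$ for all $s\in[-T,T]$. If the orbit of $z$ does not escape in the past, there is $t_0\le -T$ such that $(\phi_{t_0+s}z,\phi_sw)\in W$ for all $s\in[-T,T]$. (v) Every continuous function $f:S(\vartheta)\to\mathbb R$ that is invariant under the flow is constant. (vi) The flow is minimal (every orbit is dense in $S(\vartheta)$) if and only if $\eta_\vartheta$ is dense in $S(\vartheta)$. (vii) The closure of $\eta_\vartheta\cap L$ is either all of $L$ or a Cantor set (nonempty, compact, perfect and totally disconnected). -/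

import Mathlib

open Set Filter Topology MeasureTheory

noncomputable section

/-- An infinite step billiard: the heights `p n` of the steps of the table
`⋃ n, [n, n+1] × [0, p n]`. -/
structure StepBilliard where
  p : ℕ → ℝ
  p_zero : p 0 = 1
  p_pos : ∀ n, 0 < p n
  p_anti : Antitone p
  p_lim : Tendsto p atTop (𝓝 0)

namespace StepBilliard

variable (B : StepBilliard)

/-- The unfolded table (four reflected copies of the table) is the union over `k : ℤ` of the
rectangles `[k, k+1] × [-h k, h k]`, where `h k = p k` for `k ≥ 0` and `h (-n-1) = p n`. -/
def h : ℤ → ℝ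
  | Int.ofNat n => B.p n
  | Int.negSucc n => B.p n

lemma h_pos (k : ℤ) : 0 < B.h k := by
  cases k <;> exact B.p_pos _

lemma two_h_pos (k : ℤ) : 0 < 2 * B.h k := by
  have := B.h_pos k
  linarith

lemma h_reflect (k : ℤ) : B.h (-k - 1) = B.h k := by
  cases k with
  | ofNat n =>
    have e : -(Int.ofNat n) - 1 = Int.negSucc n := by
      rw [Int.negSucc_eq, Int.ofNat_eq_natCast]; ring
    rw [e]; rfl
  | negSucc n =>
    have e : -(Int.negSucc n) - 1 = Int.ofNat n := by
      rw [Int.negSucc_eq, Int.ofNat_eq_natCast]; ring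
    rw [e]; rfl

/-! ### The invariant surface -/

/-- The unfolded table, a closed subset of the plane. -/
def unfolded : Set (ℝ × ℝ) :=
  {q | ∃ k : ℤ, q.1 ∈ Icc (k : ℝ) (k + 1) ∧ q.2 ∈ Icc (-(B.h k)) (B.h k)}

/-- The side identifications: opposite horizontal sides of every rectangle are glued by a vertical
translation, and the vertical sides at abscissa `n+1` (at heights between `p (n+1)` and `p n` in
absolute value) are glued to those at abscissa `-(n+1)` by a horizontal translation. -/
inductive Glue : B.unfolded → B.unfolded → Prop
  | horizontal (k : ℤ) (a b : B.unfolded) (hx : a.1.1 ∈ Icc (k : ℝ) (k + 1))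
      (hab : b.1.1 = a.1.1) (ha : a.1.2 = -(B.h k)) (hb : b.1.2 = B.h k) : Glue a b
  | vertical (n : ℕ) (a b : B.unfolded) (ha : a.1.1 = -((n : ℝ) + 1)) (hb : b.1.1 = (n : ℝ) + 1)
      (hab : b.1.2 = a.1.2) (hy : |a.1.2| ∈ Icc (B.p (n + 1)) (B.p n)) : Glue a b

/-- The invariant surface: the unfolded table modulo the side identifications, with the quotient
topology. The vertices `(±n, ±p n)`, `n ≥ 1`, become one conical point of angle `6π`. -/
abbrev Surface : Type := Quot B.Glue

/-! ### The flow

Points of the phase space are points of the unfolded table, with one representative for each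
incoming trajectory: trajectories hitting a side or a vertex are continued from above, i.e. all
vertical intervals are closed below and open above. Only the conical points have more than one
(namely three) representatives. -/

/-- Phase points `(X, Y)`. -/
def Phase : Type := {q : ℝ × ℝ // q.2 ∈ Ico (-(B.h ⌊q.1⌋)) (B.h ⌊q.1⌋)}

variable {B} in
/-- The abscissa `X` of a phase point. -/
def Phase.X (z : B.Phase) : ℝ := z.1.1

variable {B} in
/-- The ordinate `Y` of a phase point. -/
def Phase.Y (z : B.Phase) : ℝ := z.1.2

lemma Phase.mem_unfolded (z : B.Phase) : z.1 ∈ B.unfolded :=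
  ⟨⌊z.1.1⌋, ⟨Int.floor_le _, (Int.lt_floor_add_one _).le⟩, z.2.1, z.2.2.le⟩

/-- The point of the surface represented by a phase point. -/
def proj (z : B.Phase) : B.Surface := Quot.mk _ ⟨z.1, Phase.mem_unfolded B z⟩

/-- Vertical cross-sections of the rectangles: `(k, y)` with `-h k ≤ y < h k`. -/
def Edge : Type := {e : ℤ × ℝ // e.2 ∈ Ico (-(B.h e.1)) (B.h e.1)}

/-- Reduction of an ordinate modulo `2 * h k` to `[-h k, h k)`; this realizes the gluing of the
horizontal sides of the `k`-th rectangle. -/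
def wrap (k : ℤ) (y : ℝ) : ℝ := toIcoMod (B.two_h_pos k) (-(B.h k)) y

lemma wrap_mem (k : ℤ) (y : ℝ) : B.wrap k y ∈ Ico (-(B.h k)) (B.h k) := by
  have := toIcoMod_mem_Ico (B.two_h_pos k) (-(B.h k)) y
  have e : -(B.h k) + 2 * B.h k = B.h k := by ring
  rwa [e] at this

lemma wrap_eq_self {k : ℤ} {y : ℝ} (hy : y ∈ Ico (-(B.h k)) (B.h k)) : B.wrap k y = y := by
  have e : -(B.h k) + 2 * B.h k = B.h k := by ring
  exact (toIcoMod_eq_self _).2 (by rwa [e])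

lemma wrap_wrap_add (k : ℤ) (y c : ℝ) : B.wrap k (B.wrap k y + c) = B.wrap k (y + c) := by
  have : B.wrap k y + c = y + c - toIcoDiv (B.two_h_pos k) (-(B.h k)) y • (2 * B.h k) := by
    unfold wrap toIcoMod
    ring
  rw [this]
  exact toIcoMod_sub_zsmul _ _ _ _

/-- Crossing the `k`-th rectangle from left to right with slope `a`. -/
def shift (a : ℝ) : Equiv.Perm B.Edge where
  toFun e := ⟨(e.1.1, B.wrap e.1.1 (e.1.2 + a)), B.wrap_mem _ _⟩
  invFun e := ⟨(e.1.1, B.wrap e.1.1 (e.1.2 - a)), B.wrap_mem _ _⟩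
  left_inv e := by
    apply Subtype.ext
    refine Prod.ext rfl ?_
    simp only [sub_eq_add_neg, wrap_wrap_add, add_neg_cancel_right]
    exact B.wrap_eq_self e.2
  right_inv e := by
    apply Subtype.ext
    refine Prod.ext rfl ?_
    simp only [sub_eq_add_neg, wrap_wrap_add, neg_add_cancel_right]
    exact B.wrap_eq_self e.2

open Classical in
/-- Leaving the `k`-th rectangle through its right side `X = k+1` at height `y`: if the next
rectangle is open at that height, one enters it; otherwise one is at a vertical side, which is
glued to the one at `X = -(k+1)`. -/
def exitFun (e : B.Edge) : B.Edge :=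
  if hy : e.1.2 ∈ Ico (-(B.h (e.1.1 + 1))) (B.h (e.1.1 + 1)) then
    ⟨(e.1.1 + 1, e.1.2), hy⟩
  else ⟨(-e.1.1 - 1, e.1.2), by simpa only [h_reflect] using e.2⟩

open Classical in
/-- The inverse of `exitFun`. -/
def exitInv (e : B.Edge) : B.Edge :=
  if hy : e.1.2 ∈ Ico (-(B.h (e.1.1 - 1))) (B.h (e.1.1 - 1)) then
    ⟨(e.1.1 - 1, e.1.2), hy⟩
  else ⟨(-e.1.1 - 1, e.1.2), by simpa only [h_reflect] using e.2⟩

lemma exitInv_exitFun (e : B.Edge) : B.exitInv (B.exitFun e) = e := by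
  obtain ⟨⟨k, y⟩, he⟩ := e
  dsimp only at he
  by_cases hy : y ∈ Ico (-(B.h (k + 1))) (B.h (k + 1))
  · have h1 : B.exitFun ⟨(k, y), he⟩ = ⟨(k + 1, y), hy⟩ := dif_pos hy
    have h2 : y ∈ Ico (-(B.h (k + 1 - 1))) (B.h (k + 1 - 1)) := by
      rwa [add_sub_cancel_right]
    rw [h1]
    exact (dif_pos h2).trans (Subtype.ext (Prod.ext (add_sub_cancel_right k 1) rfl))
  · have h0 : y ∈ Ico (-(B.h (-k - 1))) (B.h (-k - 1)) := by rwa [h_reflect]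
    have h1 : B.exitFun ⟨(k, y), he⟩ = ⟨(-k - 1, y), h0⟩ := dif_neg hy
    have h2 : ¬ y ∈ Ico (-(B.h (-k - 1 - 1))) (B.h (-k - 1 - 1)) := by
      have e1 : -k - 1 - 1 = -(k + 1) - 1 := by ring
      rwa [e1, h_reflect]
    rw [h1]
    refine (dif_neg h2).trans (Subtype.ext (Prod.ext ?_ rfl))
    change -(-k - 1) - 1 = k
    ring

lemma exitFun_exitInv (e : B.Edge) : B.exitFun (B.exitInv e) = e := by
  obtain ⟨⟨k, y⟩, he⟩ := e
  dsimp only at he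
  by_cases hy : y ∈ Ico (-(B.h (k - 1))) (B.h (k - 1))
  · have h1 : B.exitInv ⟨(k, y), he⟩ = ⟨(k - 1, y), hy⟩ := dif_pos hy
    have h2 : y ∈ Ico (-(B.h (k - 1 + 1))) (B.h (k - 1 + 1)) := by
      rwa [sub_add_cancel]
    rw [h1]
    exact (dif_pos h2).trans (Subtype.ext (Prod.ext (sub_add_cancel k 1) rfl))
  · have h0 : y ∈ Ico (-(B.h (-k - 1))) (B.h (-k - 1)) := by rwa [h_reflect]
    have h1 : B.exitInv ⟨(k, y), he⟩ = ⟨(-k - 1, y), h0⟩ := dif_neg hy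
    have h2 : ¬ y ∈ Ico (-(B.h (-k - 1 + 1))) (B.h (-k - 1 + 1)) := by
      have e1 : -k - 1 + 1 = -(k - 1) - 1 := by ring
      rwa [e1, h_reflect]
    rw [h1]
    refine (dif_neg h2).trans (Subtype.ext (Prod.ext ?_ rfl))
    change -(-k - 1) - 1 = k
    ring

/-- `exitFun` as a bijection. -/
def exit : Equiv.Perm B.Edge := ⟨B.exitFun, B.exitInv, B.exitInv_exitFun, B.exitFun_exitInv⟩

/-- The passage from one vertical cross-section to the next along the direction of slope `a`. -/
def step (a : ℝ) : Equiv.Perm B.Edge := (B.shift a).trans B.exit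

/-- The point at which the line of slope `a` ending at `z` entered the rectangle of `z`. -/
def base (a : ℝ) (z : B.Phase) : B.Edge :=
  ⟨(⌊z.X⌋, B.wrap ⌊z.X⌋ (z.Y - a * Int.fract z.X)), B.wrap_mem _ _⟩

/-- The point reached from the cross-section point `e` along the direction of slope `a` after a
horizontal displacement `s` with `0 ≤ s < 1`. -/
def along (a : ℝ) (e : B.Edge) (s : ℝ) (hs : s ∈ Ico (0 : ℝ) 1) : B.Phase :=
  ⟨((e.1.1 : ℝ) + s, B.wrap e.1.1 (e.1.2 + a * s)), by
    have : ⌊(e.1.1 : ℝ) + s⌋ = e.1.1 := by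
      rw [Int.floor_intCast_add, Int.floor_eq_zero_iff.2 hs, add_zero]
    simpa only [this] using B.wrap_mem _ _⟩

/-- The billiard flow at unit speed in the direction `θ`: in time `t` the horizontal displacement
is `t * cos θ`, and the slope is `tan θ`. -/
def flow (θ t : ℝ) (z : B.Phase) : B.Phase :=
  B.along (Real.tan θ)
    ((B.step (Real.tan θ) ^ ⌊Int.fract z.X + t * Real.cos θ⌋) (B.base (Real.tan θ) z))
    (Int.fract (Int.fract z.X + t * Real.cos θ)) ⟨Int.fract_nonneg _, Int.fract_lt_one _⟩

/-- The orbit of a phase point (for all times, past and future). -/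
def orbit (θ : ℝ) (z : B.Phase) : Set B.Phase := range fun t => B.flow θ t z

/-- The `ω`-limit set of the orbit of `z`, in the surface. -/
def omegaLim (θ : ℝ) (z : B.Phase) : Set B.Surface :=
  omegaLimit atTop (fun t w => B.proj (B.flow θ t w)) {z}

/-- The `α`-limit set of the orbit of `z`, in the surface. -/
def alphaLim (θ : ℝ) (z : B.Phase) : Set B.Surface :=
  omegaLimit atBot (fun t w => B.proj (B.flow θ t w)) {z}

/-! ### Escape orbits and typical directions -/

/-- The curve `L`, i.e. `{0} × [-1, 1)`, as a set of phase points. -/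
def section0 : Set B.Phase := {z | z.X = 0}

/-- The points of `L` whose forward orbit reaches the aperture `{n} × [-p n, p n)` directly,
i.e. without meeting any vertical wall before. -/
def reach (θ : ℝ) (n : ℕ) : Set B.Phase :=
  {z | z ∈ B.section0 ∧ ∀ t ∈ Icc 0 ((n : ℝ) / Real.cos θ), (B.flow θ t z).X = t * Real.cos θ}

/-- A subset of `L` that is a single right-open interval of the closed curve `L ≃ ℝ / 2ℤ`. -/
def IsSingleInterval (S : Set B.Phase) : Prop :=
  ∃ a b : ℝ, a < b ∧ S = {z | z ∈ B.section0 ∧ ∃ m : ℤ, z.Y + 2 * m ∈ Ico a b}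

/-- The points of `L` whose forward orbit reaches all apertures directly. -/
def escapePoints (θ : ℝ) : Set B.Phase := ⋂ n : ℕ, B.reach θ n

/-- Escape orbits: the orbits of the points of `escapePoints`. -/
def IsEscapeOrbit (θ : ℝ) (O : Set B.Phase) : Prop :=
  ∃ z ∈ B.escapePoints θ, O = B.orbit θ z

/-- The orbit of `z` goes to infinity as `t → -∞`. -/
def EscapesInPast (θ : ℝ) (z : B.Phase) : Prop :=
  Tendsto (fun t => |(B.flow θ t z).X|) atBot atTop

/-- The forward semi-orbit of `z` is unbounded. -/
def UnboundedInFuture (θ : ℝ) (z : B.Phase) : Prop :=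
  ∀ M : ℝ, ∃ t ≥ 0, M < |(B.flow θ t z).X|

/-- The backward semi-orbit of `z` is unbounded. -/
def UnboundedInPast (θ : ℝ) (z : B.Phase) : Prop :=
  ∀ M : ℝ, ∃ t ≤ 0, M < |(B.flow θ t z).X|

/-- The backward semi-orbit of `z` is oscillating: unbounded and not escaping. -/
def OscillatesInPast (θ : ℝ) (z : B.Phase) : Prop :=
  B.UnboundedInPast θ z ∧ ¬ B.EscapesInPast θ z

/-- The vertices of the table `⋃ n, [n, n+1] × [0, p n]`. -/
def tableVertices : Set (ℝ × ℝ) :=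
  {(0, 0)} ∪ (range fun n : ℕ => ((n : ℝ), B.p n)) ∪ (range fun n : ℕ => ((n : ℝ) + 1, B.p n))

/-- The phase points lying over a vertex of the table. -/
def IsVertex (z : B.Phase) : Prop := (|z.X|, |z.Y|) ∈ B.tableVertices

/-- Typical directions: all semi-orbits are unbounded; infinitely many of the sets `reach θ n`
are single intervals; there is exactly one escape orbit, and it meets no vertex. -/
structure IsTypical (θ : ℝ) : Prop where
  unboundedInFuture : ∀ z, B.UnboundedInFuture θ z
  unboundedInPast : ∀ z, B.UnboundedInPast θ z
  singleInterval : ∃ᶠ n in atTop, B.IsSingleInterval (B.reach θ n)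
  existsUnique : ∃! O, B.IsEscapeOrbit θ O
  noVertex : ∀ O, B.IsEscapeOrbit θ O → ∀ z ∈ O, ¬ B.IsVertex z

/-- The flow is minimal: every orbit is dense in the surface. -/
def IsMinimalFlow (θ : ℝ) : Prop := ∀ z, Dense (B.proj '' B.orbit θ z)

end StepBilliard

/-- Cantor sets: nonempty, compact, perfect and totally disconnected. -/
def IsCantorSet {Z : Type*} [TopologicalSpace Z] (C : Set Z) : Prop :=
  C.Nonempty ∧ IsCompact C ∧ Perfect C ∧ IsTotallyDisconnected C

end

/-!
Recording the flow on the left sides of the rectangles turns it into the suspension of a bijection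
of these circles, the step map, which adds the slope to the ordinate and then jumps to an adjacent
or an opposite rectangle; it is a translation off a locally finite set of discontinuities.

For almost every slope, no nonzero multiple of the slope lies in the group generated by the heights.
Then a bounded orbit is impossible: the set of edge points with bounded orbits would have gaps,
which the step map carries along unchanged until they meet a discontinuity, and two discontinuities
on one orbit are excluded by genericity.

If no vertex to the left of the `m`-th aperture reaches it directly, then translating the aperture
backwards to `L` shows that the points reaching it form a single interval. When the heights decay
with ratio less than `1 / 3`, the proportion of slopes for which some vertex does reach the aperture
stays below `1`, so by Lebesgue density almost every slope has infinitely many such apertures. The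
nested intervals shrink to exactly one escape point.

A rotation by a half turn reverses the step map and takes the escape orbit to the only orbit that
escapes in the past. Any other orbit returns to `L` infinitely often and goes arbitrarily far in
between; on its last visit to `L` before such an excursion it reaches a far aperture directly, so it
is then close to the escape point. Since the escape orbit meets no vertex, nearby orbits follow it
for a long time; this gives all the assertions about limit sets. The trace of the escape orbit on
`L` is approached by itself, so its closure is perfect; if the closure has interior, every point of
`L` returns into it, and otherwise it is totally disconnected.
-/

section Perm

variable {α : Type*} (f : Equiv.Perm α)

lemma perm_zpow_add_one_apply' (n : ℤ) (x : α) : (f ^ (n + 1)) x = f ((f ^ n) x) := by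
  rw [add_comm, zpow_one_add, Equiv.Perm.mul_apply]

lemma perm_zpow_sub_one_apply (n : ℤ) (x : α) : (f ^ (n - 1)) x = f.symm ((f ^ n) x) := by
  rw [Equiv.eq_symm_apply, ← perm_zpow_add_one_apply', sub_add_cancel]

lemma perm_zpow_neg_natCast_succ_apply (n : ℕ) (x : α) :
    (f ^ (-((n + 1 : ℕ) : ℤ))) x = (f ^ (-(n : ℤ))) (f.symm x) := by
  rw [Nat.cast_succ, neg_add, zpow_add, zpow_neg_one, Equiv.Perm.mul_apply,
    Equiv.Perm.inv_def]

lemma perm_zpow_neg_natCast_succ_apply' (n : ℕ) (x : α) :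
    (f ^ (-((n + 1 : ℕ) : ℤ))) x = f.symm ((f ^ (-(n : ℤ))) x) := by
  rw [Nat.cast_succ, neg_add, ← sub_eq_add_neg, perm_zpow_sub_one_apply]

lemma perm_zpow_natCast_succ_apply (n : ℕ) (x : α) :
    (f ^ ((n + 1 : ℕ) : ℤ)) x = (f ^ (n : ℤ)) (f x) := by
  rw [Nat.cast_succ, zpow_add_one, Equiv.Perm.mul_apply]

lemma perm_zpow_natCast_succ_apply' (n : ℕ) (x : α) :
    (f ^ ((n + 1 : ℕ) : ℤ)) x = f ((f ^ (n : ℤ)) x) := by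
  rw [Nat.cast_succ, perm_zpow_add_one_apply']

lemma perm_zpow_zpow_apply (m n : ℤ) (x : α) : (f ^ m) ((f ^ n) x) = (f ^ (m + n)) x := by
  rw [zpow_add, Equiv.Perm.mul_apply]

lemma perm_zpow_neg_zpow_apply (n : ℤ) (x : α) : (f ^ (-n)) ((f ^ n) x) = x := by
  rw [perm_zpow_zpow_apply, neg_add_cancel, zpow_zero, Equiv.Perm.one_apply]

end Perm

lemma eventually_nhds_zero_of_Ico_of_neg_Ico {G : Type*} [AddCommGroup G] [LinearOrder G]
    [IsOrderedAddMonoid G] [TopologicalSpace G] [OrderClosedTopology G] {P : G → Prop} {ε δ : G}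
    (hε : 0 < ε) (hδ : 0 < δ) (hpos : ∀ t ∈ Ico 0 ε, P t) (hneg : ∀ t ∈ Ico 0 δ, P (-t)) :
    ∀ᶠ t in 𝓝 0, P t := by
  filter_upwards [Ioo_mem_nhds (neg_lt_zero.2 hδ) hε] with t ht
  rcases le_total 0 t with h | h
  · exact hpos t ⟨h, ht.2⟩
  · simpa only [neg_neg] using hneg (-t) ⟨neg_nonneg.2 h, neg_lt.1 ht.1⟩

lemma fract_mem_Ico {R : Type*} [Ring R] [LinearOrder R] [IsStrictOrderedRing R] [FloorRing R]
    (x : R) : Int.fract x ∈ Ico 0 1 :=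
  ⟨Int.fract_nonneg x, Int.fract_lt_one x⟩

lemma abs_sub_lt_of_add_sub_notMem_Ico {G : Type*} [AddCommGroup G] [LinearOrder G]
    [IsOrderedAddMonoid G] {α β x y r : G} (hr : 0 ≤ r) (hx : x ∈ Ico α β) (hy : y ∈ Ico α β)
    (hadd : y + r ∉ Ico α β) (hsub : y - r ∉ Ico α β) : |x - y| < r := by
  have hβ : β ≤ y + r := not_lt.1 fun h => hadd ⟨le_add_of_le_of_nonneg hy.1 hr, h⟩
  have hα : y - r < α := not_le.1 fun h => hsub ⟨h, (sub_le_self y hr).trans_lt hy.2⟩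
  exact abs_sub_lt_iff.2 ⟨sub_lt_iff_lt_add'.2 (hx.2.trans_le hβ), sub_lt_comm.1 (hα.trans_le hx.1)⟩

lemma card_Icc_ceil_floor_le {x y : ℝ} {K : ℕ} (h : y - x < K) :
    (Finset.Icc ⌈x⌉ ⌊y⌋).card ≤ K := by
  have hceil := Int.le_ceil x
  have hfloor := Int.floor_le y
  have hlt : ⌊y⌋ - ⌈x⌉ < (K : ℤ) := by
    have : (⌊y⌋ : ℝ) - ⌈x⌉ < K := by linarith
    exact_mod_cast this
  rw [Int.card_Icc]
  omega

lemma geom_sum_le_inv_one_sub {r : ℝ} (h₀ : 0 ≤ r) (h₁ : r < 1) (n : ℕ) :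
    ∑ i ∈ Finset.range n, r ^ i ≤ (1 - r)⁻¹ := by
  rw [← tsum_geometric_of_lt_one h₀ h₁]
  exact (summable_geometric_of_lt_one h₀ h₁).sum_le_tsum _ fun i _ => pow_nonneg h₀ i

lemma tendsto_self_mul_const_pow_sub_one_of_lt_one {r : ℝ} (h₀ : 0 < r) (h₁ : r < 1) :
    Tendsto (fun n : ℕ => (n : ℝ) * r ^ (n - 1)) atTop (𝓝 0) := by
  have h := (tendsto_self_mul_const_pow_of_lt_one h₀.le h₁).mul_const r⁻¹
  rw [zero_mul] at h
  refine h.congr' ?_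
  filter_upwards [eventually_ge_atTop 1] with n hn
  rw [mul_assoc, pow_sub₀ r h₀.ne' hn, pow_one]

lemma measure_eq_zero_of_forall_inter_closedBall_le {β : Type*} [MetricSpace β]
    [MeasurableSpace β] [BorelSpace β] [SecondCountableTopology β] [HasBesicovitchCovering β]
    (μ : Measure β) [IsLocallyFiniteMeasure μ] {A : Set β} {c : ENNReal} (hc : c < 1)
    (h : ∀ x, ∀ r > 0, μ (A ∩ Metric.closedBall x r) ≤ c * μ (Metric.closedBall x r)) :
    μ A = 0 := by
  by_contra hA
  have : NeBot (ae (μ.restrict A)) := ae_neBot.2 (by rwa [Ne, Measure.restrict_eq_zero])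
  obtain ⟨x, hdensity⟩ := (Besicovitch.ae_tendsto_measure_inter_div μ A).exists
  have hle : ∀ᶠ r in 𝓝[>] (0 : ℝ),
      μ (A ∩ Metric.closedBall x r) / μ (Metric.closedBall x r) ≤ c := by
    filter_upwards [self_mem_nhdsWithin] with r hr
    exact ENNReal.div_le_of_le_mul (h x r hr)
  exact (le_of_tendsto hdensity hle).not_gt hc

lemma ae_tan_of_ae {P : ℝ → Prop} (h : ∀ᵐ a : ℝ, P a) :
    ∀ᵐ θ : ℝ, Real.cos θ ≠ 0 → P (Real.tan θ) := by
  have hnull : ∀ k : ℤ, volume ((fun a => Real.arctan a + k * Real.pi) '' {a | ¬ P a}) = 0 :=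
    fun k => addHaar_image_eq_zero_of_differentiableOn_of_addHaar_eq_zero volume
      (Real.differentiable_arctan.add_const _).differentiableOn h
  refine measure_mono_null (fun θ hθ => mem_iUnion.2 ?_) (measure_iUnion_null hnull)
  simp only [mem_compl_iff, mem_ofPred_eq, Classical.not_imp] at hθ
  obtain ⟨hcos, hP⟩ := hθ
  set k := toIcoDiv Real.pi_pos (-(Real.pi / 2)) θ
  have hmem : θ - k * Real.pi ∈ Ico (-(Real.pi / 2)) (Real.pi / 2) := by
    have := sub_toIcoDiv_zsmul_mem_Ico Real.pi_pos (-(Real.pi / 2)) θ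
    rwa [zsmul_eq_mul, show -(Real.pi / 2) + Real.pi = Real.pi / 2 by ring] at this
  have hne : -(Real.pi / 2) ≠ θ - k * Real.pi := by
    refine fun heq => hcos (Real.cos_eq_zero_iff.2 ⟨k - 1, ?_⟩)
    push_cast
    linarith
  refine ⟨k, Real.tan θ, hP, ?_⟩
  change Real.arctan (Real.tan θ) + k * Real.pi = θ
  rw [← Real.tan_sub_int_mul_pi θ k, Real.arctan_tan (hmem.1.lt_of_ne hne) hmem.2,
    sub_add_cancel]

lemma continuousAt_of_forall_continuousWithinAt_preimage_Icc {X Y : Type*} [TopologicalSpace X]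
    [TopologicalSpace Y] {f : X → Y} {g : X → ℝ} {x : X} (hg : ContinuousAt g x)
    (h : ∀ n : ℤ, g x ∈ Icc (n : ℝ) (n + 1) →
      ContinuousWithinAt f (g ⁻¹' Icc (n : ℝ) (n + 1)) x) :
    ContinuousAt f x := by
  have hceil : ((⌈g x⌉ - 1 : ℤ) : ℝ) < g x := by
    push_cast
    linarith [Int.ceil_lt_add_one (g x)]
  have hle : g x ≤ ((⌈g x⌉ - 1 : ℤ) : ℝ) + 1 := by
    push_cast
    linarith [Int.le_ceil (g x)]
  have hright := h ⌊g x⌋ ⟨Int.floor_le _, (Int.lt_floor_add_one _).le⟩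
  have hleft := h (⌈g x⌉ - 1) ⟨hceil.le, hle⟩
  refine (hright.union hleft).continuousAt ?_
  filter_upwards [hg.eventually_lt_const (Int.lt_floor_add_one (g x)),
    hg.eventually_const_lt hceil] with y hlt hgt
  rcases le_total (g x) (g y) with hy | hy
  · exact Or.inl ⟨(Int.floor_le _).trans hy, hlt.le⟩
  · exact Or.inr ⟨hgt.le, hy.trans hle⟩

lemma isClosed_setOf_exists_add_mul_intCast_mem {K : Set ℝ} (hK : IsCompact K) {p : ℝ}
    (hp : 0 < p) : IsClosed {y : ℝ | ∃ m : ℤ, y + p * m ∈ K} := by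
  have : Fact (0 < p) := ⟨hp⟩
  have hclosed : IsClosed ((fun x : ℝ => (x : AddCircle p)) '' K) :=
    (hK.image (AddCircle.continuous_mk' p)).isClosed
  convert hclosed.preimage (AddCircle.continuous_mk' p) using 1
  ext y
  have hcoe : ∀ x : ℝ, (x : AddCircle p) = (y : AddCircle p) ↔ ∃ m : ℤ, y + p * m = x := by
    intro x
    rw [← sub_eq_zero, ← AddCircle.coe_sub, AddCircle.coe_eq_zero_iff]
    refine exists_congr fun m => ?_
    rw [zsmul_eq_mul]
    constructor <;> intro h <;> linarith
  constructor
  · rintro ⟨m, hm⟩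
    exact ⟨_, hm, (hcoe _).2 ⟨m, rfl⟩⟩
  · rintro ⟨x, hx, hxy⟩
    obtain ⟨m, rfl⟩ := (hcoe x).1 hxy
    exact ⟨m, hx⟩

lemma closure_mem_nhds_of_eventually_add_mem {G : Type*} [TopologicalSpace G] [AddGroup G]
    [IsTopologicalAddGroup G] {A : Set G} {x y : G} (h : ∀ᶠ t in 𝓝 0, y + t ∈ A → x + t ∈ A)
    (hy : closure A ∈ 𝓝 y) : closure A ∈ 𝓝 x := by
  rw [← map_add_left_nhds_zero, mem_map] at hy ⊢
  filter_upwards [h.eventually_nhds, hy] with t ht hyt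
  rw [mem_preimage, mem_closure_iff_frequently, ← map_add_left_nhds, frequently_map] at hyt ⊢
  exact hyt.mp ht

lemma frequently_add_mem_of_closure_mem_nhds {A : Set ℝ} {y : ℝ} (hy : closure A ∈ 𝓝 y) :
    ∃ᶠ t in 𝓝[>] 0, y + t ∈ A := by
  intro h
  rw [← map_add_left_nhds_zero, mem_map] at hy
  have hnear := ((eventually_nhdsWithin_iff.1 h).eventually_nhds.and hy).filter_mono
    (nhdsWithin_le_nhds (s := Ioi 0))
  obtain ⟨t, ⟨ht, hyt⟩, hpos⟩ := (hnear.and self_mem_nhdsWithin).exists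
  beta_reduce at hyt
  rw [mem_closure_iff_frequently, ← map_add_left_nhds, frequently_map] at hyt
  exact hyt (ht.mp ((eventually_gt_nhds hpos).mono fun s hs hns => hns hs))

noncomputable section

namespace StepBilliard

variable {B : StepBilliard}

/-! ### Edge points and the step map -/

lemma h_natCast (n : ℕ) : B.h n = B.p n := rfl

lemma h_natCast_add_one (n : ℕ) : B.h (n + 1) = B.p (n + 1) := rfl

lemma h_neg_natCast_sub_one (n : ℕ) : B.h (-n - 1) = B.p n := by rw [h_reflect, h_natCast]

lemma h_zero : B.h 0 = 1 := B.p_zero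

lemma h_neg_one : B.h (-1) = 1 := B.p_zero

lemma h_le_one (k : ℤ) : B.h k ≤ 1 := by
  rw [← B.p_zero]
  cases k <;> exact B.p_anti (Nat.zero_le _)

lemma h_succ_le {k : ℤ} (hk : 0 ≤ k) : B.h (k + 1) ≤ B.h k := by
  lift k to ℕ using hk
  exact B.p_anti (Nat.le_succ k)

lemma h_le_succ {k : ℤ} (hk : k < 0) : B.h k ≤ B.h (k + 1) := by
  obtain rfl | hk : k = -1 ∨ k ≤ -2 := by omega
  · exact le_rfl
  · have := h_succ_le (B := B) (k := -k - 2) (by omega)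
    rwa [show -k - 2 + 1 = -k - 1 by ring, h_reflect, show -k - 2 = -(k + 1) - 1 by ring,
      h_reflect] at this

lemma wrap_eq_sub (k : ℤ) (y : ℝ) : ∃ m : ℤ, B.wrap k y = y - m * (2 * B.h k) :=
  ⟨toIcoDiv (B.two_h_pos k) (-(B.h k)) y, by rw [wrap, toIcoMod, zsmul_eq_mul]⟩

lemma wrap_sub_intCast_mul (k : ℤ) (y : ℝ) (m : ℤ) :
    B.wrap k (y - m * (2 * B.h k)) = B.wrap k y := by
  rw [wrap, ← zsmul_eq_mul]
  exact toIcoMod_sub_zsmul _ _ _ _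

/-- The index of the rectangle of an edge point. -/
def Edge.k (e : B.Edge) : ℤ := e.1.1

/-- The ordinate of an edge point. -/
def Edge.y (e : B.Edge) : ℝ := e.1.2

lemma Edge.mem (e : B.Edge) : e.y ∈ Ico (-(B.h e.k)) (B.h e.k) := e.2

lemma Edge.ext {e f : B.Edge} (hk : e.k = f.k) (hy : e.y = f.y) : e = f :=
  Subtype.ext (Prod.ext hk hy)

variable (B) in
/-- The edge point over the `k`-th rectangle whose ordinate is `y` modulo `2 * h k`. -/
def edgeAt (k : ℤ) (y : ℝ) : B.Edge := ⟨(k, B.wrap k y), B.wrap_mem k y⟩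

@[simp] lemma edgeAt_k (k : ℤ) (y : ℝ) : (B.edgeAt k y).k = k := rfl

lemma edgeAt_y (k : ℤ) (y : ℝ) : (B.edgeAt k y).y = B.wrap k y := rfl

lemma edgeAt_y_of_mem {k : ℤ} {y : ℝ} (hy : y ∈ Ico (-(B.h k)) (B.h k)) :
    (B.edgeAt k y).y = y :=
  B.wrap_eq_self hy

@[simp] lemma edgeAt_k_y (e : B.Edge) : B.edgeAt e.k e.y = e :=
  Edge.ext rfl (B.wrap_eq_self e.mem)

lemma edgeAt_eq_edgeAt_iff {k : ℤ} {y z : ℝ} :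
    B.edgeAt k y = B.edgeAt k z ↔ ∃ m : ℤ, y = z + m * (2 * B.h k) := by
  constructor
  · intro h
    have hwrap : B.wrap k y = B.wrap k z := congrArg Edge.y h
    obtain ⟨m, hm⟩ := B.wrap_eq_sub k y
    obtain ⟨n, hn⟩ := B.wrap_eq_sub k z
    exact ⟨m - n, by push_cast; linarith⟩
  · rintro ⟨m, rfl⟩
    have := B.wrap_sub_intCast_mul k (z + m * (2 * B.h k)) m
    rw [add_sub_cancel_right] at this
    exact Edge.ext rfl this.symm

lemma edgeAt_wrap_add (k : ℤ) (y c : ℝ) : B.edgeAt k (B.wrap k y + c) = B.edgeAt k (y + c) :=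
  Edge.ext rfl (B.wrap_wrap_add k y c)

lemma shift_edgeAt (a : ℝ) (k : ℤ) (y : ℝ) : B.shift a (B.edgeAt k y) = B.edgeAt k (y + a) :=
  Edge.ext rfl (B.wrap_wrap_add k y a)

lemma shift_symm_edgeAt (a : ℝ) (k : ℤ) (y : ℝ) :
    (B.shift a).symm (B.edgeAt k y) = B.edgeAt k (y - a) := by
  rw [Equiv.symm_apply_eq, shift_edgeAt, sub_add_cancel]

lemma Edge.mem_reflect (e : B.Edge) : e.y ∈ Ico (-(B.h (-e.k - 1))) (B.h (-e.k - 1)) := by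
  rw [h_reflect]
  exact e.mem

lemma exit_of_mem {e : B.Edge} (h : e.y ∈ Ico (-(B.h (e.k + 1))) (B.h (e.k + 1))) :
    B.exit e = B.edgeAt (e.k + 1) e.y :=
  (dif_pos h : B.exitFun e = _).trans (Edge.ext rfl (B.wrap_eq_self h).symm)

lemma exit_of_notMem {e : B.Edge} (h : e.y ∉ Ico (-(B.h (e.k + 1))) (B.h (e.k + 1))) :
    B.exit e = B.edgeAt (-e.k - 1) e.y :=
  (dif_neg h : B.exitFun e = _).trans (Edge.ext rfl (B.wrap_eq_self e.mem_reflect).symm)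

lemma exit_symm_of_mem {e : B.Edge} (h : e.y ∈ Ico (-(B.h (e.k - 1))) (B.h (e.k - 1))) :
    B.exit.symm e = B.edgeAt (e.k - 1) e.y :=
  (dif_pos h : B.exitInv e = _).trans (Edge.ext rfl (B.wrap_eq_self h).symm)

lemma exit_symm_of_notMem {e : B.Edge} (h : e.y ∉ Ico (-(B.h (e.k - 1))) (B.h (e.k - 1))) :
    B.exit.symm e = B.edgeAt (-e.k - 1) e.y :=
  (dif_neg h : B.exitInv e = _).trans (Edge.ext rfl (B.wrap_eq_self e.mem_reflect).symm)

@[simp] lemma exit_y (e : B.Edge) : (B.exit e).y = e.y := by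
  by_cases h : e.y ∈ Ico (-(B.h (e.k + 1))) (B.h (e.k + 1))
  · rw [exit_of_mem h, edgeAt_y_of_mem h]
  · rw [exit_of_notMem h, edgeAt_y_of_mem e.mem_reflect]

lemma exit_k_eq_add_one_iff (e : B.Edge) :
    (B.exit e).k = e.k + 1 ↔ e.y ∈ Ico (-(B.h (e.k + 1))) (B.h (e.k + 1)) := by
  refine ⟨fun h => ?_, fun h => by rw [exit_of_mem h, edgeAt_k]⟩
  by_contra hy
  rw [exit_of_notMem hy, edgeAt_k] at h
  rw [← h] at hy
  exact hy e.mem_reflect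

lemma exit_k_cases (e : B.Edge) : (B.exit e).k = e.k + 1 ∨ (B.exit e).k = -e.k - 1 := by
  by_cases h : e.y ∈ Ico (-(B.h (e.k + 1))) (B.h (e.k + 1))
  · exact .inl ((exit_k_eq_add_one_iff e).2 h)
  · exact .inr (by rw [exit_of_notMem h, edgeAt_k])

lemma exit_k_of_neg {e : B.Edge} (he : e.k < 0) : (B.exit e).k = e.k + 1 := by
  have hle := h_le_succ (B := B) he
  exact (exit_k_eq_add_one_iff e).2 ⟨by linarith [e.mem.1], by linarith [e.mem.2]⟩

lemma step_apply (a : ℝ) (e : B.Edge) : B.step a e = B.exit (B.edgeAt e.k (e.y + a)) := by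
  conv_lhs => rw [← edgeAt_k_y e]
  exact congrArg B.exit (shift_edgeAt a e.k e.y)

lemma step_symm_apply (a : ℝ) (e : B.Edge) :
    (B.step a).symm e = (B.shift a).symm (B.exit.symm e) := rfl

lemma step_y (a : ℝ) (e : B.Edge) : (B.step a e).y = B.wrap e.k (e.y + a) := by
  rw [step_apply, exit_y, edgeAt_y]

lemma step_k_eq_add_one_iff (a : ℝ) (e : B.Edge) : (B.step a e).k = e.k + 1 ↔
    B.wrap e.k (e.y + a) ∈ Ico (-(B.h (e.k + 1))) (B.h (e.k + 1)) := by
  rw [step_apply]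
  exact exit_k_eq_add_one_iff (B.edgeAt e.k (e.y + a))

lemma step_k_of_neg (a : ℝ) {e : B.Edge} (he : e.k < 0) : (B.step a e).k = e.k + 1 := by
  rw [step_apply]
  exact exit_k_of_neg (e := B.edgeAt e.k (e.y + a)) he

lemma step_k_cases (a : ℝ) (e : B.Edge) :
    (B.step a e).k = e.k + 1 ∨ 0 ≤ e.k ∧ (B.step a e).k = -e.k - 1 := by
  rcases lt_or_ge e.k 0 with he | he
  · exact .inl (step_k_of_neg a he)
  · rw [step_apply]
    exact (exit_k_cases (B.edgeAt e.k (e.y + a))).imp_right fun h => ⟨he, h⟩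

lemma step_symm_k_cases (a : ℝ) (e : B.Edge) :
    ((B.step a).symm e).k = e.k - 1 ∨ e.k < 0 ∧ ((B.step a).symm e).k = -e.k - 1 := by
  have := step_k_cases a ((B.step a).symm e)
  rw [Equiv.apply_symm_apply] at this
  omega

lemma step_symm_k_of_nonneg (a : ℝ) {e : B.Edge} (he : 0 ≤ e.k) :
    ((B.step a).symm e).k = e.k - 1 := by
  have := step_symm_k_cases a e
  omega

lemma step_symm_of_pos (a : ℝ) {e : B.Edge} (he : 0 < e.k) :
    (B.step a).symm e = B.edgeAt (e.k - 1) (e.y - a) := by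
  have hle := h_succ_le (B := B) (k := e.k - 1) (by omega)
  rw [sub_add_cancel] at hle
  rw [step_symm_apply, exit_symm_of_mem ⟨by linarith [e.mem.1], by linarith [e.mem.2]⟩,
    shift_symm_edgeAt]

/-! ### Ordinates modulo the heights -/

variable (B) in
/-- The additive group generated by the heights: ordinates along a line are well defined modulo
this group. -/
def heightGroup : Submodule ℤ ℝ := Submodule.span ℤ (range B.p)

lemma countable_heightGroup : (B.heightGroup : Set ℝ).Countable := by
  rw [heightGroup, ← Finsupp.range_linearCombination]
  exact countable_range (Finsupp.linearCombination ℤ B.p)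

lemma h_mem_heightGroup (k : ℤ) : B.h k ∈ B.heightGroup := by
  cases k <;> exact Submodule.subset_span (mem_range_self _)

lemma wrap_sub_mem_heightGroup (k : ℤ) (y : ℝ) : B.wrap k y - y ∈ B.heightGroup := by
  obtain ⟨m, hm⟩ := B.wrap_eq_sub k y
  have : B.wrap k y - y = (-2 * m) • B.h k := by
    rw [hm, zsmul_eq_mul]
    push_cast
    ring
  rw [this]
  exact zsmul_mem (h_mem_heightGroup k) _

lemma step_y_sub_mem_heightGroup (a : ℝ) (e : B.Edge) :
    (B.step a e).y - e.y - a ∈ B.heightGroup := by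
  have := wrap_sub_mem_heightGroup (B := B) e.k (e.y + a)
  rwa [← sub_sub, ← step_y] at this

lemma step_zpow_y_sub_mem_heightGroup (a : ℝ) (e : B.Edge) (n : ℤ) :
    ((B.step a ^ n) e).y - e.y - n * a ∈ B.heightGroup := by
  induction n using Int.induction_on with
  | zero => simp
  | succ n ih =>
    rw [perm_zpow_add_one_apply']
    convert add_mem ih (step_y_sub_mem_heightGroup a ((B.step a ^ (n : ℤ)) e)) using 1
    push_cast
    ring
  | pred n ih =>
    have hstep := step_y_sub_mem_heightGroup a ((B.step a ^ (-(n : ℤ) - 1)) e)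
    rw [← perm_zpow_add_one_apply', sub_add_cancel] at hstep
    convert sub_mem ih hstep using 1
    push_cast
    ring

variable (B) in
/-- Slopes with no nonzero integer multiple in the group of heights. Along a line of generic slope
no edge point is met twice, and no two points with ordinates in the group of heights occur. -/
def Generic (a : ℝ) : Prop := ∀ n : ℤ, n ≠ 0 → (n : ℝ) * a ∉ B.heightGroup

lemma Generic.step_zpow_apply_ne {a : ℝ} (ha : B.Generic a) (e : B.Edge) {m n : ℤ} (hmn : m ≠ n) :
    (B.step a ^ m) e ≠ (B.step a ^ n) e := by
  intro h
  apply ha (m - n) (sub_ne_zero.2 hmn)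
  have hm := step_zpow_y_sub_mem_heightGroup a e m
  rw [h] at hm
  convert sub_mem (step_zpow_y_sub_mem_heightGroup a e n) hm using 1
  push_cast
  ring

lemma Generic.step_zpow_y_notMem_heightGroup {a : ℝ} (ha : B.Generic a) {e : B.Edge} {n : ℤ}
    (hn : n ≠ 0) (he : e.y ∈ B.heightGroup) : ((B.step a ^ n) e).y ∉ B.heightGroup := by
  intro h
  apply ha n hn
  convert sub_mem (sub_mem h he) (step_zpow_y_sub_mem_heightGroup a e n) using 1
  ring

lemma countable_setOf_not_generic : {a | ¬ B.Generic a}.Countable := by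
  have hsub : {a | ¬ B.Generic a} ⊆ ⋃ n : ℤ, (fun x => x / n) '' (B.heightGroup : Set ℝ) := by
    intro a ha
    simp only [Generic, mem_ofPred_eq, not_forall, not_not] at ha
    obtain ⟨n, hn, hna⟩ := ha
    exact mem_iUnion.2 ⟨n, n * a, hna, mul_div_cancel_left₀ a (Int.cast_ne_zero.2 hn)⟩
  exact (countable_iUnion fun n => countable_heightGroup.image _).mono hsub

/-! ### The flow as a suspension of the step map -/

lemma Phase.ext {z w : B.Phase} (hX : z.X = w.X) (hY : z.Y = w.Y) : z = w :=
  Subtype.ext (Prod.ext hX hY)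

/-- An edge point viewed as a phase point on the left side of its rectangle. -/
def Edge.toPhase (e : B.Edge) : B.Phase :=
  ⟨(e.k, e.y), by simpa only [Int.floor_intCast] using e.mem⟩

@[simp] lemma toPhase_X (e : B.Edge) : e.toPhase.X = e.k := rfl

@[simp] lemma toPhase_Y (e : B.Edge) : e.toPhase.Y = e.y := rfl

section Along

variable (a : ℝ) (e : B.Edge) (s : ℝ) (hs : s ∈ Ico (0 : ℝ) 1)

lemma along_X : (B.along a e s hs).X = e.k + s := rfl

lemma along_Y : (B.along a e s hs).Y = B.wrap e.k (e.y + a * s) := rfl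

lemma floor_along : ⌊(B.along a e s hs).X⌋ = e.k := by
  rw [along_X, Int.floor_intCast_add, Int.floor_eq_zero_iff.2 hs, add_zero]

lemma fract_along : Int.fract (B.along a e s hs).X = s := by
  rw [along_X, Int.fract_intCast_add, Int.fract_eq_self.2 hs]

end Along

lemma along_congr {a : ℝ} {e f : B.Edge} {s t : ℝ} {hs : s ∈ Ico (0 : ℝ) 1}
    {ht : t ∈ Ico (0 : ℝ) 1} (hef : e = f) (hst : s = t) :
    B.along a e s hs = B.along a f t ht := by
  subst hef hst
  rfl

lemma base_k (a : ℝ) (z : B.Phase) : (B.base a z).k = ⌊z.X⌋ := rfl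

lemma abs_X_sub_base_k_le (a : ℝ) (z : B.Phase) : |z.X - (B.base a z).k| ≤ 1 := by
  rw [base_k, Int.self_sub_floor, abs_of_nonneg (Int.fract_nonneg _)]
  exact (Int.fract_lt_one _).le

lemma base_eq_edgeAt (a : ℝ) (z : B.Phase) :
    B.base a z = B.edgeAt ⌊z.X⌋ (z.Y - a * Int.fract z.X) := rfl

lemma base_along (a : ℝ) (e : B.Edge) (s : ℝ) (hs : s ∈ Ico (0 : ℝ) 1) :
    B.base a (B.along a e s hs) = e := by
  rw [base_eq_edgeAt, floor_along, fract_along, along_Y, sub_eq_add_neg, edgeAt_wrap_add,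
    add_neg_cancel_right, edgeAt_k_y]

lemma along_base (a : ℝ) (z : B.Phase) :
    B.along a (B.base a z) (Int.fract z.X) (fract_mem_Ico _) = z := by
  apply Phase.ext
  · exact Int.floor_add_fract z.X
  · change B.wrap ⌊z.X⌋ (B.wrap ⌊z.X⌋ (z.Y - a * Int.fract z.X) + a * Int.fract z.X) = z.Y
    rw [wrap_wrap_add, sub_add_cancel]
    exact B.wrap_eq_self z.2

lemma base_toPhase (a : ℝ) (e : B.Edge) : B.base a e.toPhase = e := by
  rw [base_eq_edgeAt, toPhase_X, toPhase_Y, Int.floor_intCast, Int.fract_intCast, mul_zero,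
    sub_zero, edgeAt_k_y]

lemma flow_eq (θ t : ℝ) (z : B.Phase) : B.flow θ t z = B.along (Real.tan θ)
    ((B.step (Real.tan θ) ^ ⌊Int.fract z.X + t * Real.cos θ⌋) (B.base (Real.tan θ) z))
    (Int.fract (Int.fract z.X + t * Real.cos θ)) (fract_mem_Ico _) := rfl

lemma base_flow (θ t : ℝ) (z : B.Phase) : B.base (Real.tan θ) (B.flow θ t z) =
    (B.step (Real.tan θ) ^ ⌊Int.fract z.X + t * Real.cos θ⌋) (B.base (Real.tan θ) z) :=
  base_along _ _ _ _

lemma flow_flow (θ s t : ℝ) (z : B.Phase) :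
    B.flow θ s (B.flow θ t z) = B.flow θ (t + s) z := by
  have hsplit : Int.fract z.X + (t + s) * Real.cos θ = (⌊Int.fract z.X + t * Real.cos θ⌋ : ℝ) +
      (Int.fract (Int.fract z.X + t * Real.cos θ) + s * Real.cos θ) := by
    have := Int.floor_add_fract (Int.fract z.X + t * Real.cos θ)
    linarith
  simp only [flow_eq]
  apply along_congr
  · rw [base_along, fract_along, hsplit, Int.floor_intCast_add, perm_zpow_zpow_apply, add_comm]
  · rw [fract_along, hsplit, Int.fract_intCast_add]

lemma flow_zero (θ : ℝ) (z : B.Phase) : B.flow θ 0 z = z := by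
  conv_rhs => rw [← along_base (Real.tan θ) z]
  rw [flow_eq]
  apply along_congr
  · rw [zero_mul, add_zero, Int.floor_fract, zpow_zero, Equiv.Perm.one_apply]
  · rw [zero_mul, add_zero, Int.fract_fract]

lemma flow_toPhase (θ t : ℝ) (e : B.Edge) : B.flow θ t e.toPhase =
    B.along (Real.tan θ) ((B.step (Real.tan θ) ^ ⌊t * Real.cos θ⌋) e) (Int.fract (t * Real.cos θ))
      (fract_mem_Ico _) := by
  rw [flow_eq]
  apply along_congr
  · rw [base_toPhase, toPhase_X, Int.fract_intCast, zero_add]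
  · rw [toPhase_X, Int.fract_intCast, zero_add]

lemma flow_int_toPhase {θ : ℝ} (hc : Real.cos θ ≠ 0) (n : ℤ) (e : B.Edge) :
    B.flow θ (n / Real.cos θ) e.toPhase = ((B.step (Real.tan θ) ^ n) e).toPhase := by
  rw [flow_toPhase]
  have hn : (n : ℝ) / Real.cos θ * Real.cos θ = n := div_mul_cancel₀ _ hc
  apply Phase.ext
  · rw [along_X, hn, Int.fract_intCast, Int.floor_intCast, toPhase_X, add_zero]
  · rw [along_Y, hn, Int.fract_intCast, Int.floor_intCast, toPhase_Y, mul_zero, add_zero]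
    exact B.wrap_eq_self (Edge.mem _)

lemma flow_base {θ : ℝ} (hc : Real.cos θ ≠ 0) (z : B.Phase) :
    B.flow θ (Int.fract z.X / Real.cos θ) (B.base (Real.tan θ) z).toPhase = z := by
  conv_rhs => rw [← along_base (Real.tan θ) z]
  rw [flow_toPhase]
  have hX : Int.fract z.X / Real.cos θ * Real.cos θ = Int.fract z.X := div_mul_cancel₀ _ hc
  apply along_congr
  · rw [hX, Int.floor_fract, zpow_zero, Equiv.Perm.one_apply]
  · rw [hX, Int.fract_fract]

lemma mem_orbit_self (θ : ℝ) (z : B.Phase) : z ∈ B.orbit θ z := ⟨0, flow_zero θ z⟩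

lemma orbit_eq_of_mem {θ : ℝ} {z w : B.Phase} (h : w ∈ B.orbit θ z) :
    B.orbit θ w = B.orbit θ z := by
  obtain ⟨t, rfl⟩ := h
  ext x
  constructor
  · rintro ⟨s, rfl⟩
    exact ⟨t + s, (flow_flow θ s t z).symm⟩
  · rintro ⟨s, rfl⟩
    exact ⟨s - t, by simp only [flow_flow, add_sub_cancel]⟩

lemma toPhase_base_mem_orbit {θ : ℝ} (hc : Real.cos θ ≠ 0) (z : B.Phase) :
    (B.base (Real.tan θ) z).toPhase ∈ B.orbit θ z := by
  have hz : z ∈ B.orbit θ (B.base (Real.tan θ) z).toPhase := ⟨_, flow_base hc z⟩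
  rw [orbit_eq_of_mem hz]
  exact mem_orbit_self θ _

lemma toPhase_mem_orbit {θ : ℝ} (hc : Real.cos θ ≠ 0) (n : ℤ) (z : B.Phase) :
    ((B.step (Real.tan θ) ^ n) (B.base (Real.tan θ) z)).toPhase ∈ B.orbit θ z := by
  rw [← orbit_eq_of_mem (toPhase_base_mem_orbit hc z)]
  exact ⟨n / Real.cos θ, flow_int_toPhase hc n _⟩

lemma mem_section0_iff {z : B.Phase} : z ∈ B.section0 ↔ z = (B.edgeAt 0 z.Y).toPhase := by
  constructor
  · intro hX
    have hX : z.1.1 = 0 := hX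
    have hY := z.2
    rw [hX, Int.floor_zero] at hY
    exact Phase.ext (hX.trans Int.cast_zero.symm) (edgeAt_y_of_mem hY).symm
  · intro h
    rw [h]
    simp [section0]

lemma toPhase_mem_section0_iff {e : B.Edge} : e.toPhase ∈ B.section0 ↔ e.k = 0 :=
  Int.cast_eq_zero (α := ℝ)

/-- The edge points from which the next `n` steps all go to the right. -/
def Direct (a : ℝ) (n : ℕ) (e : B.Edge) : Prop :=
  ∀ i ≤ n, ((B.step a ^ (i : ℤ)) e).k = e.k + i

lemma Direct.mono {a : ℝ} {m n : ℕ} (hmn : m ≤ n) {e : B.Edge} (h : Direct a n e) :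
    Direct a m e := fun i hi => h i (hi.trans hmn)

lemma Direct.step {a : ℝ} {n : ℕ} {e : B.Edge} (h : Direct a (n + 1) e) :
    (B.step a e).k = e.k + 1 ∧ Direct a n (B.step a e) := by
  have hk : (B.step a e).k = e.k + 1 := by simpa using h 1 (by omega)
  refine ⟨hk, fun i hi => ?_⟩
  have := h (i + 1) (by omega)
  rw [perm_zpow_natCast_succ_apply] at this
  rw [this, hk]
  push_cast
  ring

lemma mem_reach_iff {θ : ℝ} (hc : 0 < Real.cos θ) (n : ℕ) (e : B.Edge) :
    e.toPhase ∈ B.reach θ n ↔ e.k = 0 ∧ Direct (Real.tan θ) n e := by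
  refine (and_congr_left' toPhase_mem_section0_iff).trans (and_congr_right fun hk => ⟨?_, ?_⟩)
  · intro h i hi
    have hX := h (((i : ℤ) : ℝ) / Real.cos θ) ⟨by positivity, by rw [Int.cast_natCast]; gcongr⟩
    rw [flow_int_toPhase hc.ne', toPhase_X, div_mul_cancel₀ _ hc.ne'] at hX
    rw [hk, zero_add]
    exact_mod_cast hX
  · intro h t ht
    obtain ⟨i, hi⟩ := Int.eq_ofNat_of_zero_le (Int.floor_nonneg.2 (mul_nonneg ht.1 hc.le))
    have hin : i ≤ n := by
      have : (⌊t * Real.cos θ⌋ : ℝ) ≤ n := (Int.floor_le _).trans ((le_div_iff₀ hc).1 ht.2)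
      rw [hi] at this
      exact_mod_cast this
    rw [flow_toPhase, along_X, hi, h i hin, hk, zero_add, ← hi]
    exact Int.floor_add_fract _

/-- The points of `L` that reach every aperture directly, in terms of the step map. -/
def Escaping (a : ℝ) (e : B.Edge) : Prop := ∀ i : ℕ, ((B.step a ^ (i : ℤ)) e).k = i

lemma Escaping.k_eq_zero {a : ℝ} {e : B.Edge} (h : Escaping a e) : e.k = 0 := h 0

lemma Escaping.direct_step_zpow {a : ℝ} {e : B.Edge} (h : Escaping a e) (l n : ℕ) :
    Direct a n ((B.step a ^ (l : ℤ)) e) := by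
  intro i _
  have hk := h (i + l)
  push_cast at hk
  rw [perm_zpow_zpow_apply, hk, h, add_comm]

lemma escaping_iff {a : ℝ} {e : B.Edge} : Escaping a e ↔ e.k = 0 ∧ ∀ n, Direct a n e :=
  ⟨fun h => ⟨h.k_eq_zero, h.direct_step_zpow 0⟩,
    fun ⟨hk, h⟩ i => by rw [h i i le_rfl, hk, zero_add]⟩

lemma toPhase_mem_escapePoints_iff {θ : ℝ} (hc : 0 < Real.cos θ) {e : B.Edge} :
    e.toPhase ∈ B.escapePoints θ ↔ Escaping (Real.tan θ) e := by
  simp only [escapePoints, mem_iInter, mem_reach_iff hc, forall_and, forall_const, escaping_iff]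

/-! ### Measure of the slopes for which a point moves directly to the right -/

/-- Edge points `e a` of the `j`-th rectangle that depend on the slope `a ∈ A` through finitely
many affine functions `N * a - c`, `c ∈ S`, as the `N`-th iterates of a fixed edge point do. -/
structure AffineOn (A : Set ℝ) (e : ℝ → B.Edge) (j N : ℕ) (S : Finset ℝ) : Prop where
  k_eq : ∀ a ∈ A, (e a).k = j
  y_eq : ∀ a ∈ A, ∃ c ∈ S, (e a).y = N * a - c

section Decay

variable {lam : ℝ}

lemma pos_of_p_succ_le (hp : ∀ n, B.p (n + 1) ≤ lam * B.p n) : 0 < lam :=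
  pos_of_mul_pos_left ((B.p_pos 1).trans_le (hp 0)) (B.p_pos 0).le

lemma p_add_le (hp : ∀ n, B.p (n + 1) ≤ lam * B.p n) (j i : ℕ) :
    B.p (j + i) ≤ lam ^ i * B.p j := by
  have hlam := pos_of_p_succ_le hp
  induction i with
  | zero => simp
  | succ i ih =>
    calc B.p (j + i + 1) ≤ lam * B.p (j + i) := hp _
      _ ≤ lam * (lam ^ i * B.p j) := by gcongr
      _ = lam ^ (i + 1) * B.p j := by ring

-- The previous ordinate `N * a - c` confines `a`, and thereby the number of turns `i`, to an
-- interval around the value for which `N * a = c`.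
lemma exists_mem_Icc_step_y_eq {j : ℕ} (hp : B.p (j + 1) ≤ lam * B.p j) {a c : ℝ} {e : B.Edge}
    {N : ℕ} (hN : 1 ≤ N) (hk : e.k = j) (hy : e.y = N * a - c) (hright : (B.step a e).k = j + 1) :
    ∃ i ∈ Finset.Icc ⌈c / (2 * B.p j * N) - (1 + 1 / (N : ℝ) + lam) / 2⌉
        ⌊c / (2 * B.p j * N) + (1 + 1 / (N : ℝ) + lam) / 2⌋,
      (B.step a e).y = (N + 1 : ℕ) * a - (c + i * (2 * B.p j)) := by
  have hH : 0 < B.p j := B.p_pos j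
  have : (0 : ℝ) < N := by exact_mod_cast hN
  obtain ⟨i, hi⟩ := B.wrap_eq_sub j (e.y + a)
  have hstep : (B.step a e).y = N * a - c + a - i * (2 * B.p j) := by
    rw [step_y, hk, hi, hy, h_natCast]
  refine ⟨i, ?_, by rw [hstep]; push_cast; ring⟩
  have hmem := e.mem
  rw [hk, h_natCast, hy] at hmem
  have hmem_step := (B.step a e).mem
  rw [hright, h_natCast_add_one, hstep] at hmem_step
  have hscale : ((N : ℝ) + 1) * a - c - c / N = (1 + 1 / N) * (N * a - c) := by
    field_simp
    ring
  have hN₁ : (0 : ℝ) ≤ 1 + 1 / N := by positivity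
  have hlower := mul_le_mul_of_nonneg_left hmem.1 hN₁
  have hupper := mul_le_mul_of_nonneg_left hmem.2.le hN₁
  have hc : c / (2 * B.p j * N) * (2 * B.p j) = c / N := by field_simp
  refine Finset.mem_Icc.2 ⟨Int.ceil_le.2 ?_, Int.le_floor.2 ?_⟩ <;>
    refine le_of_mul_le_mul_right (a := 2 * B.p j) ?_ (by positivity)
  · rw [sub_mul, hc]
    linarith [hmem_step.2]
  · rw [add_mul, hc]
    linarith [hmem_step.1]

lemma exists_natCast_mul_le_and_lt (hlam : lam < 1 / 2) {N : ℕ} (hN : 1 ≤ N) :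
    ∃ K : ℕ, N * K ≤ 2 * (N + 1) ∧ 1 + 1 / (N : ℝ) + lam < K := by
  obtain rfl | hN := hN.eq_or_lt
  · exact ⟨3, by norm_num, by norm_num; linarith⟩
  · refine ⟨2, by omega, ?_⟩
    have hN' : (2 : ℝ) ≤ N := by exact_mod_cast hN
    have : 1 / (N : ℝ) ≤ 1 / 2 := one_div_le_one_div_of_le (by norm_num) hN'
    push_cast
    linarith

lemma AffineOn.exists_step (hlam : lam < 1 / 2) {j : ℕ} (hp : B.p (j + 1) ≤ lam * B.p j)
    {A : Set ℝ} {e : ℝ → B.Edge} {N : ℕ} (hN : 1 ≤ N) {S : Finset ℝ} (h : AffineOn A e j N S) :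
    ∃ S' : Finset ℝ, N * S'.card ≤ 2 * (N + 1) * S.card ∧
      AffineOn {a | a ∈ A ∧ (B.step a (e a)).k = j + 1} (fun a => B.step a (e a)) (j + 1) (N + 1)
        S' := by
  classical
  obtain ⟨K, hK, hlt⟩ := exists_natCast_mul_le_and_lt hlam hN
  let r : ℝ := (1 + 1 / (N : ℝ) + lam) / 2
  let I : ℝ → Finset ℤ := fun c =>
    Finset.Icc ⌈c / (2 * B.p j * N) - r⌉ ⌊c / (2 * B.p j * N) + r⌋
  let S' := S.biUnion fun c => (I c).image fun i : ℤ => c + i * (2 * B.p j)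
  refine ⟨S', ?_, fun a ha => by exact_mod_cast ha.2, fun a ha => ?_⟩
  · have hcard : S'.card ≤ S.card * K :=
      Finset.card_biUnion_le_card_mul _ _ _ fun c _ =>
        Finset.card_image_le.trans (card_Icc_ceil_floor_le (by simp only [r]; linarith))
    calc N * S'.card ≤ N * (S.card * K) := Nat.mul_le_mul_left _ hcard
      _ = N * K * S.card := by ring
      _ ≤ 2 * (N + 1) * S.card := Nat.mul_le_mul_right _ hK
  · obtain ⟨c, hc, hy⟩ := h.y_eq a ha.1
    obtain ⟨i, hi, hstep⟩ := exists_mem_Icc_step_y_eq hp hN (h.k_eq a ha.1) hy ha.2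
    exact ⟨_, Finset.mem_biUnion.2 ⟨c, hc, Finset.mem_image_of_mem _ hi⟩, hstep⟩

lemma AffineOn.exists_iterate (hlam : lam < 1 / 2) (hp : ∀ n, B.p (n + 1) ≤ lam * B.p n)
    {A : Set ℝ} {e : ℝ → B.Edge} {j N : ℕ} (hN : 1 ≤ N) {S : Finset ℝ} (h : AffineOn A e j N S)
    (i : ℕ) :
    ∃ S' : Finset ℝ, N * S'.card ≤ 2 ^ i * (N + i) * S.card ∧
      AffineOn {a | a ∈ A ∧ Direct a i (e a)} (fun a => (B.step a ^ (i : ℤ)) (e a)) (j + i) (N + i)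
        S' := by
  induction i with
  | zero =>
    exact ⟨S, by simp, fun a ha => by simpa using h.k_eq a ha.1,
      fun a ha => by simpa using h.y_eq a ha.1⟩
  | succ i ih =>
    obtain ⟨S₁, hS₁, h₁⟩ := ih
    obtain ⟨S₂, hS₂, h₂⟩ := h₁.exists_step hlam (hp _) (by omega)
    have hk : ∀ a, a ∈ A ∧ Direct a (i + 1) (e a) →
        ((B.step a ^ ((i + 1 : ℕ) : ℤ)) (e a)).k = ((j + i : ℕ) : ℤ) + 1 := fun a ha => by
      rw [ha.2 (i + 1) le_rfl, h.k_eq a ha.1]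
      push_cast
      ring
    refine ⟨S₂, ?_, fun a ha => by exact_mod_cast hk a ha, fun a ha => ?_⟩
    · refine le_of_mul_le_mul_left ?_ (by omega : 0 < N + i)
      calc (N + i) * (N * S₂.card) = N * ((N + i) * S₂.card) := by ring
        _ ≤ N * (2 * (N + i + 1) * S₁.card) := Nat.mul_le_mul_left _ hS₂
        _ = 2 * (N + i + 1) * (N * S₁.card) := by ring
        _ ≤ 2 * (N + i + 1) * (2 ^ i * (N + i) * S.card) := Nat.mul_le_mul_left _ hS₁
        _ = (N + i) * (2 ^ (i + 1) * (N + (i + 1)) * S.card) := by ring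
    · have hright := hk a ha
      rw [perm_zpow_natCast_succ_apply'] at hright ⊢
      exact h₂.y_eq a ⟨⟨ha.1, ha.2.mono (Nat.le_succ i)⟩, hright⟩

lemma AffineOn.volume_le {A : Set ℝ} {e : ℝ → B.Edge} {j N : ℕ} (hN : 1 ≤ N) {S : Finset ℝ}
    (h : AffineOn A e j N S) : volume A ≤ ENNReal.ofReal (2 * B.p j * S.card / N) := by
  have hN₀ : (0 : ℝ) < N := by exact_mod_cast hN
  have : 0 < B.p j := B.p_pos j
  have hsub : A ⊆ ⋃ c ∈ S, Ico ((c - B.p j) / N) ((c + B.p j) / N) := by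
    intro a ha
    obtain ⟨c, hc, hy⟩ := h.y_eq a ha
    have hmem := (e a).mem
    rw [h.k_eq a ha, hy, h_natCast] at hmem
    exact mem_iUnion₂.2 ⟨c, hc, (div_le_iff₀ hN₀).2 (by linarith [hmem.1]),
      (lt_div_iff₀ hN₀).2 (by linarith [hmem.2])⟩
  calc volume A ≤ ∑ c ∈ S, volume (Ico ((c - B.p j) / N) ((c + B.p j) / N)) :=
        (measure_mono hsub).trans (measure_biUnion_finset_le _ _)
    _ = ∑ c ∈ S, ENNReal.ofReal (2 * B.p j / N) := by
        refine Finset.sum_congr rfl fun c _ => ?_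
        rw [Real.volume_Ico]
        congr 1
        ring
    _ = ENNReal.ofReal (2 * B.p j * S.card / N) := by
        rw [Finset.sum_const, nsmul_eq_mul, ← ENNReal.ofReal_natCast,
          ← ENNReal.ofReal_mul (by positivity)]
        congr 1
        ring

lemma AffineOn.volume_direct_le (hlam : lam < 1 / 2) (hp : ∀ n, B.p (n + 1) ≤ lam * B.p n)
    {A : Set ℝ} {e : ℝ → B.Edge} {j N : ℕ} (hN : 1 ≤ N) {S : Finset ℝ} (h : AffineOn A e j N S)
    (i : ℕ) :
    volume {a | a ∈ A ∧ Direct a i (e a)} ≤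
      ENNReal.ofReal (2 * B.p j * S.card / N * (2 * lam) ^ i) := by
  obtain ⟨S', hS', h'⟩ := h.exists_iterate hlam hp hN i
  refine (h'.volume_le (by omega)).trans (ENNReal.ofReal_le_ofReal ?_)
  have : (0 : ℝ) < N := by exact_mod_cast hN
  have : (0 : ℝ) < (N + i : ℕ) := by exact_mod_cast (by omega : 0 < N + i)
  have hcard : (N : ℝ) * S'.card ≤ 2 ^ i * (N + i : ℕ) * S.card := by exact_mod_cast hS'
  have hH : 0 < B.p (j + i) := B.p_pos _
  calc 2 * B.p (j + i) * S'.card / (N + i : ℕ)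
      = (N * S'.card) * (2 * B.p (j + i) / ((N + i : ℕ) * N)) := by field_simp
    _ ≤ (2 ^ i * (N + i : ℕ) * S.card) * (2 * B.p (j + i) / ((N + i : ℕ) * N)) := by gcongr
    _ = 2 ^ i * S.card * 2 / N * B.p (j + i) := by field_simp
    _ ≤ 2 ^ i * S.card * 2 / N * (lam ^ i * B.p j) := by
        gcongr
        exact p_add_le hp j i
    _ = 2 * B.p j * S.card / N * (2 * lam) ^ i := by
        rw [mul_pow]
        ring

lemma AffineOn.volume_forall_direct_eq_zero (hlam : lam < 1 / 2)
    (hp : ∀ n, B.p (n + 1) ≤ lam * B.p n) {A : Set ℝ} {e : ℝ → B.Edge} {j N : ℕ} (hN : 1 ≤ N)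
    {S : Finset ℝ} (h : AffineOn A e j N S) :
    volume {a | a ∈ A ∧ ∀ i, Direct a i (e a)} = 0 := by
  have hlam₀ := pos_of_p_succ_le hp
  have hlim : Tendsto (fun i : ℕ => ENNReal.ofReal (2 * B.p j * S.card / N * (2 * lam) ^ i)) atTop
      (𝓝 0) := by
    have := (tendsto_pow_atTop_nhds_zero_of_lt_one (r := 2 * lam) (by linarith)
      (by linarith)).const_mul (2 * B.p j * S.card / N)
    rw [mul_zero] at this
    simpa using ENNReal.tendsto_ofReal this
  refine le_antisymm (ge_of_tendsto' hlim fun i => ?_) zero_le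
  refine (measure_mono ?_).trans (h.volume_direct_le hlam hp hN i)
  exact fun a ha => ⟨ha.1, ha.2 i⟩

lemma volume_forall_direct_step_zpow_eq_zero (hlam : lam < 1 / 2)
    (hp : ∀ n, B.p (n + 1) ≤ lam * B.p n) (e : B.Edge) {m : ℕ} (hm : 1 ≤ m) :
    volume {a | 0 ≤ ((B.step a ^ (m : ℤ)) e).k ∧
      ∀ i, Direct a i ((B.step a ^ (m : ℤ)) e)} = 0 := by
  let A (j : ℕ) (d : B.heightGroup) : Set ℝ :=
    {a | ((B.step a ^ (m : ℤ)) e).k = j ∧ ((B.step a ^ (m : ℤ)) e).y = m * a - (-e.y - d)}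
  have hA : ∀ j d, AffineOn (A j d) (fun a => (B.step a ^ (m : ℤ)) e) j m {-e.y - (d : ℝ)} :=
    fun j d => ⟨fun a ha => ha.1, fun a ha => ⟨_, Finset.mem_singleton_self _, ha.2⟩⟩
  have hsub : {a | 0 ≤ ((B.step a ^ (m : ℤ)) e).k ∧ ∀ i, Direct a i ((B.step a ^ (m : ℤ)) e)} ⊆
      ⋃ j, ⋃ d, {a | a ∈ A j d ∧ ∀ i, Direct a i ((B.step a ^ (m : ℤ)) e)} := by
    rintro a ⟨hk, hdirect⟩
    obtain ⟨j, hj⟩ := Int.eq_ofNat_of_zero_le hk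
    refine mem_iUnion₂.2 ⟨j, ⟨_, step_zpow_y_sub_mem_heightGroup a e m⟩, ⟨hj, ?_⟩, hdirect⟩
    push_cast
    ring
  have : Countable B.heightGroup := countable_heightGroup
  exact measure_mono_null hsub (measure_iUnion_null fun j => measure_iUnion_null fun d =>
    (hA j d).volume_forall_direct_eq_zero hlam hp hm)

variable (B) in
/-- The vertex at the bottom of the left side of the `k`-th rectangle, as an edge point. -/
def lowerVertex (k : ℕ) : B.Edge := B.edgeAt k (-B.p k)

lemma lowerVertex_y (k : ℕ) : (B.lowerVertex k).y = -B.p k :=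
  edgeAt_y_of_mem ⟨by rw [h_natCast], by rw [h_natCast]; linarith [B.p_pos k]⟩

lemma exists_affineOn_step_lowerVertex {α β : ℝ} (hαβ : α ≤ β) (k : ℕ) :
    ∃ S : Finset ℝ, (S.card : ℝ) ≤ (β - α) / (2 * B.p k) + 2 ∧
      AffineOn {a | a ∈ Icc α β ∧ (B.step a (B.lowerVertex k)).k = k + 1}
        (fun a => B.step a (B.lowerVertex k)) (k + 1) 1 S := by
  classical
  have hH : 0 < B.p k := B.p_pos k
  have hq : 0 < B.p (k + 1) := B.p_pos _
  let x := (α - B.p k - B.p (k + 1)) / (2 * B.p k)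
  let y := (β - B.p k + B.p (k + 1)) / (2 * B.p k)
  have hxy : y - x = (β - α) / (2 * B.p k) + B.p (k + 1) / B.p k := by
    simp only [x, y]
    field_simp
    ring
  let S : Finset ℝ := (Finset.Icc ⌈x⌉ ⌊y⌋).image fun i : ℤ => B.p k + i * (2 * B.p k)
  refine ⟨S, ?_, fun a ha => by exact_mod_cast ha.2, ?_⟩
  · have hcard : (S.card : ℝ) ≤ ⌊y - x⌋₊ + 1 := by
      exact_mod_cast Finset.card_image_le.trans
        (card_Icc_ceil_floor_le (by push_cast; exact Nat.lt_floor_add_one (y - x)))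
    have hratio : B.p (k + 1) / B.p k ≤ 1 := (div_le_one hH).2 (B.p_anti (Nat.le_succ k))
    have hnonneg : 0 ≤ y - x := by
      have := sub_nonneg.2 hαβ
      rw [hxy]
      positivity
    linarith [Nat.floor_le hnonneg]
  · rintro a ⟨ha, hright⟩
    obtain ⟨l, hl⟩ := B.wrap_eq_sub k (-B.p k + a)
    have hy : (B.step a (B.lowerVertex k)).y = -B.p k + a - l * (2 * B.p k) := by
      rw [step_y, lowerVertex_y]
      exact hl
    have hmem := (B.step a (B.lowerVertex k)).mem
    rw [hright, h_natCast_add_one, hy] at hmem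
    refine ⟨_, Finset.mem_image_of_mem _ (Finset.mem_Icc.2
      ⟨Int.ceil_le.2 ?_, Int.le_floor.2 ?_⟩), by rw [hy]; push_cast; ring⟩
    · exact (div_le_iff₀ (by positivity)).2 (by linarith [hmem.2, ha.1])
    · exact (le_div_iff₀ (by positivity)).2 (by linarith [hmem.1, ha.2])

lemma volume_direct_lowerVertex_le (hlam : lam < 1 / 2) (hp : ∀ n, B.p (n + 1) ≤ lam * B.p n)
    {α β : ℝ} (hαβ : α ≤ β) (k i : ℕ) :
    volume {a | a ∈ Icc α β ∧ Direct a (i + 1) (B.lowerVertex k)} ≤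
      ENNReal.ofReal (lam * (β - α + 4 * B.p k) * (2 * lam) ^ i) := by
  have hlam₀ := pos_of_p_succ_le hp
  have hH : 0 < B.p k := B.p_pos k
  obtain ⟨S, hcard, hS⟩ := exists_affineOn_step_lowerVertex (B := B) hαβ k
  calc volume {a | a ∈ Icc α β ∧ Direct a (i + 1) (B.lowerVertex k)}
      ≤ volume {a | (a ∈ Icc α β ∧ (B.step a (B.lowerVertex k)).k = k + 1) ∧
          Direct a i (B.step a (B.lowerVertex k))} :=
        measure_mono fun a ha => ⟨⟨ha.1, ha.2.step.1⟩, ha.2.step.2⟩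
    _ ≤ ENNReal.ofReal (2 * B.p (k + 1) * S.card / (1 : ℕ) * (2 * lam) ^ i) :=
        hS.volume_direct_le hlam hp le_rfl i
    _ ≤ ENNReal.ofReal (2 * (lam * B.p k) * ((β - α) / (2 * B.p k) + 2) / (1 : ℕ) *
          (2 * lam) ^ i) := by
        gcongr
        exact hp k
    _ = ENNReal.ofReal (lam * (β - α + 4 * B.p k) * (2 * lam) ^ i) := by
        congr 1
        rw [Nat.cast_one]
        field_simp
        ring

variable (B) in
/-- No vertex to the left of the `m`-th aperture reaches it directly. -/
def Clear (a : ℝ) (m : ℕ) : Prop := ∀ k < m, ¬ Direct a (m - k) (B.lowerVertex k)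

lemma sum_lowerVertex_bound_le (hlam : lam < 1 / 2) (hp : ∀ n, B.p (n + 1) ≤ lam * B.p n)
    {δ : ℝ} (hδ : 0 ≤ δ) (m : ℕ) :
    ∑ k ∈ Finset.range m, lam * (δ + 4 * B.p k) * (2 * lam) ^ (m - 1 - k) ≤
      lam / (1 - 2 * lam) * δ + 4 * lam * (m * (2 * lam) ^ (m - 1)) := by
  have hlam₀ := pos_of_p_succ_le hp
  have hterm : ∀ k ∈ Finset.range m, lam * (δ + 4 * B.p k) * (2 * lam) ^ (m - 1 - k) ≤
      lam * δ * (2 * lam) ^ (m - 1 - k) + 4 * lam * (2 * lam) ^ (m - 1) := fun k hk => by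
    have hpk : B.p k ≤ (2 * lam) ^ k := by
      have := p_add_le hp 0 k
      rw [zero_add, B.p_zero, mul_one] at this
      exact this.trans (pow_le_pow_left₀ hlam₀.le (by linarith) _)
    have hsplit : (2 * lam) ^ (m - 1) = (2 * lam) ^ k * (2 * lam) ^ (m - 1 - k) := by
      have := Finset.mem_range.1 hk
      rw [← pow_add]
      congr 1
      omega
    calc lam * (δ + 4 * B.p k) * (2 * lam) ^ (m - 1 - k)
        ≤ lam * (δ + 4 * (2 * lam) ^ k) * (2 * lam) ^ (m - 1 - k) := by gcongr
      _ = lam * δ * (2 * lam) ^ (m - 1 - k) + 4 * lam * (2 * lam) ^ (m - 1) := by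
          rw [hsplit]
          ring
  calc _ ≤ ∑ k ∈ Finset.range m,
        (lam * δ * (2 * lam) ^ (m - 1 - k) + 4 * lam * (2 * lam) ^ (m - 1)) :=
        Finset.sum_le_sum hterm
    _ = lam * δ * ∑ i ∈ Finset.range m, (2 * lam) ^ i + 4 * lam * (m * (2 * lam) ^ (m - 1)) := by
        rw [Finset.sum_add_distrib, Finset.sum_const, Finset.card_range, nsmul_eq_mul,
          ← Finset.mul_sum, Finset.sum_range_reflect (fun i => (2 * lam) ^ i) m]
        ring
    _ ≤ lam * δ * (1 - 2 * lam)⁻¹ + 4 * lam * (m * (2 * lam) ^ (m - 1)) := by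
        gcongr
        exact geom_sum_le_inv_one_sub (by positivity) (by linarith) m
    _ = lam / (1 - 2 * lam) * δ + 4 * lam * (m * (2 * lam) ^ (m - 1)) := by
        rw [div_eq_mul_inv]
        ring

lemma volume_not_clear_le (hlam : lam < 1 / 2) (hp : ∀ n, B.p (n + 1) ≤ lam * B.p n)
    {α β : ℝ} (hαβ : α ≤ β) (m : ℕ) :
    volume {a | a ∈ Icc α β ∧ ¬ B.Clear a m} ≤
      ENNReal.ofReal (lam / (1 - 2 * lam) * (β - α) + 4 * lam * (m * (2 * lam) ^ (m - 1))) := by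
  have hlam₀ := pos_of_p_succ_le hp
  have hδ := sub_nonneg.2 hαβ
  have hsub : {a | a ∈ Icc α β ∧ ¬ B.Clear a m} ⊆
      ⋃ k ∈ Finset.range m, {a | a ∈ Icc α β ∧ Direct a (m - 1 - k + 1) (B.lowerVertex k)} := by
    rintro a ⟨ha, h⟩
    simp only [Clear, not_forall, not_not] at h
    obtain ⟨k, hk, hdirect⟩ := h
    refine mem_iUnion₂.2 ⟨k, Finset.mem_range.2 hk, ha, ?_⟩
    rwa [show m - 1 - k + 1 = m - k by omega]
  calc _ ≤ ∑ k ∈ Finset.range m,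
          volume {a | a ∈ Icc α β ∧ Direct a (m - 1 - k + 1) (B.lowerVertex k)} :=
        (measure_mono hsub).trans (measure_biUnion_finset_le _ _)
    _ ≤ ∑ k ∈ Finset.range m,
          ENNReal.ofReal (lam * (β - α + 4 * B.p k) * (2 * lam) ^ (m - 1 - k)) :=
        Finset.sum_le_sum fun k _ => volume_direct_lowerVertex_le hlam hp hαβ k _
    _ = ENNReal.ofReal (∑ k ∈ Finset.range m,
          lam * (β - α + 4 * B.p k) * (2 * lam) ^ (m - 1 - k)) :=
        (ENNReal.ofReal_sum_of_nonneg fun k _ => by have := B.p_pos k; positivity).symm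
    _ ≤ _ := ENNReal.ofReal_le_ofReal (sum_lowerVertex_bound_le hlam hp hδ m)

-- For `lam < 1/3` the limiting proportion `lam / (1 - 2 * lam)` of bad slopes is less than `1`.
lemma ae_frequently_clear (hlam : lam < 1 / 3) (hp : ∀ n, B.p (n + 1) ≤ lam * B.p n) :
    ∀ᵐ a : ℝ, ∃ᶠ m in atTop, B.Clear a m := by
  have hlam₀ := pos_of_p_succ_le hp
  have hsub : {a : ℝ | ¬ ∃ᶠ m in atTop, B.Clear a m} ⊆ ⋃ N : ℕ, {a | ∀ m ≥ N, ¬ B.Clear a m} :=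
    fun a ha => mem_iUnion.2 (eventually_atTop.1 (not_frequently.1 ha))
  refine measure_mono_null hsub (measure_iUnion_null fun N => ?_)
  refine measure_eq_zero_of_forall_inter_closedBall_le volume
    (c := ENNReal.ofReal (lam / (1 - 2 * lam))) ?_ fun x r hr => ?_
  · rw [ENNReal.ofReal_lt_one, div_lt_one (by linarith)]
    linarith
  · rw [Real.volume_closedBall, ← ENNReal.ofReal_mul' (by positivity)]
    have hlim : Tendsto (fun m : ℕ => ENNReal.ofReal (lam / (1 - 2 * lam) * ((x + r) - (x - r)) +
        4 * lam * (m * (2 * lam) ^ (m - 1)))) atTop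
        (𝓝 (ENNReal.ofReal (lam / (1 - 2 * lam) * (2 * r)))) := by
      have := ((tendsto_self_mul_const_pow_sub_one_of_lt_one (r := 2 * lam) (by positivity)
        (by linarith)).const_mul (4 * lam)).const_add (lam / (1 - 2 * lam) * ((x + r) - (x - r)))
      rw [mul_zero, add_zero] at this
      convert ENNReal.tendsto_ofReal this using 4
      ring
    refine ge_of_tendsto hlim ?_
    filter_upwards [eventually_ge_atTop N] with m hm
    refine (measure_mono ?_).trans (volume_not_clear_le (by linarith) hp (by linarith) m)
    rintro a ⟨ha, hball⟩
    rw [Real.closedBall_eq_Icc] at hball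
    exact ⟨hball, ha m hm⟩

end Decay

/-! ### Translations along edges and discontinuities -/

/-- Vertical translation of an edge point along the circle carrying it. -/
def Edge.translate (e : B.Edge) (t : ℝ) : B.Edge := B.edgeAt e.k (e.y + t)

@[simp] lemma translate_k (e : B.Edge) (t : ℝ) : (e.translate t).k = e.k := rfl

lemma translate_y_of_mem {e : B.Edge} {t : ℝ} (h : e.y + t ∈ Ico (-(B.h e.k)) (B.h e.k)) :
    (e.translate t).y = e.y + t :=
  edgeAt_y_of_mem h

@[simp] lemma translate_edgeAt (k : ℤ) (y t : ℝ) :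
    (B.edgeAt k y).translate t = B.edgeAt k (y + t) :=
  edgeAt_wrap_add k y t

lemma translate_translate (e : B.Edge) (s t : ℝ) :
    (e.translate s).translate t = e.translate (s + t) := by
  rw [Edge.translate.eq_1 e s, translate_edgeAt, Edge.translate, add_assoc]

@[simp] lemma translate_zero (e : B.Edge) : e.translate 0 = e := by
  rw [Edge.translate, add_zero, edgeAt_k_y]

lemma translate_injOn {e : B.Edge} {s t : ℝ} (h : e.translate s = e.translate t)
    (hst : |s - t| < 2 * B.h e.k) : s = t := by
  obtain ⟨m, hm⟩ := edgeAt_eq_edgeAt_iff.1 h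
  have hsub : s - t = m * (2 * B.h e.k) := by linarith
  rw [hsub, abs_mul, abs_of_pos (B.two_h_pos _), mul_lt_iff_lt_one_left (B.two_h_pos _)] at hst
  have hm₀ : m = 0 := Int.abs_lt_one_iff.1 (by exact_mod_cast hst)
  rwa [hm₀, Int.cast_zero, zero_mul, sub_eq_zero] at hsub

lemma shift_translate (a : ℝ) (e : B.Edge) (t : ℝ) :
    B.shift a (e.translate t) = (B.shift a e).translate t := by
  conv_rhs => rw [← edgeAt_k_y e]
  rw [shift_edgeAt, translate_edgeAt, Edge.translate, shift_edgeAt, add_right_comm]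

lemma shift_symm_translate (a : ℝ) (e : B.Edge) (t : ℝ) :
    (B.shift a).symm (e.translate t) = ((B.shift a).symm e).translate t := by
  rw [Equiv.symm_apply_eq, shift_translate, Equiv.apply_symm_apply]

open Classical in
variable (B) in
/-- Passing from the `k`-th rectangle to the rectangle `s k` where this is open, and jumping to the
opposite rectangle elsewhere; this covers `exit` and its inverse. -/
def jump (s : ℤ → ℤ) (e : B.Edge) : B.Edge :=
  if e.y ∈ Ico (-(B.h (s e.k))) (B.h (s e.k)) then B.edgeAt (s e.k) e.y else B.edgeAt (-e.k - 1) e.y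

lemma exit_eq_jump (e : B.Edge) : B.exit e = B.jump (· + 1) e := by
  unfold jump
  split_ifs with h
  · exact exit_of_mem h
  · exact exit_of_notMem h

lemma exit_symm_eq_jump (e : B.Edge) : B.exit.symm e = B.jump (· - 1) e := by
  unfold jump
  split_ifs with h
  · exact exit_symm_of_mem h
  · exact exit_symm_of_notMem h

lemma step_eq_jump (a : ℝ) (e : B.Edge) : B.step a e = B.jump (· + 1) (B.shift a e) :=
  exit_eq_jump _

lemma step_symm_eq_jump (a : ℝ) (e : B.Edge) :
    (B.step a).symm e = (B.shift a).symm (B.jump (· - 1) e) := by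
  rw [← exit_symm_eq_jump, step_symm_apply]

lemma jump_translate_of_mem_iff {s : ℤ → ℤ} {e : B.Edge} {t : ℝ}
    (hmem : e.y + t ∈ Ico (-(B.h e.k)) (B.h e.k))
    (hiff : e.y + t ∈ Ico (-(B.h (s e.k))) (B.h (s e.k)) ↔
      e.y ∈ Ico (-(B.h (s e.k))) (B.h (s e.k))) :
    B.jump s (e.translate t) = (B.jump s e).translate t := by
  unfold jump
  rw [translate_y_of_mem hmem, translate_k]
  simp only [hiff]
  split_ifs <;> rw [translate_edgeAt]

variable (B) in
/-- The edge points at which `jump s` may be discontinuous. -/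
def cut (s : ℤ → ℤ) : Set B.Edge :=
  {e | e.y = -B.h e.k ∨ e.y = -B.h (s e.k) ∨ e.y = B.h (s e.k)}

variable (B) in
/-- The edge points at which the step map may be discontinuous. -/
def stepCut (a : ℝ) : Set B.Edge := B.shift a ⁻¹' B.cut (· + 1)

/-- The map `f` moves every interval whose points, read downwards from its upper end, avoid `D` by
a translation. -/
def TranslatesOff (f : B.Edge → B.Edge) (D : Set B.Edge) : Prop :=
  ∀ (e : B.Edge) (g : ℝ), (∀ t ∈ Ico 0 g, e.translate (-t) ∉ D) →
    ∀ t ∈ Ico 0 g, f (e.translate (-t)) = (f e).translate (-t)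

lemma translatesOff_jump (s : ℤ → ℤ) : TranslatesOff (B.jump s) (B.cut s) := by
  intro e g hg t ht
  have hlower : ∀ r ∈ Icc 0 t, -B.h e.k < e.y - r := by
    intro r hr
    by_contra hle
    refine hg (e.y + B.h e.k) ⟨by linarith [e.mem.1], by linarith [hr.2, ht.2]⟩ (.inl ?_)
    rw [translate_y_of_mem (by constructor <;> linarith [B.h_pos e.k]), translate_k]
    ring
  have hmem : ∀ r ∈ Icc 0 t, e.y + -r ∈ Ico (-(B.h e.k)) (B.h e.k) := fun r hr =>
    ⟨(hlower r hr).le, by linarith [e.mem.2, hr.1]⟩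
  have hne : ∀ r ∈ Icc 0 t, e.y + -r ≠ -B.h (s e.k) ∧ e.y + -r ≠ B.h (s e.k) := fun r hr => by
    have hr_notMem := hg r ⟨hr.1, hr.2.trans_lt ht.2⟩
    simp only [cut, mem_ofPred_eq, translate_k, translate_y_of_mem (hmem r hr), not_or]
      at hr_notMem
    exact hr_notMem.2
  refine jump_translate_of_mem_iff (hmem t ⟨ht.1, le_rfl⟩)
    ⟨fun h => ⟨by linarith [h.1, ht.1], ?_⟩, fun h => ⟨?_, by linarith [h.2, ht.1]⟩⟩
  · by_contra hle
    exact (hne (e.y - B.h (s e.k)) ⟨by linarith, by linarith [h.2]⟩).2 (by ring)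
  · by_contra hlt
    exact (hne (e.y + B.h (s e.k)) ⟨by linarith [h.1], by linarith⟩).1 (by ring)

lemma translatesOff_step (a : ℝ) : TranslatesOff (B.step a) (B.stepCut a) := by
  intro e g hg t ht
  rw [step_eq_jump, step_eq_jump, shift_translate]
  refine translatesOff_jump _ _ g (fun r hr => ?_) t ht
  rw [← shift_translate]
  exact hg r hr

lemma translatesOff_step_symm (a : ℝ) : TranslatesOff (B.step a).symm (B.cut (· - 1)) := by
  intro e g hg t ht
  rw [step_symm_eq_jump, step_symm_eq_jump, translatesOff_jump _ e g hg t ht,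
    shift_symm_translate]

lemma exists_forall_mem_Ico_iff (y c : ℝ) :
    ∃ ε > 0, ∀ t ∈ Ico 0 ε, (y + t ∈ Ico (-c) c ↔ y ∈ Ico (-c) c) := by
  rcases lt_or_ge y (-c) with hlower | hlower
  · exact ⟨-c - y, by linarith, fun t ht => iff_of_false
      (fun h => by linarith [h.1, ht.2]) fun h => by linarith [h.1]⟩
  rcases lt_or_ge y c with hupper | hupper
  · exact ⟨c - y, by linarith, fun t ht => iff_of_true
      ⟨by linarith [ht.1], by linarith [ht.2]⟩ ⟨hlower, hupper⟩⟩
  · exact ⟨1, one_pos, fun t ht => iff_of_false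
      (fun h => by linarith [h.2, ht.1]) fun h => by linarith [h.2]⟩

lemma exists_jump_translate (s : ℤ → ℤ) (e : B.Edge) :
    ∃ ε > 0, ∀ t ∈ Ico 0 ε, B.jump s (e.translate t) = (B.jump s e).translate t := by
  obtain ⟨ε, hε, hiff⟩ := exists_forall_mem_Ico_iff e.y (B.h (s e.k))
  refine ⟨min ε (B.h e.k - e.y), lt_min hε (sub_pos.2 e.mem.2), fun t ht =>
    jump_translate_of_mem_iff ⟨by linarith [e.mem.1, ht.1], ?_⟩ (hiff t ⟨ht.1, ?_⟩)⟩
  · linarith [ht.2.trans_le (min_le_right _ _)]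
  · exact ht.2.trans_le (min_le_left _ _)

lemma exists_step_translate (a : ℝ) (e : B.Edge) :
    ∃ ε > 0, ∀ t ∈ Ico 0 ε, B.step a (e.translate t) = (B.step a e).translate t := by
  obtain ⟨ε, hε, h⟩ := exists_jump_translate (· + 1) (B.shift a e)
  exact ⟨ε, hε, fun t ht => by rw [step_eq_jump, step_eq_jump, shift_translate, h t ht]⟩

lemma exists_step_symm_translate (a : ℝ) (e : B.Edge) :
    ∃ ε > 0, ∀ t ∈ Ico 0 ε, (B.step a).symm (e.translate t) = ((B.step a).symm e).translate t := by
  obtain ⟨ε, hε, h⟩ := exists_jump_translate (· - 1) e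
  exact ⟨ε, hε, fun t ht => by
    rw [step_symm_eq_jump, step_symm_eq_jump, h t ht, shift_symm_translate]⟩

lemma exists_step_zpow_translate (a : ℝ) (n : ℤ) (e : B.Edge) :
    ∃ ε > 0, ∀ t ∈ Ico 0 ε, (B.step a ^ n) (e.translate t) = ((B.step a ^ n) e).translate t := by
  induction n using Int.induction_on with
  | zero => exact ⟨1, one_pos, fun t _ => rfl⟩
  | succ n ih =>
    obtain ⟨ε, hε, h⟩ := ih
    obtain ⟨δ, hδ, hstep⟩ := exists_step_translate a ((B.step a ^ (n : ℤ)) e)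
    refine ⟨min ε δ, lt_min hε hδ, fun t ht => ?_⟩
    rw [perm_zpow_add_one_apply', h t ⟨ht.1, ht.2.trans_le (min_le_left _ _)⟩,
      hstep t ⟨ht.1, ht.2.trans_le (min_le_right _ _)⟩, perm_zpow_add_one_apply']
  | pred n ih =>
    obtain ⟨ε, hε, h⟩ := ih
    obtain ⟨δ, hδ, hstep⟩ := exists_step_symm_translate a ((B.step a ^ (-(n : ℤ))) e)
    refine ⟨min ε δ, lt_min hε hδ, fun t ht => ?_⟩
    rw [perm_zpow_sub_one_apply, h t ⟨ht.1, ht.2.trans_le (min_le_left _ _)⟩,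
      hstep t ⟨ht.1, ht.2.trans_le (min_le_right _ _)⟩, perm_zpow_sub_one_apply]

/-- A set of edge points with finitely many points over each bounded part of the table. -/
def LocallyFinite (D : Set B.Edge) : Prop := ∀ K : ℤ, {e | e ∈ D ∧ |e.k| ≤ K}.Finite

lemma locallyFinite_cut (s : ℤ → ℤ) : LocallyFinite (B.cut s) := by
  intro K
  have hsub : {e | e ∈ B.cut s ∧ |e.k| ≤ K} ⊆
      ⋃ k ∈ Icc (-K) K, B.edgeAt k '' {-B.h k, -B.h (s k), B.h (s k)} := by
    rintro e ⟨he, hk⟩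
    exact mem_iUnion₂.2 ⟨e.k, abs_le.1 hk, e.y, he, edgeAt_k_y e⟩
  exact ((finite_Icc _ _).biUnion fun k _ => (toFinite _).image _).subset hsub

lemma locallyFinite_stepCut (a : ℝ) : LocallyFinite (B.stepCut a) := fun K =>
  (locallyFinite_cut (B := B) (· + 1) K).preimage (f := B.shift a) (B.shift a).injective.injOn

lemma LocallyFinite.exists_translate_neg_notMem {D : Set B.Edge} (hD : LocallyFinite D)
    {x : B.Edge} (hx : x ∉ D) : ∃ g > 0, ∀ t ∈ Ico 0 g, x.translate (-t) ∉ D := by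
  have havoid : ∀ᶠ t in 𝓝[>] (0 : ℝ), ∀ v ∈ {e | e ∈ D ∧ |e.k| ≤ |x.k|}, x.translate (-t) ≠ v := by
    refine (eventually_all_finite (hD _)).2 fun v _ => ?_
    by_cases hv : ∃ t ∈ Ioo 0 (2 * B.h x.k), x.translate (-t) = v
    · obtain ⟨t₀, ht₀, rfl⟩ := hv
      filter_upwards [Ioo_mem_nhdsGT ht₀.1] with t ht heq
      have := translate_injOn heq
        (by rw [abs_lt]; constructor <;> linarith [ht.1, ht.2, ht₀.1, ht₀.2])
      linarith [ht.2]
    · filter_upwards [Ioo_mem_nhdsGT (B.two_h_pos x.k)] with t ht heq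
      exact hv ⟨t, ht, heq⟩
  obtain ⟨g, hg, hsub⟩ := mem_nhdsGT_iff_exists_Ioo_subset.1 havoid
  refine ⟨g, hg, fun t ht hmem => ?_⟩
  rcases ht.1.eq_or_lt with rfl | ht₀
  · rw [neg_zero, translate_zero] at hmem
    exact hx hmem
  · exact hsub ⟨ht₀, ht.2⟩ _ ⟨hmem, le_rfl⟩ rfl

/-! ### Gaps of invariant sets -/

/-- The points at distance less than `g` below `x` are not in `F`. -/
def GapBelow (F : Set B.Edge) (x : B.Edge) (g : ℝ) : Prop :=
  0 < g ∧ ∀ t ∈ Ioo 0 g, x.translate (-t) ∉ F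

lemma GapBelow.eq_of_translate_eq {F : Set B.Edge} {x x' : B.Edge} {g g' t t' : ℝ} (hx : x ∈ F)
    (hx' : x' ∈ F) (hg : GapBelow F x g) (hg' : GapBelow F x' g') (ht : t ∈ Ioo 0 g)
    (ht' : t' ∈ Ioo 0 g') (h : x.translate (-t) = x'.translate (-t')) : x = x' := by
  have hxx' : x = x'.translate (-(t' - t)) := by
    rw [neg_sub, sub_eq_neg_add, ← translate_translate, ← h, translate_translate, neg_add_cancel,
      translate_zero]
  have hx'x : x' = x.translate (-(t - t')) := by
    rw [neg_sub, sub_eq_neg_add, ← translate_translate, h, translate_translate, neg_add_cancel,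
      translate_zero]
  rcases lt_trichotomy t t' with hlt | heq | hlt
  · exact absurd (hxx' ▸ hx) (hg'.2 (t' - t) ⟨by linarith, by linarith [ht.1, ht'.2]⟩)
  · rw [hxx', heq, sub_self, neg_zero, translate_zero]
  · exact absurd (hx'x ▸ hx') (hg.2 (t - t') ⟨by linarith, by linarith [ht'.1, ht.2]⟩)

section Iterates

variable {f : B.Edge → B.Edge} {D F : Set B.Edge} {K : ℤ} {x : ℕ → B.Edge}

lemma GapBelow.map (hf : TranslatesOff f D) (hfF : ∀ e, f e ∈ F → e ∈ F) {e : B.Edge} {r : ℝ}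
    (h : GapBelow F e r) (hD : ∀ t ∈ Ico 0 r, e.translate (-t) ∉ D) : GapBelow F (f e) r := by
  refine ⟨h.1, fun t ht hmem => h.2 t ht (hfF _ ?_)⟩
  rwa [hf e r hD t ⟨ht.1.le, ht.2⟩]

lemma exists_gapBelow_iterate (hf : TranslatesOff f D) (hfF : ∀ e, f e ∈ F → e ∈ F)
    (hD : LocallyFinite D) (hstep : ∀ i, x (i + 1) = f (x i)) (hxD : ∀ i, x i ∉ D) {g : ℝ}
    (hg : GapBelow F (x 0) g) (i : ℕ) : ∃ r, GapBelow F (x i) r := by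
  induction i with
  | zero => exact ⟨g, hg⟩
  | succ i ih =>
    obtain ⟨r, hr⟩ := ih
    obtain ⟨r', hr', havoid⟩ := hD.exists_translate_neg_notMem (hxD i)
    rw [hstep]
    refine ⟨min r r', GapBelow.map hf hfF ⟨lt_min hr.1 hr', fun t ht => ?_⟩ fun t ht => ?_⟩
    · exact hr.2 t ⟨ht.1, ht.2.trans_le (min_le_left _ _)⟩
    · exact havoid t ⟨ht.1, ht.2.trans_le (min_le_right _ _)⟩

-- Distinct points of `F` have disjoint gaps.
lemma finite_setOf_gapBelow_meets (hD : LocallyFinite D) (hFK : ∀ e ∈ F, |e.k| ≤ K)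
    (hxF : ∀ i, x i ∈ F) (hx : Function.Injective x) :
    {i | ∃ r, GapBelow F (x i) r ∧ ∃ t ∈ Ioo 0 r, (x i).translate (-t) ∈ D}.Finite := by
  by_contra hinf
  choose! r hr t ht htD using fun i
    (hi : i ∈ {i | ∃ r, GapBelow F (x i) r ∧ ∃ t ∈ Ioo 0 r, (x i).translate (-t) ∈ D}) => hi
  have hmaps : MapsTo (fun i => (x i).translate (-t i)) _ {e | e ∈ D ∧ |e.k| ≤ K} :=
    fun i hi => ⟨htD i hi, hFK (x i) (hxF i)⟩
  obtain ⟨i, hi, j, hj, hij, heq⟩ := Set.Infinite.exists_ne_map_eq_of_mapsTo hinf hmaps (hD K)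
  exact hij (hx ((hr i hi).eq_of_translate_eq (hxF i) (hxF j) (hr j hj) (ht i hi) (ht j hj) heq))

lemma exists_ne_abs_y_sub_lt (hxK : ∀ i, |(x i).k| ≤ K) {r : ℝ} (hr : 0 < r) :
    ∃ i j, i ≠ j ∧ (x i).k = (x j).k ∧ |(x i).y - (x j).y| < r := by
  have hmaps : MapsTo (fun i : ℕ => ((x i).k, ⌊(x i).y / r⌋)) univ
      (Icc (-K) K ×ˢ Icc ⌊-1 / r⌋ ⌊1 / r⌋) := by
    refine fun i _ => ⟨abs_le.1 (hxK i), Int.floor_le_floor ?_, Int.floor_le_floor ?_⟩ <;> gcongr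
    · linarith [(x i).mem.1, B.h_le_one (x i).k]
    · linarith [(x i).mem.2, B.h_le_one (x i).k]
  obtain ⟨i, -, j, -, hij, heq⟩ := infinite_univ.exists_ne_map_eq_of_mapsTo hmaps
    ((finite_Icc _ _).prod (finite_Icc _ _))
  obtain ⟨hk, hfloor⟩ := Prod.ext_iff.1 heq
  have habs := Int.abs_sub_lt_one_of_floor_eq_floor hfloor
  rw [← sub_div, abs_div, abs_of_pos hr, div_lt_one hr] at habs
  exact ⟨i, j, hij, hk, habs⟩

lemma not_forall_gapBelow (hFK : ∀ e ∈ F, |e.k| ≤ K) (hxF : ∀ i, x i ∈ F)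
    (hx : Function.Injective x) (r : ℝ) : ¬ ∀ i, GapBelow F (x i) r := by
  intro hgap
  have hfar : ∀ i j, (x i).k = (x j).k → (x j).y - (x i).y ∉ Ioo 0 r := fun i j hk hy => by
    refine (hgap j).2 _ hy ?_
    rw [Edge.translate, ← hk, neg_sub, add_sub_cancel, edgeAt_k_y]
    exact hxF i
  obtain ⟨i, j, hij, hk, habs⟩ := exists_ne_abs_y_sub_lt (fun i => hFK _ (hxF i)) (hgap 0).1
  rw [abs_lt] at habs
  rcases lt_trichotomy (x i).y (x j).y with hlt | heq | hlt
  · exact hfar i j hk ⟨by linarith, by linarith⟩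
  · exact hij (hx (Edge.ext hk heq))
  · exact hfar j i hk.symm ⟨by linarith, by linarith⟩

-- Off the discontinuities a gap is carried along unchanged; since only finitely many gaps meet a
-- discontinuity, their sizes would be eventually constant.
lemma GapBelow.exists_mem_of_iterate (hf : TranslatesOff f D) (hfF : ∀ e, f e ∈ F → e ∈ F)
    (hD : LocallyFinite D) (hFK : ∀ e ∈ F, |e.k| ≤ K) (hstep : ∀ i, x (i + 1) = f (x i))
    (hxF : ∀ i, x i ∈ F) (hx : Function.Injective x) {g : ℝ} (hg : GapBelow F (x 0) g) :
    ∃ i, x i ∈ D := by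
  by_contra! hxD
  obtain ⟨N, hN⟩ := (finite_setOf_gapBelow_meets hD hFK hxF hx).bddAbove
  obtain ⟨r, hr⟩ := exists_gapBelow_iterate hf hfF hD hstep hxD hg (N + 1)
  refine not_forall_gapBelow hFK (fun i => hxF (N + 1 + i))
    (hx.comp (add_right_injective (N + 1))) r fun i => ?_
  induction i with
  | zero => exact hr
  | succ i ih =>
    rw [← add_assoc, hstep]
    refine ih.map hf hfF fun t ht htD => ?_
    rcases ht.1.eq_or_lt with rfl | ht₀
    · rw [neg_zero, translate_zero] at htD
      exact hxD _ htD
    · have := hN ⟨r, ih, t, ⟨ht₀, ht.2⟩, htD⟩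
      omega

end Iterates

/-! ### Absence of bounded orbits for generic slopes -/

variable (B) in
/-- The points whose orbits stay over the rectangles of index at most `K` in absolute value. -/
def boundedSet (a : ℝ) (K : ℤ) : Set B.Edge := {e | ∀ j : ℤ, |((B.step a ^ j) e).k| ≤ K}

lemma abs_k_le_of_mem_boundedSet {a : ℝ} {K : ℤ} {e : B.Edge} (h : e ∈ B.boundedSet a K) :
    |e.k| ≤ K := h 0

lemma step_zpow_mem_boundedSet {a : ℝ} {K : ℤ} {e : B.Edge} (n : ℤ) :
    (B.step a ^ n) e ∈ B.boundedSet a K ↔ e ∈ B.boundedSet a K := by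
  refine ⟨fun h j => ?_, fun h j => ?_⟩
  · have := h (j - n)
    rwa [perm_zpow_zpow_apply, sub_add_cancel] at this
  · rw [perm_zpow_zpow_apply]
    exact h _

lemma step_mem_boundedSet {a : ℝ} {K : ℤ} {e : B.Edge} :
    B.step a e ∈ B.boundedSet a K ↔ e ∈ B.boundedSet a K := by
  simpa only [zpow_one] using step_zpow_mem_boundedSet (B := B) (e := e) 1

lemma mem_heightGroup_of_mem_cut {s : ℤ → ℤ} {e : B.Edge} (h : e ∈ B.cut s) :
    e.y ∈ B.heightGroup := by
  rcases h with h | h | h <;> rw [h]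
  · exact neg_mem (h_mem_heightGroup _)
  · exact neg_mem (h_mem_heightGroup _)
  · exact h_mem_heightGroup _

lemma step_y_mem_heightGroup_of_mem_stepCut {a : ℝ} {e : B.Edge} (h : e ∈ B.stepCut a) :
    (B.step a e).y ∈ B.heightGroup := by
  have hcut : B.shift a e ∈ B.cut (· + 1) := h
  rw [show (B.step a e).y = (B.shift a e).y from exit_y _]
  exact mem_heightGroup_of_mem_cut hcut

-- Otherwise the orbit of `x` would meet discontinuities both in the future and in the past.
lemma Generic.not_gapBelow {a : ℝ} (ha : B.Generic a) {K : ℤ} {x : B.Edge}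
    (hx : x ∈ B.boundedSet a K) (g : ℝ) : ¬ GapBelow (B.boundedSet a K) x g := by
  intro hg
  obtain ⟨i, hi⟩ := hg.exists_mem_of_iterate (x := fun i => (B.step a ^ (i : ℤ)) x)
    (translatesOff_step a) (fun e => step_mem_boundedSet.1) (locallyFinite_stepCut a)
    (fun e => abs_k_le_of_mem_boundedSet) (fun i => perm_zpow_natCast_succ_apply' _ i x)
    (fun i => (step_zpow_mem_boundedSet _).2 hx)
    (Function.Injective.of_eq_imp_le fun {i j} hij => by
      by_contra hne
      exact ha.step_zpow_apply_ne x (by omega) hij)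
  obtain ⟨j, hj⟩ := hg.exists_mem_of_iterate (x := fun i => (B.step a ^ (-(i : ℤ))) x)
    (translatesOff_step_symm a)
    (fun e he => by rwa [← step_mem_boundedSet, Equiv.apply_symm_apply] at he)
    (locallyFinite_cut _) (fun e => abs_k_le_of_mem_boundedSet)
    (fun i => by rw [← perm_zpow_sub_one_apply]; congr 2; push_cast; ring)
    (fun i => (step_zpow_mem_boundedSet _).2 hx)
    (Function.Injective.of_eq_imp_le fun {i j} hij => by
      by_contra hne
      exact ha.step_zpow_apply_ne x (by omega) hij)
  refine ha.step_zpow_y_notMem_heightGroup (n := i + j + 1) (by omega)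
    (mem_heightGroup_of_mem_cut hj) ?_
  rw [perm_zpow_zpow_apply, show (i : ℤ) + j + 1 + -(j : ℤ) = i + 1 by ring,
    perm_zpow_add_one_apply']
  exact step_y_mem_heightGroup_of_mem_stepCut hi

lemma mem_boundedSet_of_right {a : ℝ} {K : ℤ} {x : B.Edge}
    (h : ∀ j : ℤ, ∀ ε > 0, ∃ t ∈ Ico 0 ε, |((B.step a ^ j) (x.translate t)).k| ≤ K) :
    x ∈ B.boundedSet a K := by
  intro j
  obtain ⟨ε, hε, hx⟩ := exists_step_zpow_translate a j x
  obtain ⟨t, ht, hk⟩ := h j ε hε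
  rwa [hx t ht] at hk

-- The first point of the bounded set above `u` would have a gap below it.
lemma Generic.mem_boundedSet_of_k_eq {a : ℝ} (ha : B.Generic a) {K : ℤ} {x u : B.Edge}
    (hx : x ∈ B.boundedSet a K) (hk : u.k = x.k) : u ∈ B.boundedSet a K := by
  by_contra hu
  let A : Set ℝ := {t | 0 ≤ t ∧ u.translate t ∈ B.boundedSet a K}
  have hne : A.Nonempty := by
    have hmem := u.mem
    rw [hk] at hmem
    refine ⟨x.y - u.y + 2 * B.h x.k, by linarith [x.mem.1, hmem.2], ?_⟩
    have hux : u.translate (x.y - u.y + 2 * B.h x.k) = x := by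
      conv_rhs => rw [← edgeAt_k_y x]
      rw [Edge.translate, hk]
      exact edgeAt_eq_edgeAt_iff.2 ⟨1, by push_cast; ring⟩
    rwa [hux]
  have hbdd : BddBelow A := ⟨0, fun t ht => ht.1⟩
  have hmem : u.translate (sInf A) ∈ B.boundedSet a K := by
    refine mem_boundedSet_of_right fun j ε hε => ?_
    obtain ⟨t, ht, hlt⟩ := exists_lt_of_csInf_lt hne (lt_add_of_pos_right (sInf A) hε)
    refine ⟨t - sInf A, ⟨by linarith [csInf_le hbdd ht], by linarith⟩, ?_⟩
    rw [translate_translate, add_sub_cancel]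
    exact ht.2 j
  have hpos : 0 < sInf A := by
    refine (le_csInf hne fun t ht => ht.1).lt_of_ne fun h₀ => hu ?_
    rwa [← h₀, translate_zero] at hmem
  refine ha.not_gapBelow hmem _ ⟨hpos, fun t ht htA => ?_⟩
  rw [translate_translate] at htA
  have := csInf_le hbdd (show sInf A + -t ∈ A from ⟨by linarith [ht.2], htA⟩)
  linarith [ht.1]

lemma step_edgeAt_neg_k (a : ℝ) (k : ℤ) : (B.step a (B.edgeAt k (-a))).k = k + 1 := by
  have hzero : ∀ j, (0 : ℝ) ∈ Ico (-(B.h j)) (B.h j) :=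
    fun j => ⟨by linarith [B.h_pos j], B.h_pos j⟩
  refine (step_k_eq_add_one_iff a (B.edgeAt k (-a))).2 ?_
  rw [edgeAt_y, edgeAt_k, wrap_wrap_add, neg_add_cancel, B.wrap_eq_self (hzero k)]
  exact hzero (k + 1)

lemma Generic.boundedSet_eq_empty {a : ℝ} (ha : B.Generic a) (K : ℤ) :
    B.boundedSet a K = ∅ := by
  refine eq_empty_iff_forall_notMem.2 fun x hx => ?_
  have hall : ∀ n : ℕ, ∃ e ∈ B.boundedSet a K, e.k = x.k + n := by
    intro n
    induction n with
    | zero => exact ⟨x, hx, by rw [Nat.cast_zero, add_zero]⟩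
    | succ n ih =>
      obtain ⟨e, he, hk⟩ := ih
      refine ⟨B.step a (B.edgeAt e.k (-a)),
        step_mem_boundedSet.2 (ha.mem_boundedSet_of_k_eq he rfl), ?_⟩
      rw [step_edgeAt_neg_k, hk]
      push_cast
      ring
  obtain ⟨e, he, hk⟩ := hall (2 * K.toNat + 1)
  have hek := abs_le.1 (abs_k_le_of_mem_boundedSet he)
  have hxk := abs_le.1 (abs_k_le_of_mem_boundedSet hx)
  omega

/-! ### The half-turn symmetry -/

/-- Rotation of the table by a half turn; it moves edge points to right sides of rectangles, which
are labelled by the rectangle to their left. -/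
def Edge.reflect (e : B.Edge) : B.Edge := B.edgeAt (-e.k - 1) (-e.y)

@[simp] lemma reflect_k (e : B.Edge) : e.reflect.k = -e.k - 1 := rfl

lemma reflect_edgeAt (k : ℤ) (y : ℝ) : (B.edgeAt k y).reflect = B.edgeAt (-k - 1) (-y) := by
  obtain ⟨m, hm⟩ := B.wrap_eq_sub k y
  refine edgeAt_eq_edgeAt_iff.2 ⟨m, ?_⟩
  rw [edgeAt_y, edgeAt_k, hm, h_reflect]
  ring

lemma reflect_y_of_ne {e : B.Edge} (h : e.y ≠ -B.h e.k) : e.reflect.y = -e.y := by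
  refine edgeAt_y_of_mem ?_
  rw [h_reflect]
  exact ⟨by linarith [e.mem.2], by linarith [e.mem.1.lt_of_ne h.symm]⟩

/-- Rotation of the table by a half turn, as a map of edge points. -/
def Edge.mirror (e : B.Edge) : B.Edge := B.exit e.reflect

lemma abs_mirror_k (e : B.Edge) : |e.mirror.k| = |e.k| := by
  rcases exit_k_cases e.reflect with h | h <;> rw [Edge.mirror, h, reflect_k]
  · rw [sub_add_cancel, abs_neg]
  · congr 1
    ring

-- The point on the right side of a rectangle is first rotated and then entered from the left.
lemma exit_reflect_exit {e : B.Edge} (he : e ∉ B.cut (· + 1)) :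
    B.exit (B.exit e).reflect = e.reflect := by
  obtain ⟨hbottom, hlower, hupper⟩ :
      e.y ≠ -B.h e.k ∧ e.y ≠ -B.h (e.k + 1) ∧ e.y ≠ B.h (e.k + 1) := by
    simpa only [cut, mem_ofPred_eq, not_or] using he
  have hy := reflect_y_of_ne hbottom
  by_cases h : e.y ∈ Ico (-(B.h (e.k + 1))) (B.h (e.k + 1))
  · have hexit : (B.exit e).k = e.k + 1 := (exit_k_eq_add_one_iff e).2 h
    have hyexit : (B.exit e).reflect.y = -e.y := by
      rw [reflect_y_of_ne (by rwa [hexit, exit_y]), exit_y]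
    have hkexit : (B.exit e).reflect.k + 1 = -e.k - 1 := by
      rw [reflect_k, hexit]
      ring
    have hmem := e.reflect.mem
    rw [reflect_k, ← hkexit, hy, ← hyexit] at hmem
    rw [exit_of_mem hmem, hyexit, hkexit, Edge.reflect]
  · have hexit : (B.exit e).reflect = B.edgeAt e.k (-e.y) := by
      rw [exit_of_notMem h, reflect_edgeAt]
      congr 1
      ring
    have hyexit : (B.edgeAt e.k (-e.y)).y = -e.y := by
      have hmem := e.reflect.mem
      rw [reflect_k, h_reflect, hy] at hmem
      exact edgeAt_y_of_mem hmem
    rw [hexit, exit_of_notMem, edgeAt_k, hyexit, Edge.reflect]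
    rw [hyexit, edgeAt_k]
    exact fun hmem => h ⟨by linarith [hmem.2], lt_of_le_of_ne (by linarith [hmem.1]) hupper⟩

lemma step_symm_mirror {a : ℝ} {e : B.Edge} (he : e ∉ B.stepCut a) :
    (B.step a).symm e.mirror = (B.step a e).mirror := by
  have hshift : (B.shift a).symm e.reflect = (B.shift a e).reflect := by
    conv_rhs => rw [← edgeAt_k_y e]
    rw [shift_edgeAt, reflect_edgeAt, Edge.reflect, shift_symm_edgeAt]
    congr 1
    ring
  rw [step_symm_apply, Edge.mirror, Equiv.symm_apply_apply, hshift]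
  exact (exit_reflect_exit he).symm

lemma step_zpow_mirror {a : ℝ} {e : B.Edge} (n : ℤ)
    (h : ∀ j : ℤ, |j| ≤ |n| → (B.step a ^ j) e ∉ B.stepCut a) :
    (B.step a ^ n) e.mirror = ((B.step a ^ (-n)) e).mirror := by
  induction n using Int.induction_on with
  | zero => rfl
  | succ n ih =>
    have hle : |(n : ℤ)| ≤ |(n : ℤ) + 1| := by
      rw [abs_of_nonneg (by positivity), abs_of_nonneg (by positivity)]
      omega
    have hsymm := step_symm_mirror (h (-(n + 1)) (by rw [abs_neg]))
    rw [← perm_zpow_add_one_apply', show -((n : ℤ) + 1) + 1 = -n by ring] at hsymm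
    rw [perm_zpow_add_one_apply', ih fun j hj => h j (hj.trans hle), ← hsymm,
      Equiv.apply_symm_apply]
  | pred n ih =>
    have hle : |(n : ℤ)| ≤ |-(n : ℤ) - 1| := by
      rw [abs_of_nonneg (by positivity), abs_of_nonpos (by omega)]
      omega
    rw [perm_zpow_sub_one_apply, ih fun j hj => h j (hj.trans (by rwa [abs_neg])), neg_neg,
      step_symm_mirror (h n hle), ← perm_zpow_add_one_apply', neg_sub, sub_neg_eq_add,
      add_comm (1 : ℤ)]

lemma exists_mirror_translate_neg (e : B.Edge) :
    ∃ ε > 0, ∀ t ∈ Ico 0 ε, (e.translate (-t)).mirror = e.mirror.translate t := by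
  obtain ⟨ε, hε, h⟩ := exists_jump_translate (· + 1) e.reflect
  refine ⟨ε, hε, fun t ht => ?_⟩
  rw [Edge.mirror, Edge.mirror, exit_eq_jump, exit_eq_jump, ← h t ht, Edge.translate,
    reflect_edgeAt, Edge.reflect, translate_edgeAt, neg_add, neg_neg]

/-! ### Unboundedness of all semi-orbits for generic slopes -/

lemma exists_tendsto_translate_of_antitone {s : ℕ → B.Edge} {k : ℤ} (hk : ∀ n, (s n).k = k)
    (hs : Antitone fun n => (s n).y) :
    ∃ (x : B.Edge) (t : ℕ → ℝ), (∀ n, 0 ≤ t n) ∧ Tendsto t atTop (𝓝 0) ∧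
      ∀ n, s n = x.translate (t n) := by
  have hbdd : BddBelow (range fun n => (s n).y) := by
    refine ⟨-B.h k, ?_⟩
    rintro _ ⟨n, rfl⟩
    exact hk n ▸ (s n).mem.1
  refine ⟨B.edgeAt k (⨅ n, (s n).y), fun n => (s n).y - ⨅ n, (s n).y,
    fun n => sub_nonneg.2 (ciInf_le hbdd n), ?_, fun n => ?_⟩
  · exact tendsto_sub_nhds_zero_iff.2 (tendsto_atTop_ciInf hs hbdd)
  · rw [translate_edgeAt, add_sub_cancel, ← hk n, edgeAt_k_y]

lemma exists_tendsto_translate_neg_of_monotone {s : ℕ → B.Edge} {k : ℤ} (hk : ∀ n, (s n).k = k)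
    (hs : Monotone fun n => (s n).y) :
    ∃ (x : B.Edge) (t : ℕ → ℝ), (∀ n, 0 ≤ t n) ∧ Tendsto t atTop (𝓝 0) ∧
      ∀ n, s n = x.translate (-t n) := by
  have hbdd : BddAbove (range fun n => (s n).y) := by
    refine ⟨B.h k, ?_⟩
    rintro _ ⟨n, rfl⟩
    exact hk n ▸ (s n).mem.2.le
  refine ⟨B.edgeAt k (⨆ n, (s n).y), fun n => (⨆ n, (s n).y) - (s n).y,
    fun n => sub_nonneg.2 (le_ciSup hbdd n), ?_, fun n => ?_⟩
  · simpa only [sub_self] using (tendsto_atTop_ciSup hs hbdd).const_sub (⨆ n, (s n).y)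
  · rw [translate_edgeAt, neg_sub, add_sub_cancel, ← hk n, edgeAt_k_y]

lemma exists_strictMono_k_eq_and_monotone_or_antitone {K : ℤ} {s : ℕ → B.Edge}
    (h : ∀ᶠ n in atTop, |(s n).k| ≤ K) :
    ∃ (k : ℤ) (σ : ℕ → ℕ), StrictMono σ ∧ (∀ n, (s (σ n)).k = k) ∧
      ((Monotone fun n => (s (σ n)).y) ∨ Antitone fun n => (s (σ n)).y) := by
  obtain ⟨k, hk⟩ : ∃ k, ∃ᶠ n in atTop, (s n).k = k := by
    by_contra! hne
    have hne' : ∀ᶠ n in atTop, ∀ k ∈ Icc (-K) K, (s n).k ≠ k :=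
      (eventually_all_finite (finite_Icc _ _)).2 fun k _ => hne k
    obtain ⟨n, hn, hle⟩ := (hne'.and h).exists
    exact hn _ (abs_le.1 hle) rfl
  obtain ⟨φ, hφ, hφk⟩ := extraction_of_frequently_atTop hk
  obtain ⟨g, hg⟩ := exists_increasing_or_nonincreasing_subseq (· < ·) fun n => (s (φ n)).y
  refine ⟨k, φ ∘ g, hφ.comp g.strictMono, fun n => hφk _, hg.imp (fun hlt => ?_) fun hle => ?_⟩
  · exact monotone_nat_of_le_succ fun n => (hlt n (n + 1) n.lt_succ_self).le
  · exact antitone_nat_of_succ_le fun n => not_lt.1 (hle n (n + 1) n.lt_succ_self)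

lemma Generic.not_forall_eventually_translate {a : ℝ} (ha : B.Generic a) (K : ℤ) (x : B.Edge)
    {t : ℕ → ℝ} (ht₀ : ∀ n, 0 ≤ t n) (ht : Tendsto t atTop (𝓝 0)) :
    ¬ ∀ j : ℤ, ∀ᶠ n in atTop, |((B.step a ^ j) (x.translate (t n))).k| ≤ K := by
  intro h
  have hx : x ∈ B.boundedSet a K := by
    refine mem_boundedSet_of_right fun j ε hε => ?_
    obtain ⟨n, hk, hlt⟩ := ((h j).and (ht.eventually_lt_const hε)).exists
    exact ⟨t n, ⟨ht₀ n, hlt⟩, hk⟩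
  rw [ha.boundedSet_eq_empty] at hx
  exact hx

-- Iterates are continuous from above only; a sequence increasing to its limit is reversed by the
-- half turn.
lemma Generic.not_forall_eventually {a : ℝ} (ha : B.Generic a) (K : ℤ) (s : ℕ → B.Edge) :
    ¬ ∀ j : ℤ, ∀ᶠ n in atTop, |((B.step a ^ j) (s n)).k| ≤ K ∧
      (B.step a ^ j) (s n) ∉ B.stepCut a := by
  intro h
  obtain ⟨k, σ, hσ, hk, hmono | hanti⟩ :=
    exists_strictMono_k_eq_and_monotone_or_antitone (s := s) ((h 0).mono fun n hn => hn.1)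
  · obtain ⟨x, t, ht₀, ht, hs⟩ := exists_tendsto_translate_neg_of_monotone hk hmono
    obtain ⟨ε, hε, hmirror⟩ := exists_mirror_translate_neg x
    refine ha.not_forall_eventually_translate K x.mirror ht₀ ht fun j => ?_
    have havoid : ∀ᶠ n in atTop, ∀ i ∈ {i : ℤ | |i| ≤ |j|},
        (B.step a ^ i) (s (σ n)) ∉ B.stepCut a :=
      (eventually_all_finite ((finite_Icc (-|j|) |j|).subset fun i hi => abs_le.1 hi)).2
        fun i _ => hσ.tendsto_atTop.eventually ((h i).mono fun n hn => hn.2)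
    filter_upwards [ht.eventually_lt_const hε, havoid, hσ.tendsto_atTop.eventually (h (-j))]
      with n hlt hn hbound
    rw [← hmirror _ ⟨ht₀ n, hlt⟩, ← hs, step_zpow_mirror j hn, abs_mirror_k]
    exact hbound.1
  · obtain ⟨x, t, ht₀, ht, hs⟩ := exists_tendsto_translate_of_antitone hk hanti
    refine ha.not_forall_eventually_translate K x ht₀ ht fun j => ?_
    filter_upwards [hσ.tendsto_atTop.eventually (h j)] with n hn
    rw [← hs]
    exact hn.1

lemma LocallyFinite.eventually_notMem {D : Set B.Edge} (hD : LocallyFinite D) {K : ℤ}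
    {s : ℕ → B.Edge} (hs : Function.Injective s) (h : ∀ᶠ n in atTop, |(s n).k| ≤ K) :
    ∀ᶠ n in atTop, s n ∉ D := by
  have hfin : {n | s n ∈ D ∧ |(s n).k| ≤ K}.Finite := (hD K).preimage (f := s) hs.injOn
  have havoid : ∀ᶠ n in atTop, n ∉ {n | s n ∈ D ∧ |(s n).k| ≤ K} := by
    rw [← Nat.cofinite_eq_atTop]
    exact hfin.compl_mem_cofinite
  filter_upwards [h, havoid] with n hk hn hmem
  exact hn ⟨hmem, hk⟩

lemma Generic.exists_lt_abs_k {a : ℝ} (ha : B.Generic a) {σ : ℤ} (hσ : σ = 1 ∨ σ = -1) (K : ℤ)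
    (e : B.Edge) : ∃ i : ℕ, K < |((B.step a ^ (σ * i)) e).k| := by
  by_contra! hbound
  have hinj : ∀ j : ℤ, Function.Injective fun n : ℕ =>
      (B.step a ^ j) ((B.step a ^ (σ * n)) e) := by
    intro j m n hmn
    by_contra hne
    exact ha.step_zpow_apply_ne e (by rcases hσ with rfl | rfl <;> omega)
      ((B.step a ^ j).injective hmn)
  have hbound' : ∀ j : ℤ, ∀ᶠ n : ℕ in atTop,
      |((B.step a ^ j) ((B.step a ^ (σ * n)) e)).k| ≤ K := by
    intro j
    filter_upwards [eventually_ge_atTop j.natAbs] with n hn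
    obtain ⟨i, hi⟩ : ∃ i : ℕ, j + σ * n = σ * i := by
      rcases hσ with rfl | rfl
      · exact ⟨(j + n).toNat, by omega⟩
      · exact ⟨(n - j).toNat, by omega⟩
    rw [perm_zpow_zpow_apply, hi]
    exact hbound i
  exact ha.not_forall_eventually K (fun n => (B.step a ^ (σ * n)) e) fun j =>
    (hbound' j).and ((locallyFinite_stepCut a).eventually_notMem (hinj j) (hbound' j))

/-! ### Almost every direction is typical -/

lemma step_zpow_neg_k (a : ℝ) {e : B.Edge} {i : ℕ} (hi : (i : ℤ) ≤ e.k) :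
    ((B.step a ^ (-(i : ℤ))) e).k = e.k - i := by
  induction i with
  | zero => simp
  | succ i ih =>
    push_cast at hi ⊢
    have hk := ih (by omega)
    rw [neg_add, ← sub_eq_add_neg, perm_zpow_sub_one_apply,
      step_symm_k_of_nonneg a (by omega), hk]
    ring

lemma direct_step_zpow_neg (a : ℝ) {e : B.Edge} {i : ℕ} (hi : (i : ℤ) ≤ e.k) :
    Direct a i ((B.step a ^ (-(i : ℤ))) e) := by
  intro l hl
  rw [perm_zpow_zpow_apply, step_zpow_neg_k a hi,
    show (l : ℤ) + -(i : ℤ) = -((i - l : ℕ) : ℤ) by omega, step_zpow_neg_k a (by omega)]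
  omega

-- If the translate of the aperture met the top of a rectangle, the backward orbit of one of its
-- points would pass through a lower vertex, contradicting clearness.
lemma Clear.exists_step_zpow_neg_edgeAt {a : ℝ} {m : ℕ} (h : B.Clear a m) (i : ℕ) (hi : i ≤ m) :
    ∃ c : ℝ, ∀ u ∈ Ico (-B.p m) (B.p m), c + u ∈ Ico (-B.p (m - i)) (B.p (m - i)) ∧
      (B.step a ^ (-(i : ℤ))) (B.edgeAt m u) = B.edgeAt ((m - i : ℕ) : ℤ) (c + u) := by
  induction i with
  | zero => exact ⟨0, fun u hu => ⟨by simpa using hu, by simp⟩⟩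
  | succ i ih =>
    obtain ⟨c, hc⟩ := ih (by omega)
    obtain ⟨j, hj⟩ : ∃ j, m - i = j + 1 := ⟨m - i - 1, by omega⟩
    rw [hj] at hc
    rw [show m - (i + 1) = j by omega]
    set v := B.wrap j (c - B.p m - a)
    have hv : v ∈ Ico (-B.p j) (B.p j) := by simpa only [h_natCast] using B.wrap_mem j _
    have hback : ∀ u ∈ Ico (-B.p m) (B.p m),
        (B.step a ^ (-((i + 1 : ℕ) : ℤ))) (B.edgeAt m u) = B.edgeAt j (v + B.p m + u) := by
      intro u hu
      obtain ⟨hcu, hstep⟩ := hc u hu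
      rw [Nat.cast_succ, neg_add, ← sub_eq_add_neg, perm_zpow_sub_one_apply, hstep,
        step_symm_of_pos a (by rw [edgeAt_k]; positivity), edgeAt_k, edgeAt_y_of_mem hcu,
        add_assoc v, edgeAt_wrap_add, Nat.cast_succ, add_sub_cancel_right]
      congr 1
      ring
    refine ⟨v + B.p m, fun u hu => ⟨⟨by linarith [hv.1, hu.1], ?_⟩, hback u hu⟩⟩
    by_contra! htop
    have hvertex : B.p j - v - B.p m ∈ Ico (-B.p m) (B.p m) :=
      ⟨by linarith [hv.2], by linarith [hu.2]⟩
    have hlower : (B.step a ^ (-((i + 1 : ℕ) : ℤ))) (B.edgeAt m (B.p j - v - B.p m)) =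
        B.lowerVertex j := by
      rw [hback _ hvertex]
      refine edgeAt_eq_edgeAt_iff.2 ⟨1, ?_⟩
      rw [h_natCast]
      push_cast
      ring
    have hdirect := direct_step_zpow_neg a (e := B.edgeAt m (B.p j - v - B.p m)) (i := i + 1)
      (by rw [edgeAt_k]; exact_mod_cast hi)
    rw [hlower] at hdirect
    exact h j (by omega) (by rwa [show m - j = i + 1 by omega])

/-- The points of `{0} × [-1, 1)` which reach the aperture `{m} × [-p m, p m)` directly along the
slope `a` form a right-open interval with center `c`, which the `m`-th iterate translates onto the
aperture. -/
structure DirectInterval (B : StepBilliard) (a : ℝ) (m : ℕ) (c : ℝ) : Prop where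
  center_add_mem : ∀ u ∈ Ico (-B.p m) (B.p m), c + u ∈ Ico (-B.h 0) (B.h 0)
  step_zpow : ∀ u ∈ Ico (-B.p m) (B.p m),
    (B.step a ^ (m : ℤ)) (B.edgeAt 0 (c + u)) = B.edgeAt m u
  direct_iff : ∀ e : B.Edge, e.k = 0 →
    (Direct a m e ↔ e.y ∈ Ico (c - B.p m) (c + B.p m))

lemma Clear.exists_directInterval {a : ℝ} {m : ℕ} (h : B.Clear a m) :
    ∃ c, B.DirectInterval a m c := by
  obtain ⟨c, hc⟩ := h.exists_step_zpow_neg_edgeAt m le_rfl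
  simp only [Nat.sub_self, Nat.cast_zero] at hc
  refine ⟨c, fun u hu => (hc u hu).1, fun u hu => ?_, fun e he => ⟨fun hd => ?_, fun hy => ?_⟩⟩
  · rw [← (hc u hu).2, perm_zpow_zpow_apply, add_neg_cancel, zpow_zero, Equiv.Perm.one_apply]
  · set f := (B.step a ^ (m : ℤ)) e with hf
    have hk : f.k = m := by rw [hf, hd m le_rfl, he, zero_add]
    have hmem : f.y ∈ Ico (-B.p m) (B.p m) := by simpa only [hk, h_natCast] using f.mem
    obtain ⟨hcf, hback⟩ := hc _ hmem
    rw [← hk, edgeAt_k_y, hk, hf, perm_zpow_zpow_apply, neg_add_cancel, zpow_zero,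
      Equiv.Perm.one_apply, ← hf] at hback
    rw [hback, edgeAt_y_of_mem hcf]
    constructor <;> linarith [hmem.1, hmem.2]
  · have hu : e.y - c ∈ Ico (-B.p m) (B.p m) := ⟨by linarith [hy.1], by linarith [hy.2]⟩
    have hd := direct_step_zpow_neg a (e := B.edgeAt m (e.y - c)) (i := m) (by rw [edgeAt_k])
    rwa [(hc _ hu).2, add_sub_cancel, ← he, edgeAt_k_y] at hd

namespace DirectInterval

variable {a c d : ℝ} {m n : ℕ}

lemma isSingleInterval_reach {θ : ℝ} (hθ : 0 < Real.cos θ)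
    (h : B.DirectInterval (Real.tan θ) m c) : B.IsSingleInterval (B.reach θ m) := by
  refine ⟨c - B.p m, c + B.p m, by linarith [B.p_pos m], Set.ext fun z => ⟨fun hz => ?_, ?_⟩⟩
  · have hz₀ := mem_section0_iff.1 hz.1
    rw [hz₀, mem_reach_iff hθ] at hz
    have hy := (h.direct_iff _ hz.1).1 hz.2
    rw [← toPhase_Y, ← hz₀] at hy
    exact ⟨hz₀ ▸ toPhase_mem_section0_iff.2 hz.1, 0, by simpa using hy⟩
  · rintro ⟨hz, i, hi⟩
    have hz₀ := mem_section0_iff.1 hz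
    rw [hz₀, mem_reach_iff hθ]
    refine ⟨rfl, (h.direct_iff _ rfl).2 ?_⟩
    have hu : z.Y + 2 * i - c ∈ Ico (-B.p m) (B.p m) := ⟨by linarith [hi.1], by linarith [hi.2]⟩
    have hmem := h.center_add_mem _ hu
    rw [add_sub_cancel] at hmem
    have hedge : B.edgeAt 0 z.Y = B.edgeAt 0 (z.Y + 2 * i) :=
      edgeAt_eq_edgeAt_iff.2 ⟨-i, by rw [h_zero]; push_cast; ring⟩
    rwa [hedge, edgeAt_y_of_mem hmem]

lemma Ico_subset (h : B.DirectInterval a m c) (h' : B.DirectInterval a n d) (hmn : m ≤ n) :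
    Ico (d - B.p n) (d + B.p n) ⊆ Ico (c - B.p m) (c + B.p m) := by
  intro x hx
  have hu : x - d ∈ Ico (-B.p n) (B.p n) := ⟨by linarith [hx.1], by linarith [hx.2]⟩
  have hy : (B.edgeAt 0 x).y = x :=
    edgeAt_y_of_mem (by simpa only [add_sub_cancel] using h'.center_add_mem _ hu)
  have hd := ((h'.direct_iff (B.edgeAt 0 x) rfl).2 (by rwa [hy])).mono hmn
  simpa only [hy] using (h.direct_iff _ rfl).1 hd

lemma endpoints_le (h : B.DirectInterval a m c) (h' : B.DirectInterval a n d) (hmn : m ≤ n) :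
    c - B.p m ≤ d - B.p n ∧ d + B.p n ≤ c + B.p m :=
  (Ico_subset_Ico_iff (by linarith [B.p_pos n])).1 (h.Ico_subset h' hmn)

lemma add_mul_mem_heightGroup (h : B.DirectInterval a m c) : c + m * a ∈ B.heightGroup := by
  have hzero : (0 : ℝ) ∈ Ico (-B.p m) (B.p m) := ⟨by linarith [B.p_pos m], B.p_pos m⟩
  have hmem := step_zpow_y_sub_mem_heightGroup a (B.edgeAt 0 (c + 0)) m
  rw [h.step_zpow 0 hzero, edgeAt_y_of_mem (h.center_add_mem 0 hzero),
    edgeAt_y_of_mem (by rwa [h_natCast])] at hmem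
  convert neg_mem hmem using 1
  push_cast
  ring

lemma right_endpoint_lt (ha : B.Generic a) (h : B.DirectInterval a m c)
    (h' : B.DirectInterval a n d) (hmn : m < n) : d + B.p n < c + B.p m := by
  refine (h.endpoints_le h' hmn.le).2.lt_of_ne fun heq => ha ((n : ℤ) - m) (by omega) ?_
  have hcentres := sub_mem h'.add_mul_mem_heightGroup h.add_mul_mem_heightGroup
  have hheights := sub_mem (h_mem_heightGroup (B := B) n) (h_mem_heightGroup (B := B) m)
  rw [h_natCast, h_natCast] at hheights
  convert add_mem hcentres hheights using 1
  push_cast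
  linarith

lemma abs_y_sub_lt (h : B.DirectInterval a m c) {e f : B.Edge} (he : e.k = 0) (hf : f.k = 0)
    (hde : Direct a m e) (hdf : Direct a m f) : |e.y - f.y| < 2 * B.p m := by
  have hye := (h.direct_iff e he).1 hde
  have hyf := (h.direct_iff f hf).1 hdf
  rw [abs_lt]
  constructor <;> linarith [hye.1, hye.2, hyf.1, hyf.2]

end DirectInterval

-- The right endpoints of the nested intervals decrease strictly along a subsequence, so the
-- intersection is not lost at an open end.
lemma Generic.exists_escaping {a : ℝ} (ha : B.Generic a)
    (hclear : ∃ᶠ m in atTop, B.Clear a m) : ∃ e : B.Edge, Escaping a e := by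
  obtain ⟨φ, hφ, hclearφ⟩ := extraction_of_frequently_atTop hclear
  choose c hc using fun n => (hclearφ n).exists_directInterval
  have hleft : Monotone fun n => c n - B.p (φ n) :=
    fun m n hmn => ((hc m).endpoints_le (hc n) (hφ.monotone hmn)).1
  have hright : StrictAnti fun n => c n + B.p (φ n) :=
    fun m n hmn => (hc m).right_endpoint_lt ha (hc n) (hφ hmn)
  have hx := hleft.ciSup_mem_iInter_Icc_of_antitone hright.antitone
    fun n => by linarith [B.p_pos (φ n)]
  set x := ⨆ n, c n - B.p (φ n)
  rw [mem_iInter] at hx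
  have hmem : ∀ n, x ∈ Ico (c n - B.p (φ n)) (c n + B.p (φ n)) :=
    fun n => ⟨(hx n).1, (hx (n + 1)).2.trans_lt (hright n.lt_succ_self)⟩
  have hy : (B.edgeAt 0 x).y = x := by
    refine edgeAt_y_of_mem ?_
    have hu := (hc 0).center_add_mem (x - c 0) ⟨by linarith [(hmem 0).1], by linarith [(hmem 0).2]⟩
    rwa [add_sub_cancel] at hu
  refine ⟨B.edgeAt 0 x, escaping_iff.2 ⟨rfl, fun n => ?_⟩⟩
  exact (((hc n).direct_iff (B.edgeAt 0 x) rfl).2 (hy.symm ▸ hmem n)).mono (hφ.le_apply)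

lemma Escaping.eq_of_frequently_clear {a : ℝ} {e f : B.Edge} (he : Escaping a e)
    (hf : Escaping a f) (hclear : ∃ᶠ m in atTop, B.Clear a m) : e = f := by
  obtain ⟨hke, hde⟩ := escaping_iff.1 he
  obtain ⟨hkf, hdf⟩ := escaping_iff.1 hf
  refine Edge.ext (hke.trans hkf.symm) ?_
  by_contra hne
  have hlim : Tendsto (fun m => 2 * B.p m) atTop (𝓝 0) := by
    simpa only [mul_zero] using B.p_lim.const_mul 2
  have hsmall : ∀ᶠ m in atTop, 2 * B.p m < |e.y - f.y| :=
    hlim.eventually_lt_const (abs_pos.2 (sub_ne_zero.2 hne))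
  obtain ⟨m, hm, hlt⟩ := (hclear.and_eventually hsmall).exists
  obtain ⟨c, hc⟩ := hm.exists_directInterval
  exact (hc.abs_y_sub_lt hke hkf (hde m) (hdf m)).not_gt hlt

lemma base_flow_int {θ : ℝ} (hc : Real.cos θ ≠ 0) (n : ℤ) (z : B.Phase) :
    B.base (Real.tan θ) (B.flow θ (n / Real.cos θ) z) =
      (B.step (Real.tan θ) ^ n) (B.base (Real.tan θ) z) := by
  rw [base_flow, div_mul_cancel₀ _ hc, Int.floor_add_intCast, Int.floor_fract, zero_add]

lemma Generic.exists_lt_abs_flow_X {θ : ℝ} (hc : 0 < Real.cos θ) (ha : B.Generic (Real.tan θ))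
    {σ : ℤ} (hσ : σ = 1 ∨ σ = -1) (z : B.Phase) (M : ℝ) :
    ∃ t ≥ 0, M < |(B.flow θ (σ * t) z).X| := by
  obtain ⟨i, hi⟩ := ha.exists_lt_abs_k hσ (⌈M⌉ + 1) (B.base (Real.tan θ) z)
  refine ⟨i / Real.cos θ, by positivity, ?_⟩
  have hbase : B.base (Real.tan θ) (B.flow θ (σ * (i / Real.cos θ)) z) =
      (B.step (Real.tan θ) ^ (σ * i)) (B.base (Real.tan θ) z) := by
    rw [← base_flow_int hc.ne']
    push_cast
    rw [mul_div_assoc]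
  have hX := abs_X_sub_base_k_le (Real.tan θ) (B.flow θ (σ * (i / Real.cos θ)) z)
  rw [hbase] at hX
  set k := ((B.step (Real.tan θ) ^ (σ * i)) (B.base (Real.tan θ) z)).k
  have hk : (⌈M⌉ : ℝ) + 1 < |(k : ℝ)| := by exact_mod_cast hi
  have htri := abs_sub_abs_le_abs_sub (k : ℝ) (B.flow θ (σ * (i / Real.cos θ)) z).X
  rw [abs_sub_comm] at htri
  linarith [Int.le_ceil M]

lemma Generic.unboundedInFuture {θ : ℝ} (hc : 0 < Real.cos θ) (ha : B.Generic (Real.tan θ))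
    (z : B.Phase) : B.UnboundedInFuture θ z := by
  intro M
  obtain ⟨t, ht, hM⟩ := ha.exists_lt_abs_flow_X hc (Or.inl rfl) z M
  exact ⟨t, ht, by simpa using hM⟩

lemma Generic.unboundedInPast {θ : ℝ} (hc : 0 < Real.cos θ) (ha : B.Generic (Real.tan θ))
    (z : B.Phase) : B.UnboundedInPast θ z := by
  intro M
  obtain ⟨t, ht, hM⟩ := ha.exists_lt_abs_flow_X hc (Or.inr rfl) z M
  exact ⟨-t, by linarith, by simpa using hM⟩

variable (B) in
/-- The points of the vertical cross-sections at the height of a vertex of the table, on either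
side of the axis. -/
def vertexEdges : Set B.Edge := {e | |e.y| ∈ insert 0 (range B.p)}

lemma countable_vertexEdges : B.vertexEdges.Countable := by
  have hsub : B.vertexEdges ⊆ ⋃ k : ℤ, ⋃ s ∈ ({1, -1} : Set ℝ),
      (fun x => B.edgeAt k (s * x)) '' insert 0 (range B.p) := by
    intro e he
    refine mem_iUnion.2 ⟨e.k, ?_⟩
    rcases abs_cases e.y with ⟨h, -⟩ | ⟨h, -⟩
    · refine mem_iUnion₂.2 ⟨1, by simp, |e.y|, he, ?_⟩
      simp only [h, one_mul, edgeAt_k_y]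
    · refine mem_iUnion₂.2 ⟨-1, by simp, |e.y|, he, ?_⟩
      simp only [h, neg_mul_neg, one_mul, edgeAt_k_y]
  refine (countable_iUnion fun k => ?_).mono hsub
  exact ((toFinite _).countable).biUnion fun s _ => ((countable_range _).insert _).image _

lemma IsVertex.fract_X {z : B.Phase} (h : B.IsVertex z) : Int.fract z.X = 0 := by
  obtain ⟨n, hn⟩ : ∃ n : ℕ, |z.X| = n := by
    rcases h with (h | ⟨n, h⟩) | ⟨n, h⟩
    · exact ⟨0, by simpa using congrArg Prod.fst h⟩
    · exact ⟨n, by simpa using (congrArg Prod.fst h).symm⟩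
    · exact ⟨n + 1, by simpa using (congrArg Prod.fst h).symm⟩
  rcases abs_choice z.X with hX | hX <;> rw [hX] at hn
  · rw [hn, Int.fract_natCast]
  · rw [neg_eq_iff_eq_neg.1 hn, Int.fract_neg_eq_zero, Int.fract_natCast]

lemma IsVertex.abs_Y_mem {z : B.Phase} (h : B.IsVertex z) :
    |z.Y| ∈ (insert 0 (range B.p) : Set ℝ) := by
  rcases h with (h | ⟨n, h⟩) | ⟨n, h⟩
  · exact Or.inl (by simpa using congrArg Prod.snd h)
  · exact Or.inr ⟨n, congrArg Prod.snd h⟩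
  · exact Or.inr ⟨n, congrArg Prod.snd h⟩

lemma base_y_of_fract_X {z : B.Phase} (h : Int.fract z.X = 0) (a : ℝ) : (B.base a z).y = z.Y := by
  rw [base_eq_edgeAt, h, mul_zero, sub_zero]
  exact edgeAt_y_of_mem z.2

lemma IsVertex.base_mem_vertexEdges {z : B.Phase} (h : B.IsVertex z) (a : ℝ) :
    B.base a z ∈ B.vertexEdges := by
  change |(B.base a z).y| ∈ (insert 0 (range B.p) : Set ℝ)
  rw [base_y_of_fract_X h.fract_X]
  exact h.abs_Y_mem

lemma exists_toPhase_eq_of_mem_escapePoints {θ : ℝ} {z : B.Phase} (hz : z ∈ B.escapePoints θ) :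
    ∃ e : B.Edge, e.toPhase = z :=
  ⟨_, (mem_section0_iff.1 (mem_iInter.1 hz 0).1).symm⟩

lemma existsUnique_isEscapeOrbit {θ : ℝ} (hc : 0 < Real.cos θ) (ha : B.Generic (Real.tan θ))
    (hclear : ∃ᶠ m in atTop, B.Clear (Real.tan θ) m) : ∃! O, B.IsEscapeOrbit θ O := by
  obtain ⟨e, he⟩ := ha.exists_escaping hclear
  refine ⟨B.orbit θ e.toPhase, ⟨_, (toPhase_mem_escapePoints_iff hc).2 he, rfl⟩, ?_⟩
  rintro O ⟨z, hz, rfl⟩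
  obtain ⟨f, rfl⟩ := exists_toPhase_eq_of_mem_escapePoints hz
  rw [((toPhase_mem_escapePoints_iff hc).1 hz).eq_of_frequently_clear he hclear]

lemma not_isVertex_of_mem_escapeOrbit {θ : ℝ} (hc : 0 < Real.cos θ)
    (hvertex : ∀ e ∈ B.vertexEdges, ∀ m : ℕ, 1 ≤ m →
      ¬ (0 ≤ ((B.step (Real.tan θ) ^ (m : ℤ)) e).k ∧
        ∀ i, Direct (Real.tan θ) i ((B.step (Real.tan θ) ^ (m : ℤ)) e)))
    {O : Set B.Phase} (hO : B.IsEscapeOrbit θ O) {w : B.Phase} (hw : w ∈ O) :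
    ¬ B.IsVertex w := by
  intro hV
  obtain ⟨z, hz, rfl⟩ := hO
  obtain ⟨t, rfl⟩ := hw
  obtain ⟨e, rfl⟩ := exists_toPhase_eq_of_mem_escapePoints hz
  have he := (toPhase_mem_escapePoints_iff hc).1 hz
  have hbase := hV.base_mem_vertexEdges (Real.tan θ)
  simp only [base_flow, base_toPhase] at hbase
  set n := ⌊Int.fract e.toPhase.X + t * Real.cos θ⌋
  obtain ⟨m, l, hm, hml⟩ : ∃ m l : ℕ, 1 ≤ m ∧ (m : ℤ) + n = l :=
    ⟨n.natAbs + 1, (n.natAbs + 1 + n).toNat, by omega, by omega⟩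
  refine hvertex _ hbase m hm ?_
  rw [perm_zpow_zpow_apply, hml, he]
  exact ⟨by positivity, he.direct_step_zpow l⟩

lemma isTypical_of_generic {θ : ℝ} (hc : 0 < Real.cos θ) (ha : B.Generic (Real.tan θ))
    (hclear : ∃ᶠ m in atTop, B.Clear (Real.tan θ) m)
    (hvertex : ∀ e ∈ B.vertexEdges, ∀ m : ℕ, 1 ≤ m →
      ¬ (0 ≤ ((B.step (Real.tan θ) ^ (m : ℤ)) e).k ∧
        ∀ i, Direct (Real.tan θ) i ((B.step (Real.tan θ) ^ (m : ℤ)) e))) : B.IsTypical θ where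
  unboundedInFuture := ha.unboundedInFuture hc
  unboundedInPast := ha.unboundedInPast hc
  singleInterval := hclear.mono fun _ hm =>
    let ⟨_, h⟩ := hm.exists_directInterval
    h.isSingleInterval_reach hc
  existsUnique := existsUnique_isEscapeOrbit hc ha hclear
  noVertex _ hO _ hz := not_isVertex_of_mem_escapeOrbit hc hvertex hO hz

lemma ae_isTypical {lam : ℝ} (hlam : lam < 1 / 3) (hp : ∀ n, B.p (n + 1) ≤ lam * B.p n) :
    ∀ᵐ θ : ℝ, 0 < Real.cos θ → B.IsTypical θ := by
  have hgeneric : ∀ᵐ a : ℝ, B.Generic a := (countable_setOf_not_generic (B := B)).measure_zero _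
  have hvertex : ∀ᵐ a : ℝ, ∀ e ∈ B.vertexEdges, ∀ m : ℕ, 1 ≤ m →
      ¬ (0 ≤ ((B.step a ^ (m : ℤ)) e).k ∧ ∀ i, Direct a i ((B.step a ^ (m : ℤ)) e)) := by
    refine (ae_ball_iff countable_vertexEdges).2 fun e _ => ae_all_iff.2 fun m => ?_
    by_cases hm : 1 ≤ m
    · have hnull := volume_forall_direct_step_zpow_eq_zero (by linarith) hp e hm
      rw [← compl_compl {a | _}, ← mem_ae_iff] at hnull
      filter_upwards [hnull] with a ha _ using ha
    · exact Eventually.of_forall fun a h => absurd h hm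
  filter_upwards [ae_tan_of_ae (hgeneric.and ((ae_frequently_clear hlam hp).and hvertex))]
    with θ hθ hc
  obtain ⟨ha, hclear, hv⟩ := hθ hc.ne'
  exact isTypical_of_generic hc ha hclear hv

/-! ### Topology of the surface -/

variable (B) in
/-- Parametrization of the `k`-th rectangle of the unfolded table by `[0, 1] × [-h k, h k]`,
extended to the whole plane by projecting onto this rectangle. -/
def rect (k : ℤ) (q : ℝ × ℝ) : B.unfolded :=
  ⟨((k : ℝ) + max 0 (min 1 q.1), max (-(B.h k)) (min (B.h k) q.2)), k,
    ⟨by simp, by simp⟩, ⟨by simp, by simp [(B.h_pos k).le]⟩⟩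

lemma continuous_rect (k : ℤ) : Continuous (B.rect k) := by
  unfold rect
  fun_prop

lemma rect_val {k : ℤ} {x y : ℝ} (hx : x ∈ Icc (0 : ℝ) 1) (hy : y ∈ Icc (-(B.h k)) (B.h k)) :
    (B.rect k (x, y)).1 = ((k : ℝ) + x, y) := by
  simp [rect, hx.1, hx.2, hy.1, hy.2]

lemma mk_rect_neg_h (k : ℤ) (x : ℝ) :
    (Quot.mk _ (B.rect k (x, -(B.h k))) : B.Surface) = Quot.mk _ (B.rect k (x, B.h k)) := by
  have h := B.h_pos k
  refine Quot.sound (Glue.horizontal k _ _ ⟨?_, ?_⟩ ?_ ?_ ?_)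
  · simp [rect]
  · simp [rect]
  · simp [rect]
  · simp [rect, h.le]
  · simp [rect, h.le]

variable (B) in
/-- The `k`-th rectangle with its horizontal sides glued, as a part of the surface. The ordinate
is periodic with period `2 * h k`. -/
def cylinder (k : ℤ) (q : ℝ × ℝ) : B.Surface := Quot.mk _ (B.rect k (q.1, B.wrap k q.2))

lemma cylinder_wrap_add (k : ℤ) (x y c : ℝ) :
    B.cylinder k (x, B.wrap k y + c) = B.cylinder k (x, y + c) := by
  unfold cylinder
  rw [wrap_wrap_add]

lemma cylinder_wrap (k : ℤ) (x y : ℝ) : B.cylinder k (x, B.wrap k y) = B.cylinder k (x, y) := by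
  simpa only [add_zero] using cylinder_wrap_add k x y 0

lemma cylinder_eq_mk_rect {k : ℤ} (x : ℝ) {y : ℝ} (m : ℤ)
    (h : y - m * (2 * B.h k) ∈ Icc (-(B.h k)) (B.h k)) :
    B.cylinder k (x, y) = Quot.mk _ (B.rect k (x, y - m * (2 * B.h k))) := by
  rw [cylinder, ← B.wrap_sub_intCast_mul k y m]
  rcases h.2.eq_or_lt with heq | hlt
  · have hbottom : B.wrap k (B.h k) = -(B.h k) := by
      rw [← B.wrap_sub_intCast_mul k (B.h k) 1, B.wrap_eq_self]
      · push_cast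
        ring
      · constructor <;> push_cast <;> linarith [B.h_pos k]
    rw [heq, hbottom, mk_rect_neg_h]
  · rw [B.wrap_eq_self ⟨h.1, hlt⟩]

lemma continuous_cylinder (k : ℤ) : Continuous (B.cylinder k) := by
  have hpos := B.two_h_pos k
  refine continuous_iff_continuousAt.2 fun q₀ => ?_
  refine continuousAt_of_forall_continuousWithinAt_preimage_Icc
    (g := fun q : ℝ × ℝ => (q.2 + B.h k) / (2 * B.h k)) (by fun_prop) fun m hm => ?_
  have hpiece : ∀ q ∈ (fun q : ℝ × ℝ => (q.2 + B.h k) / (2 * B.h k)) ⁻¹' Icc (m : ℝ) (m + 1),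
      B.cylinder k q = Quot.mk _ (B.rect k (q.1, q.2 - m * (2 * B.h k))) := by
    intro q hq
    have hlower := (le_div_iff₀ hpos).1 hq.1
    have hupper := (div_le_iff₀ hpos).1 hq.2
    exact cylinder_eq_mk_rect q.1 m ⟨by linarith, by linarith⟩
  have hcont : Continuous fun q : ℝ × ℝ =>
      (Quot.mk _ (B.rect k (q.1, q.2 - m * (2 * B.h k))) : B.Surface) :=
    continuous_quot_mk.comp ((continuous_rect k).comp (by fun_prop))
  exact hcont.continuousWithinAt.congr hpiece (hpiece q₀ hm)

lemma mk_eq_cylinder (q : B.unfolded) {k : ℤ} {x : ℝ} (hx : x ∈ Icc (0 : ℝ) 1)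
    (hX : q.1.1 = k + x) (hY : q.1.2 ∈ Icc (-(B.h k)) (B.h k)) :
    (Quot.mk _ q : B.Surface) = B.cylinder k (x, q.1.2) := by
  have hzero : q.1.2 - (0 : ℤ) * (2 * B.h k) = q.1.2 := by rw [Int.cast_zero, zero_mul, sub_zero]
  rw [cylinder_eq_mk_rect x 0 (by rwa [hzero]), hzero]
  refine congrArg _ (Subtype.ext ?_)
  rw [rect_val hx hY, ← hX]

lemma proj_eq_cylinder (z : B.Phase) : B.proj z = B.cylinder ⌊z.X⌋ (Int.fract z.X, z.Y) :=
  mk_eq_cylinder _ (Ico_subset_Icc_self (fract_mem_Ico _)) (Int.floor_add_fract _).symm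
    (Ico_subset_Icc_self z.2)

lemma proj_along (a : ℝ) (e : B.Edge) (s : ℝ) (hs : s ∈ Ico (0 : ℝ) 1) :
    B.proj (B.along a e s hs) = B.cylinder e.k (s, e.y + a * s) := by
  rw [proj_eq_cylinder, floor_along, fract_along, along_Y, cylinder_wrap]

lemma proj_toPhase (e : B.Edge) : B.proj e.toPhase = B.cylinder e.k (0, e.y) := by
  rw [proj_eq_cylinder, toPhase_X, toPhase_Y, Int.floor_intCast, Int.fract_intCast]

lemma nonneg_of_y_notMem_Ico_h_add_one {f : B.Edge}
    (h : f.y ∉ Ico (-(B.h (f.k + 1))) (B.h (f.k + 1))) : 0 ≤ f.k := by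
  by_contra! hk
  have hle := h_le_succ (B := B) hk
  exact h ⟨by linarith [f.mem.1], by linarith [f.mem.2]⟩

lemma cylinder_one (f : B.Edge) : B.cylinder f.k (1, f.y) = B.proj (B.exit f).toPhase := by
  have hf := Ico_subset_Icc_self f.mem
  have hval := rect_val (B := B) (k := f.k) (x := 1) (by simp) hf
  rw [cylinder, B.wrap_eq_self f.mem]
  by_cases h : f.y ∈ Ico (-(B.h (f.k + 1))) (B.h (f.k + 1))
  · unfold proj
    refine congrArg _ (Subtype.ext ?_)
    rw [hval]
    refine Prod.ext ?_ (exit_y f).symm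
    change (f.k : ℝ) + 1 = ((B.exit f).k : ℝ)
    rw [exit_of_mem h, edgeAt_k]
    push_cast
    ring
  · obtain ⟨n, hn⟩ := Int.eq_ofNat_of_zero_le (nonneg_of_y_notMem_Ico_h_add_one h)
    refine (Quot.sound (Glue.vertical n _ _ ?_ ?_ ?_ ?_)).symm
    · change ((B.exit f).k : ℝ) = _
      rw [exit_of_notMem h, edgeAt_k, hn]
      push_cast
      ring
    · rw [hval, hn]
      push_cast
      rfl
    · rw [hval]
      exact (exit_y f).symm
    · change |(B.exit f).y| ∈ _
      rw [exit_y]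
      rw [hn] at hf h
      refine ⟨?_, abs_le.2 hf⟩
      by_contra! hlt
      exact h ⟨(abs_lt.1 hlt).1.le, (abs_lt.1 hlt).2⟩

lemma proj_flow_toPhase {θ t : ℝ} {e : B.Edge} {n : ℤ}
    (h : t * Real.cos θ ∈ Icc (n : ℝ) (n + 1)) :
    B.proj (B.flow θ t e.toPhase) = B.cylinder ((B.step (Real.tan θ) ^ n) e).k
      (t * Real.cos θ - n,
        ((B.step (Real.tan θ) ^ n) e).y + Real.tan θ * (t * Real.cos θ - n)) := by
  rw [flow_toPhase, proj_along]
  rcases h.2.eq_or_lt with heq | hlt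
  · have hfl : ⌊t * Real.cos θ⌋ = n + 1 := by
      rw [heq, ← Int.cast_one, ← Int.cast_add, Int.floor_intCast]
    have hfr : Int.fract (t * Real.cos θ) = 0 := by
      rw [heq, ← Int.cast_one, ← Int.cast_add, Int.fract_intCast]
    rw [hfl, hfr, heq, mul_zero, add_zero, add_sub_cancel_left, mul_one, ← proj_toPhase,
      perm_zpow_add_one_apply', step_apply, ← cylinder_one, edgeAt_k, edgeAt_y, cylinder_wrap]
  · have hfl : ⌊t * Real.cos θ⌋ = n := Int.floor_eq_iff.2 ⟨h.1, hlt⟩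
    have hfr : Int.fract (t * Real.cos θ) = t * Real.cos θ - n := by
      rw [← hfl, Int.self_sub_floor]
    rw [hfl, hfr]

lemma continuousAt_proj_flow {θ : ℝ} {y₀ : ℝ} {k₀ : ℤ}
    (h : ∀ n : ℤ, ∀ᶠ y in 𝓝 y₀, (B.step (Real.tan θ) ^ n) (B.edgeAt k₀ y) =
      ((B.step (Real.tan θ) ^ n) (B.edgeAt k₀ y₀)).translate (y - y₀)) (s₀ : ℝ) :
    ContinuousAt (fun q : ℝ × ℝ => B.proj (B.flow θ q.2 (B.edgeAt k₀ q.1).toPhase)) (y₀, s₀) := by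
  refine continuousAt_of_forall_continuousWithinAt_preimage_Icc
    (g := fun q : ℝ × ℝ => q.2 * Real.cos θ) (by fun_prop) fun n hn => ?_
  set f := (B.step (Real.tan θ) ^ n) (B.edgeAt k₀ y₀)
  have hcont : Continuous fun q : ℝ × ℝ => B.cylinder f.k (q.2 * Real.cos θ - n,
      f.y + (q.1 - y₀) + Real.tan θ * (q.2 * Real.cos θ - n)) :=
    (continuous_cylinder f.k).comp (by fun_prop)
  have hflow : ∀ᶠ q : ℝ × ℝ in 𝓝[(fun q => q.2 * Real.cos θ) ⁻¹' Icc (n : ℝ) (n + 1)] (y₀, s₀),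
      B.proj (B.flow θ q.2 (B.edgeAt k₀ q.1).toPhase) = B.cylinder f.k
        (q.2 * Real.cos θ - n, f.y + (q.1 - y₀) + Real.tan θ * (q.2 * Real.cos θ - n)) := by
    filter_upwards [self_mem_nhdsWithin,
      nhdsWithin_le_nhds ((continuous_fst.tendsto (y₀, s₀)).eventually (h n))] with q hq hstep
    rw [proj_flow_toPhase hq, hstep, translate_k]
    exact cylinder_wrap_add f.k _ _ _
  exact hcont.continuousWithinAt.congr_of_eventuallyEq hflow (hflow.self_of_nhdsWithin hn)

lemma proj_surjective : Function.Surjective B.proj := by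
  intro x
  induction x using Quot.ind with
  | mk q =>
    obtain ⟨k, hX, hY⟩ := q.2
    rcases hX.2.eq_or_lt with heq | hlt
    · refine ⟨(B.exit (B.edgeAt k q.1.2)).toPhase, ?_⟩
      rw [← cylinder_one, edgeAt_k, edgeAt_y, cylinder_wrap,
        ← mk_eq_cylinder q (x := 1) (by simp) heq hY]
    · have hx : q.1.1 - k ∈ Ico (0 : ℝ) 1 := ⟨by linarith [hX.1], by linarith⟩
      refine ⟨B.along 0 (B.edgeAt k q.1.2) (q.1.1 - k) hx, ?_⟩
      rw [proj_along, zero_mul, add_zero, edgeAt_k, edgeAt_y, cylinder_wrap,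
        ← mk_eq_cylinder q (Ico_subset_Icc_self hx) (by ring) hY]

/-! ### The closed curve `L` in the surface -/

variable (B) in
/-- The covering of the closed curve `L` by the real line. -/
def sectionCurve (y : ℝ) : B.Surface := B.proj (B.edgeAt 0 y).toPhase

lemma sectionCurve_eq_cylinder (y : ℝ) : B.sectionCurve y = B.cylinder 0 (0, y) := by
  rw [sectionCurve, proj_toPhase, edgeAt_k, edgeAt_y, cylinder_wrap]

lemma continuous_sectionCurve : Continuous B.sectionCurve := by
  rw [funext sectionCurve_eq_cylinder]
  exact (continuous_cylinder 0).comp (by fun_prop)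

lemma sectionCurve_add_intCast (y : ℝ) (m : ℤ) :
    B.sectionCurve (y + 2 * m) = B.sectionCurve y := by
  unfold sectionCurve
  congr 2
  refine edgeAt_eq_edgeAt_iff.2 ⟨m, ?_⟩
  rw [h_zero]
  ring

lemma image_section0 : B.proj '' B.section0 = range B.sectionCurve := by
  ext x
  constructor
  · rintro ⟨z, hz, rfl⟩
    exact ⟨z.Y, by rw [sectionCurve, ← mem_section0_iff.1 hz]⟩
  · rintro ⟨y, rfl⟩
    exact ⟨_, by simp [section0], rfl⟩

lemma Glue.fst_eq_zero_and_exists_iff {S : Set ℝ} {a b : B.unfolded} (hab : B.Glue a b) :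
    (a.1.1 = 0 ∧ ∃ m : ℤ, a.1.2 + 2 * m ∈ S) ↔ (b.1.1 = 0 ∧ ∃ m : ℤ, b.1.2 + 2 * m ∈ S) := by
  cases hab with
  | horizontal k _ _ hx hab ha hb =>
    rw [hab]
    refine and_congr_right fun hzero => ?_
    rw [hzero] at hx
    have hk : k = 0 ∨ k = -1 := by
      have hle : k ≤ 0 := by exact_mod_cast hx.1
      have hge : 0 ≤ k + 1 := by exact_mod_cast hx.2
      omega
    have hheight : B.h k = 1 := by rcases hk with rfl | rfl <;> [exact h_zero; exact h_neg_one]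
    rw [ha, hb, hheight]
    constructor
    · rintro ⟨m, hm⟩
      refine ⟨m - 1, ?_⟩
      push_cast
      convert hm using 1
      ring
    · rintro ⟨m, hm⟩
      refine ⟨m + 1, ?_⟩
      push_cast
      convert hm using 1
      ring
  | vertical n _ _ ha hb _ _ =>
    have : (0 : ℝ) < (n : ℝ) + 1 := by positivity
    rw [ha, hb]
    exact iff_of_false (fun h => by linarith [h.1]) (fun h => by linarith [h.1])

lemma mk_mem_image_sectionCurve_iff (S : Set ℝ) (q : B.unfolded) :
    (Quot.mk _ q : B.Surface) ∈ B.sectionCurve '' S ↔ q.1.1 = 0 ∧ ∃ m : ℤ, q.1.2 + 2 * m ∈ S := by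
  constructor
  · rintro ⟨y, hy, hq⟩
    have hlift := congrArg (Quot.lift (fun a : B.unfolded => a.1.1 = 0 ∧ ∃ m : ℤ, a.1.2 + 2 * m ∈ S)
      fun a b hab => propext hab.fst_eq_zero_and_exists_iff) hq
    refine hlift.mp ⟨Int.cast_zero, ?_⟩
    obtain ⟨m, hm⟩ := B.wrap_eq_sub 0 y
    refine ⟨m, ?_⟩
    change B.wrap 0 y + 2 * m ∈ S
    rw [hm, h_zero]
    convert hy using 1
    ring
  · rintro ⟨hzero, m, hm⟩
    refine ⟨_, hm, ?_⟩
    have hY : q.1.2 ∈ Icc (-(B.h 0)) (B.h 0) := by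
      obtain ⟨k, -, hk⟩ := q.2
      rw [h_zero]
      exact ⟨by linarith [hk.1, B.h_le_one k], by linarith [hk.2, B.h_le_one k]⟩
    rw [sectionCurve_add_intCast, sectionCurve_eq_cylinder,
      mk_eq_cylinder q (k := 0) (x := 0) (by simp) (by simpa using hzero) hY]

lemma sectionCurve_eq_sectionCurve_iff {y z : ℝ} :
    B.sectionCurve y = B.sectionCurve z ↔ ∃ m : ℤ, y + 2 * m = z := by
  constructor
  · intro h
    obtain ⟨-, m, hm⟩ := (mk_mem_image_sectionCurve_iff {z} _).1 ⟨z, rfl, h.symm⟩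
    change B.wrap 0 y + 2 * m = z at hm
    obtain ⟨n, hn⟩ := B.wrap_eq_sub 0 y
    rw [hn, h_zero] at hm
    exact ⟨m - n, by push_cast; linarith⟩
  · rintro ⟨m, rfl⟩
    exact (sectionCurve_add_intCast y m).symm

lemma isClosed_image_sectionCurve {S : Set ℝ} (h : IsClosed {y | ∃ m : ℤ, y + 2 * (m : ℝ) ∈ S}) :
    IsClosed (B.sectionCurve '' S) := by
  rw [← isQuotientMap_quot_mk.isClosed_preimage]
  have hpre : Quot.mk B.Glue ⁻¹' (B.sectionCurve '' S) =
      {q | q.1.1 = 0} ∩ (fun q : B.unfolded => q.1.2) ⁻¹' {y | ∃ m : ℤ, y + 2 * (m : ℝ) ∈ S} :=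
    Set.ext (mk_mem_image_sectionCurve_iff S)
  rw [hpre]
  exact (isClosed_eq (by fun_prop) continuous_const).inter (h.preimage (by fun_prop))

lemma isClosed_range_sectionCurve : IsClosed (range B.sectionCurve) := by
  rw [← image_univ]
  exact isClosed_image_sectionCurve (by simp)

lemma exists_mem_Ico_sectionCurve_eq (x c : ℝ) :
    ∃ y ∈ Ico c (c + 2), B.sectionCurve y = B.sectionCurve x := by
  obtain ⟨m, hm, -⟩ := existsUnique_add_zsmul_mem_Ico (two_pos (α := ℝ)) x c
  refine ⟨_, hm, ?_⟩
  rw [zsmul_eq_mul, mul_comm, sectionCurve_add_intCast]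

lemma isCompact_range_sectionCurve : IsCompact (range B.sectionCurve) := by
  have hperiod : range B.sectionCurve = B.sectionCurve '' Icc (-1) (-1 + 2) := by
    refine Subset.antisymm ?_ (image_subset_range _ _)
    rintro _ ⟨x, rfl⟩
    obtain ⟨y, hy, hyx⟩ := B.exists_mem_Ico_sectionCurve_eq x (-1)
    exact ⟨y, Ico_subset_Icc_self hy, hyx⟩
  rw [hperiod]
  exact isCompact_Icc.image continuous_sectionCurve

lemma add_two_mul_mem_closure_preimage_sectionCurve {A : Set B.Surface} {y : ℝ}
    (hy : y ∈ closure (B.sectionCurve ⁻¹' A)) (m : ℤ) :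
    y + 2 * m ∈ closure (B.sectionCurve ⁻¹' A) :=
  map_mem_closure (f := fun z => z + 2 * (m : ℝ)) (by fun_prop) hy fun w hw => by
    rwa [mem_preimage, sectionCurve_add_intCast]

lemma sectionCurve_mem_closure_iff {A : Set B.Surface} (hA : A ⊆ range B.sectionCurve) {y : ℝ} :
    B.sectionCurve y ∈ closure A ↔ y ∈ closure (B.sectionCurve ⁻¹' A) := by
  constructor
  · intro h
    have hclosed : IsClosed (B.sectionCurve '' closure (B.sectionCurve ⁻¹' A)) := by
      refine isClosed_image_sectionCurve ?_
      convert isClosed_closure (s := B.sectionCurve ⁻¹' A) using 1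
      ext z
      constructor
      · rintro ⟨m, hm⟩
        have hz := add_two_mul_mem_closure_preimage_sectionCurve hm (-m)
        push_cast at hz
        convert hz using 1
        ring
      · exact fun hz => ⟨0, by simpa using hz⟩
    have hsub : A ⊆ B.sectionCurve '' closure (B.sectionCurve ⁻¹' A) := by
      intro x hx
      obtain ⟨z, rfl⟩ := hA hx
      exact ⟨z, subset_closure hx, rfl⟩
    obtain ⟨z, hz, hzy⟩ := closure_minimal hsub hclosed h
    obtain ⟨m, rfl⟩ := sectionCurve_eq_sectionCurve_iff.1 hzy
    exact add_two_mul_mem_closure_preimage_sectionCurve hz m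
  · exact fun h => map_mem_closure continuous_sectionCurve h fun z hz => hz

lemma isClosed_image_sectionCurve_Icc (u v : ℝ) : IsClosed (B.sectionCurve '' Icc u v) :=
  isClosed_image_sectionCurve (isClosed_setOf_exists_add_mul_intCast_mem isCompact_Icc two_pos)

/-! ### Regular points -/

lemma abs_h_mem_tableVertices (j : ℤ) : (|(j : ℝ)|, B.h j) ∈ B.tableVertices := by
  rcases lt_or_ge j 0 with hj | hj
  · obtain ⟨n, rfl⟩ : ∃ n : ℕ, j = -n - 1 := ⟨(-j - 1).toNat, by omega⟩
    refine .inr ⟨n, Prod.ext ?_ (h_neg_natCast_sub_one n).symm⟩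
    have : (0 : ℝ) ≤ n := n.cast_nonneg
    push_cast
    rw [abs_of_neg (by linarith)]
    ring
  · lift j to ℕ using hj
    exact .inl (.inr ⟨j, by rw [Int.cast_natCast, Nat.abs_cast, h_natCast]⟩)

lemma abs_h_sub_one_mem_tableVertices (j : ℤ) : (|(j : ℝ)|, B.h (j - 1)) ∈ B.tableVertices := by
  have := abs_h_mem_tableVertices (B := B) (-j)
  rwa [← h_reflect, neg_neg, Int.cast_neg, abs_neg] at this

lemma isVertex_toPhase {e : B.Edge} {j : ℤ} (hk : |(e.k : ℝ)| = |(j : ℝ)|)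
    (hy : |e.y| = B.h j ∨ |e.y| = B.h (j - 1)) : B.IsVertex e.toPhase := by
  change (|(e.k : ℝ)|, |e.y|) ∈ B.tableVertices
  rw [hk]
  rcases hy with hy | hy <;> rw [hy]
  · exact abs_h_mem_tableVertices j
  · exact abs_h_sub_one_mem_tableVertices j

variable (B) in
/-- Edge points whose orbits under the step map meet no vertex. -/
def Regular (a : ℝ) (e : B.Edge) : Prop := ∀ n : ℤ, ¬ B.IsVertex ((B.step a ^ n) e).toPhase

lemma Regular.zpow {a : ℝ} {e : B.Edge} (h : B.Regular a e) (n : ℤ) :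
    B.Regular a ((B.step a ^ n) e) := fun m => by
  rw [perm_zpow_zpow_apply]
  exact h _

lemma isVertex_of_mem_cut {e : B.Edge} (h : e ∈ B.cut (· - 1)) : B.IsVertex e.toPhase := by
  refine isVertex_toPhase (j := e.k) rfl ?_
  rcases h with h | h | h <;> rw [h]
  · exact .inl (by rw [abs_neg, abs_of_pos (B.h_pos _)])
  · exact .inr (by rw [abs_neg, abs_of_pos (B.h_pos _)])
  · exact .inr (abs_of_pos (B.h_pos _))

lemma isVertex_step_of_mem_stepCut {a : ℝ} {e : B.Edge} (h : e ∈ B.stepCut a) :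
    B.IsVertex (B.step a e).toPhase := by
  refine isVertex_toPhase (j := e.k + 1) ?_ ?_
  · rcases step_k_cases a e with hk | ⟨-, hk⟩
    · rw [hk]
    · rw [hk, ← abs_neg, ← Int.cast_neg, neg_sub, sub_neg_eq_add, add_comm]
  · have hy : (B.step a e).y = (B.shift a e).y := exit_y _
    rw [hy, add_sub_cancel_right]
    have hcut : (B.shift a e).y = -B.h e.k ∨ (B.shift a e).y = -B.h (e.k + 1) ∨
      (B.shift a e).y = B.h (e.k + 1) := h
    rcases hcut with h | h | h <;> rw [h]
    · exact .inr (by rw [abs_neg, abs_of_pos (B.h_pos _)])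
    · exact .inl (by rw [abs_neg, abs_of_pos (B.h_pos _)])
    · exact .inl (abs_of_pos (B.h_pos _))

lemma Regular.notMem_stepCut {a : ℝ} {e : B.Edge} (h : B.Regular a e) (n : ℤ) :
    (B.step a ^ n) e ∉ B.stepCut a := fun hn => by
  refine h (n + 1) ?_
  rw [perm_zpow_add_one_apply']
  exact isVertex_step_of_mem_stepCut hn

lemma Regular.notMem_cut {a : ℝ} {e : B.Edge} (h : B.Regular a e) (n : ℤ) :
    (B.step a ^ n) e ∉ B.cut (· - 1) := fun hn => h n (isVertex_of_mem_cut hn)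

lemma Regular.mem_Ioo {a : ℝ} {e : B.Edge} (h : B.Regular a e) :
    e.y ∈ Ioo (-(B.h e.k)) (B.h e.k) :=
  ⟨lt_of_le_of_ne e.mem.1 fun hy => h.notMem_cut 0 (.inl hy.symm), e.mem.2⟩

lemma Regular.eventually_step_zpow_translate {a : ℝ} {e : B.Edge} (h : B.Regular a e) (n : ℤ) :
    ∀ᶠ t in 𝓝 (0 : ℝ), (B.step a ^ n) (e.translate t) = ((B.step a ^ n) e).translate t := by
  induction n using Int.induction_on with
  | zero => exact .of_forall fun t => rfl
  | succ n ih =>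
    obtain ⟨ε, hε, hright⟩ := exists_step_translate a ((B.step a ^ (n : ℤ)) e)
    obtain ⟨δ, hδ, hleft⟩ :=
      (locallyFinite_stepCut a).exists_translate_neg_notMem (h.notMem_stepCut n)
    filter_upwards [ih, eventually_nhds_zero_of_Ico_of_neg_Ico hε hδ hright
      (translatesOff_step a _ _ hleft)] with t hn hstep
    rw [perm_zpow_add_one_apply', hn, hstep, perm_zpow_add_one_apply']
  | pred n ih =>
    obtain ⟨ε, hε, hright⟩ := exists_step_symm_translate a ((B.step a ^ (-(n : ℤ))) e)
    obtain ⟨δ, hδ, hleft⟩ := (locallyFinite_cut _).exists_translate_neg_notMem (h.notMem_cut (-n))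
    filter_upwards [ih, eventually_nhds_zero_of_Ico_of_neg_Ico hε hδ hright
      (translatesOff_step_symm a _ _ hleft)] with t hn hstep
    rw [perm_zpow_sub_one_apply, hn, hstep, perm_zpow_sub_one_apply]

lemma Regular.reflect_y {a : ℝ} {e : B.Edge} (h : B.Regular a e) : e.reflect.y = -e.y :=
  reflect_y_of_ne h.mem_Ioo.1.ne'

lemma Regular.ne_mirror {a : ℝ} {e : B.Edge} (h : B.Regular a e) : e ≠ e.mirror := by
  intro heq
  have hy₀ : e.y = 0 := by
    have : e.y = e.reflect.y := (congrArg Edge.y heq).trans (exit_y _)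
    rw [h.reflect_y] at this
    linarith
  have hmem : e.reflect.y ∈ Ico (-(B.h (e.reflect.k + 1))) (B.h (e.reflect.k + 1)) := by
    rw [h.reflect_y, hy₀, neg_zero]
    exact ⟨neg_nonpos.2 (B.h_pos _).le, B.h_pos _⟩
  have hk₀ : e.k = 0 := by
    have hk : e.k = (B.exit e.reflect).k := congrArg Edge.k heq
    rw [exit_of_mem hmem, edgeAt_k, reflect_k] at hk
    omega
  refine h 0 (.inl (.inl ?_))
  change (|(e.k : ℝ)|, |e.y|) = (0, 0)
  rw [hk₀, hy₀, Int.cast_zero, abs_zero]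

-- If the rotated point were on the orbit, the rotation would fix either a point of the orbit or
-- a step of it; the latter is impossible by the parity of abscissas.
lemma Regular.not_sameCycle_mirror {a : ℝ} {e : B.Edge} (h : B.Regular a e) :
    ¬ (B.step a).SameCycle e e.mirror := by
  rintro ⟨n, hn⟩
  have hsymm (r : ℤ) : (B.step a ^ (n - r)) e = ((B.step a ^ r) e).mirror := by
    have := step_zpow_mirror (-r) fun j _ => h.notMem_stepCut j
    rw [← hn, perm_zpow_zpow_apply, neg_neg] at this
    rw [← this, neg_add_eq_sub]
  rcases Int.even_or_odd' n with ⟨r, rfl | rfl⟩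
  · refine (h.zpow r).ne_mirror ?_
    rw [← hsymm r, two_mul, add_sub_cancel_right]
  · have hstep := hsymm r
    rw [show 2 * r + 1 - r = r + 1 by ring, perm_zpow_add_one_apply', step_apply,
      Edge.mirror] at hstep
    have hk := congrArg Edge.k (B.exit.injective hstep)
    rw [edgeAt_k, reflect_k] at hk
    omega

/-! ### Returns to the section -/

variable (B) in
/-- The points of the section `k = 0` whose whole past consists of steps to the right, so that
the past orbit recedes monotonically to `-∞`. -/
def PastEscaping (a : ℝ) (e : B.Edge) : Prop := ∀ i : ℕ, ((B.step a ^ (-(i : ℤ))) e).k = -i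

lemma step_zpow_k_of_add_nonpos (a : ℝ) {e : B.Edge} {l : ℕ} (hl : e.k + l ≤ 0) :
    ((B.step a ^ (l : ℤ)) e).k = e.k + l := by
  induction l with
  | zero => simp
  | succ l ih =>
    push_cast at hl
    have hk := ih (by omega)
    rw [perm_zpow_natCast_succ_apply', step_k_of_neg a (by omega), hk]
    push_cast
    ring

lemma exists_direct_of_le_k {a : ℝ} {e : B.Edge} {n j : ℕ} (hn : (n : ℤ) ≤ e.k)
    (hj : ((B.step a ^ (-(j : ℤ))) e).k = 0) :
    ∃ i ≤ j, ((B.step a ^ (-(i : ℤ))) e).k = 0 ∧ Direct a n ((B.step a ^ (-(i : ℤ))) e) := by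
  refine ⟨e.k.toNat, ?_, ?_, (direct_step_zpow_neg a (by omega)).mono (by omega)⟩
  · by_contra! hlt
    rw [step_zpow_neg_k a (by omega)] at hj
    omega
  · rw [step_zpow_neg_k a (by omega)]
    omega

lemma exists_direct_of_lt_abs_k {a : ℝ} {e : B.Edge} {n j : ℕ} (hn : (n : ℤ) < |e.k|)
    (hj : ((B.step a ^ (-(j : ℤ))) e).k = 0) :
    ∃ i ≤ j, ((B.step a ^ (-(i : ℤ))) e).k = 0 ∧ Direct a n ((B.step a ^ (-(i : ℤ))) e) := by
  induction j generalizing e with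
  | zero =>
    have hk : e.k = 0 := hj
    rw [hk, abs_zero] at hn
    omega
  | succ j ih =>
    rcases lt_or_ge e.k 0 with hneg | hpos
    · rw [abs_of_neg hneg] at hn
      rw [perm_zpow_neg_natCast_succ_apply] at hj
      suffices hsymm : ∃ i ≤ j, ((B.step a ^ (-(i : ℤ))) ((B.step a).symm e)).k = 0 ∧
          Direct a n ((B.step a ^ (-(i : ℤ))) ((B.step a).symm e)) by
        obtain ⟨i, hi, h⟩ := hsymm
        refine ⟨i + 1, by omega, ?_⟩
        rwa [perm_zpow_neg_natCast_succ_apply]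
      rcases step_symm_k_cases a e with hk | ⟨-, hk⟩
      · exact ih (by rw [hk, abs_of_neg (by omega)]; omega) hj
      · exact exists_direct_of_le_k (by omega) hj
    · rw [abs_of_nonneg hpos] at hn
      exact exists_direct_of_le_k hn.le hj

lemma step_zpow_k_pos_of_forall_ne_zero {a : ℝ} {e : B.Edge}
    (h : ∀ i : ℕ, ((B.step a ^ (i : ℤ)) e).k ≠ 0) (i : ℕ) : 0 < ((B.step a ^ (i : ℤ)) e).k := by
  by_contra! hneg
  have hl := step_zpow_k_of_add_nonpos a (e := (B.step a ^ (i : ℤ)) e)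
    (l := (-((B.step a ^ (i : ℤ)) e).k).toNat) (by omega)
  rw [perm_zpow_zpow_apply, ← Nat.cast_add] at hl
  exact h _ (hl.trans (by omega))

lemma step_zpow_k_eq_add_of_forall_ne_zero {a : ℝ} {e : B.Edge}
    (h : ∀ i : ℕ, ((B.step a ^ (i : ℤ)) e).k ≠ 0) (i : ℕ) :
    ((B.step a ^ (i : ℤ)) e).k = e.k + i := by
  induction i with
  | zero => simp
  | succ i ih =>
    have := step_zpow_k_pos_of_forall_ne_zero h i
    have hpos := step_zpow_k_pos_of_forall_ne_zero h (i + 1)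
    rw [perm_zpow_natCast_succ_apply'] at hpos ⊢
    rcases step_k_cases a ((B.step a ^ (i : ℤ)) e) with hk | ⟨-, hk⟩
    · rw [hk, ih]
      push_cast
      ring
    · omega

lemma exists_escaping_of_forall_k_ne_zero {a : ℝ} {e : B.Edge}
    (h : ∀ i : ℕ, ((B.step a ^ (i : ℤ)) e).k ≠ 0) : ∃ m : ℤ, Escaping a ((B.step a ^ m) e) := by
  have hpos : 0 < e.k := step_zpow_k_pos_of_forall_ne_zero h 0
  refine ⟨-(e.k.toNat : ℤ), fun i => ?_⟩
  rcases le_total i e.k.toNat with hi | hi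
  · rw [direct_step_zpow_neg a (by omega) i hi, step_zpow_neg_k a (by omega)]
    omega
  · rw [perm_zpow_zpow_apply,
      show (i : ℤ) + -(e.k.toNat : ℤ) = ((i - e.k.toNat : ℕ) : ℤ) by omega,
      step_zpow_k_eq_add_of_forall_ne_zero h]
    omega

lemma frequently_k_eq_zero_or_exists_escaping (a : ℝ) (e : B.Edge) :
    (∃ᶠ i : ℕ in atTop, ((B.step a ^ (i : ℤ)) e).k = 0) ∨
      ∃ m : ℤ, Escaping a ((B.step a ^ m) e) := by
  refine or_iff_not_imp_left.2 fun h => ?_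
  obtain ⟨I, hI⟩ := eventually_atTop.1 (not_frequently.1 h)
  obtain ⟨m, hm⟩ := exists_escaping_of_forall_k_ne_zero (e := (B.step a ^ (I : ℤ)) e) fun i => by
    rw [perm_zpow_zpow_apply, ← Nat.cast_add]
    exact hI _ (Nat.le_add_left _ _)
  exact ⟨m + I, by rwa [perm_zpow_zpow_apply] at hm⟩

lemma step_zpow_neg_k_neg_of_forall_ne_zero {a : ℝ} {e : B.Edge}
    (h : ∀ i : ℕ, ((B.step a ^ (-(i : ℤ))) e).k ≠ 0) (i : ℕ) :
    ((B.step a ^ (-(i : ℤ))) e).k < 0 := by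
  by_contra! hpos
  have hl := step_zpow_neg_k a (e := (B.step a ^ (-(i : ℤ))) e)
    (i := ((B.step a ^ (-(i : ℤ))) e).k.toNat) (by omega)
  rw [perm_zpow_zpow_apply, ← neg_add, ← Nat.cast_add] at hl
  exact h _ (hl.trans (by omega))

lemma step_zpow_neg_k_eq_sub_of_forall_ne_zero {a : ℝ} {e : B.Edge}
    (h : ∀ i : ℕ, ((B.step a ^ (-(i : ℤ))) e).k ≠ 0) (i : ℕ) :
    ((B.step a ^ (-(i : ℤ))) e).k = e.k - i := by
  induction i with
  | zero => simp
  | succ i ih =>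
    have := step_zpow_neg_k_neg_of_forall_ne_zero h i
    have hneg := step_zpow_neg_k_neg_of_forall_ne_zero h (i + 1)
    rw [perm_zpow_neg_natCast_succ_apply'] at hneg ⊢
    rcases step_symm_k_cases a ((B.step a ^ (-(i : ℤ))) e) with hk | ⟨-, hk⟩
    · rw [hk, ih]
      push_cast
      ring
    · omega

lemma exists_pastEscaping_of_forall_k_ne_zero {a : ℝ} {e : B.Edge}
    (h : ∀ i : ℕ, ((B.step a ^ (-(i : ℤ))) e).k ≠ 0) :
    ∃ m : ℤ, B.PastEscaping a ((B.step a ^ m) e) := by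
  have hneg : e.k < 0 := step_zpow_neg_k_neg_of_forall_ne_zero h 0
  refine ⟨(-e.k).toNat, fun i => ?_⟩
  rw [perm_zpow_zpow_apply]
  rcases le_total i (-e.k).toNat with hi | hi
  · rw [show -(i : ℤ) + ((-e.k).toNat : ℤ) = (((-e.k).toNat - i : ℕ) : ℤ) by omega,
      step_zpow_k_of_add_nonpos a (by omega)]
    omega
  · rw [show -(i : ℤ) + ((-e.k).toNat : ℤ) = -((i - (-e.k).toNat : ℕ) : ℤ) by omega,
      step_zpow_neg_k_eq_sub_of_forall_ne_zero h]
    omega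

lemma frequently_k_eq_zero_or_exists_pastEscaping (a : ℝ) (e : B.Edge) :
    (∃ᶠ i : ℕ in atTop, ((B.step a ^ (-(i : ℤ))) e).k = 0) ∨
      ∃ m : ℤ, B.PastEscaping a ((B.step a ^ m) e) := by
  refine or_iff_not_imp_left.2 fun h => ?_
  obtain ⟨I, hI⟩ := eventually_atTop.1 (not_frequently.1 h)
  obtain ⟨m, hm⟩ := exists_pastEscaping_of_forall_k_ne_zero (e := (B.step a ^ (-(I : ℤ))) e)
    fun i => by
      rw [perm_zpow_zpow_apply, ← neg_add, ← Nat.cast_add]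
      exact hI _ (Nat.le_add_left _ _)
  exact ⟨m + -I, by rwa [perm_zpow_zpow_apply] at hm⟩

/-! ### Past escape and the rotation by a half turn -/

lemma step_edgeAt_neg_step_y {a t : ℝ} {f : B.Edge} (hf : f.k < 0)
    (ht : -f.y - t ∈ Ico (-B.h (-f.k)) (B.h (-f.k))) :
    B.step a (B.edgeAt (-f.k - 1) (-(B.step a f).y - t)) = B.edgeAt (-f.k) (-f.y - t) := by
  have hle : B.h (-f.k) ≤ B.h (-f.k - 1) := by
    simpa using h_succ_le (B := B) (k := -f.k - 1) (by omega)
  have hshift : B.edgeAt (-f.k - 1) (-(B.step a f).y - t + a) =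
      B.edgeAt (-f.k - 1) (-f.y - t) := by
    obtain ⟨m, hm⟩ := B.wrap_eq_sub f.k (f.y + a)
    refine edgeAt_eq_edgeAt_iff.2 ⟨m, ?_⟩
    rw [step_y, hm, h_reflect]
    ring
  have hy : (B.edgeAt (-f.k - 1) (-f.y - t)).y = -f.y - t :=
    edgeAt_y_of_mem ⟨by linarith [ht.1], by linarith [ht.2]⟩
  rw [step_apply, edgeAt_k, edgeAt_y, edgeAt_wrap_add, hshift, exit_of_mem] <;>
    rw [hy, edgeAt_k, sub_add_cancel]
  exact ht

lemma PastEscaping.y_mem_Ico {a : ℝ} {g : B.Edge} (hg : B.PastEscaping a g) (i : ℕ) :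
    ((B.step a ^ (-(i : ℤ))) g).y ∈ Ico (-B.p i) (B.p i) := by
  have hmem := B.wrap_mem ((B.step a ^ (-((i + 1 : ℕ) : ℤ))) g).k
    (((B.step a ^ (-((i + 1 : ℕ) : ℤ))) g).y + a)
  rwa [← step_y, hg, Nat.cast_succ, neg_add, ← sub_eq_add_neg, h_neg_natCast_sub_one,
    perm_zpow_sub_one_apply, Equiv.apply_symm_apply] at hmem

lemma PastEscaping.step_zpow_edgeAt {a t : ℝ} {g : B.Edge} (hg : B.PastEscaping a g) {n : ℕ}
    (ht : ∀ i ≤ n, -((B.step a ^ (-(i : ℤ))) g).y - t ∈ Ico (-B.p i) (B.p i)) {i : ℕ}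
    (hi : i ≤ n) : (B.step a ^ (i : ℤ)) (B.edgeAt 0 (-g.y - t)) =
      B.edgeAt i (-((B.step a ^ (-(i : ℤ))) g).y - t) := by
  induction i with
  | zero => rfl
  | succ i ih =>
    have hk := hg (i + 1)
    have hy := ht (i + 1) hi
    have hback := perm_zpow_neg_natCast_succ_apply' (B.step a) i g
    set f := (B.step a ^ (-((i + 1 : ℕ) : ℤ))) g
    rw [← h_natCast, ← neg_neg ((i + 1 : ℕ) : ℤ), ← hk] at hy
    have hstep := step_edgeAt_neg_step_y (a := a) (by omega) hy
    rw [hk, neg_neg, hback, Equiv.apply_symm_apply, ← hback, Nat.cast_succ,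
      add_sub_cancel_right] at hstep
    rw [perm_zpow_natCast_succ_apply', ih (by omega), hstep, Nat.cast_succ]

lemma PastEscaping.eventually_direct {a : ℝ} {g : B.Edge} (hg : B.PastEscaping a g) (n : ℕ) :
    ∀ᶠ t in 𝓝[>] (0 : ℝ),
      (B.edgeAt 0 (-g.y - t)).y = -g.y - t ∧ Direct a n (B.edgeAt 0 (-g.y - t)) := by
  have hsmall : ∀ᶠ t in 𝓝[>] (0 : ℝ),
      ∀ i ∈ {i | i ≤ n}, t < B.p i - ((B.step a ^ (-(i : ℤ))) g).y :=
    (eventually_all_finite (finite_le_nat n)).2 fun i _ =>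
      eventually_nhdsWithin_of_eventually_nhds (eventually_lt_nhds (sub_pos.2 (hg.y_mem_Ico i).2))
  filter_upwards [hsmall, self_mem_nhdsWithin] with t ht ht₀
  have ht₀ : 0 < t := ht₀
  have hmem : ∀ i ≤ n, -((B.step a ^ (-(i : ℤ))) g).y - t ∈ Ico (-B.p i) (B.p i) := fun i hi =>
    ⟨by linarith [ht i hi], by linarith [(hg.y_mem_Ico i).1]⟩
  refine ⟨edgeAt_y_of_mem (hmem 0 n.zero_le), fun i hi => ?_⟩
  rw [hg.step_zpow_edgeAt hmem hi, edgeAt_k, edgeAt_k, zero_add]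

/-! ### The escape point of a typical direction -/

lemma mem_orbit_toPhase_iff {θ : ℝ} (hc : Real.cos θ ≠ 0) {z : B.Phase} {e : B.Edge} :
    z ∈ B.orbit θ e.toPhase ↔ (B.step (Real.tan θ)).SameCycle e (B.base (Real.tan θ) z) := by
  constructor
  · rintro ⟨t, rfl⟩
    refine ⟨⌊Int.fract e.toPhase.X + t * Real.cos θ⌋, ?_⟩
    change _ = B.base (Real.tan θ) (B.flow θ t e.toPhase)
    rw [base_flow, base_toPhase]
  · intro h
    obtain ⟨n, rfl⟩ := h.symm
    rw [orbit_eq_of_mem (toPhase_mem_orbit hc n z)]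
    exact mem_orbit_self θ z

lemma toPhase_mem_orbit_iff {θ : ℝ} (hc : Real.cos θ ≠ 0) {f e : B.Edge} :
    f.toPhase ∈ B.orbit θ e.toPhase ↔ (B.step (Real.tan θ)).SameCycle e f := by
  rw [mem_orbit_toPhase_iff hc, base_toPhase]

lemma Escaping.eq_of_sameCycle {a : ℝ} {e f : B.Edge} (he : Escaping a e) (hf : Escaping a f)
    (h : (B.step a).SameCycle e f) : e = f := by
  have heq_of_natCast {e f : B.Edge} (he : Escaping a e) (hf : Escaping a f) (i : ℕ)
      (hi : (B.step a ^ (i : ℤ)) e = f) : e = f := by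
    have hi₀ : (i : ℤ) = 0 := by rw [← he i, hi, hf.k_eq_zero]
    rwa [hi₀] at hi
  obtain ⟨n, hn⟩ := h
  obtain ⟨i, rfl | rfl⟩ := n.eq_nat_or_neg
  · exact heq_of_natCast he hf i hn
  · exact (heq_of_natCast hf he i (by rw [← hn, perm_zpow_zpow_apply, add_neg_cancel]; rfl)).symm

variable (B) in
/-- `e₀` is the only edge point from which the orbit goes to infinity by steps to the right, and
its orbit meets no vertex. In a typical direction this is the point where the escape orbit crosses
the section `k = 0` for the last time. -/
structure IsSoleEscape (a : ℝ) (e₀ : B.Edge) : Prop where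
  escaping : Escaping a e₀
  unique : ∀ f : B.Edge, Escaping a f → f = e₀
  regular : B.Regular a e₀

lemma IsTypical.exists_isSoleEscape {θ : ℝ} (hc : 0 < Real.cos θ) (hT : B.IsTypical θ) :
    ∃ e₀, B.IsSoleEscape (Real.tan θ) e₀ ∧
      ∀ η, B.IsEscapeOrbit θ η → η = B.orbit θ e₀.toPhase := by
  obtain ⟨O, ⟨z, hz, rfl⟩, huniq⟩ := hT.existsUnique
  obtain ⟨e₀, rfl⟩ := exists_toPhase_eq_of_mem_escapePoints hz
  have hesc := (toPhase_mem_escapePoints_iff hc).1 hz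
  refine ⟨e₀, ⟨hesc, fun f hf => ?_, fun n => ?_⟩, huniq⟩
  · have horbit := huniq _ ⟨_, (toPhase_mem_escapePoints_iff hc).2 hf, rfl⟩
    have hmem : f.toPhase ∈ B.orbit θ e₀.toPhase := horbit ▸ mem_orbit_self θ f.toPhase
    exact (hesc.eq_of_sameCycle hf ((toPhase_mem_orbit_iff hc.ne').1 hmem)).symm
  · exact hT.noVertex _ ⟨_, hz, rfl⟩ _ ((toPhase_mem_orbit_iff hc.ne').2 ⟨n, rfl⟩)

namespace IsSoleEscape

variable {a : ℝ} {e₀ : B.Edge}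

lemma k_eq_zero (h : B.IsSoleEscape a e₀) : e₀.k = 0 := h.escaping.k_eq_zero

lemma mem_Ioo (h : B.IsSoleEscape a e₀) : e₀.y ∈ Ioo (-1 : ℝ) 1 := by
  have := h.regular.mem_Ioo
  rwa [h.k_eq_zero, h_zero] at this

lemma edgeAt_zero_y (h : B.IsSoleEscape a e₀) : B.edgeAt 0 e₀.y = e₀ := by
  rw [← h.k_eq_zero, edgeAt_k_y]

lemma exists_not_direct_edgeAt_add (h : B.IsSoleEscape a e₀) {s : ℝ} (hs₀ : s ≠ 0)
    (hs : |s| < 2) : ∃ n, ¬ Direct a n (B.edgeAt 0 (e₀.y + s)) := by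
  by_contra! hdirect
  have heq : B.edgeAt 0 (e₀.y + s) = e₀ := h.unique _ (escaping_iff.2 ⟨rfl, hdirect⟩)
  have htranslate : e₀.translate s = e₀.translate 0 := by
    rw [Edge.translate, Edge.translate, h.k_eq_zero, heq, add_zero, h.edgeAt_zero_y]
  refine hs₀ (translate_injOn htranslate ?_)
  rwa [sub_zero, h.k_eq_zero, h_zero, mul_one]

lemma mirror_eq (h : B.IsSoleEscape a e₀) : e₀.mirror = B.edgeAt 0 (-e₀.y) := by
  have hmem : e₀.reflect.y ∈ Ico (-(B.h (e₀.reflect.k + 1))) (B.h (e₀.reflect.k + 1)) := by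
    rw [h.regular.reflect_y, reflect_k, sub_add_cancel, h.k_eq_zero, neg_zero, h_zero]
    exact ⟨neg_le_neg h.mem_Ioo.2.le, neg_lt.1 h.mem_Ioo.1⟩
  rw [Edge.mirror, exit_of_mem hmem, h.regular.reflect_y, reflect_k, sub_add_cancel, h.k_eq_zero,
    neg_zero]

lemma pastEscaping_mirror (h : B.IsSoleEscape a e₀) : B.PastEscaping a e₀.mirror := by
  intro i
  have hk : ((B.step a ^ (i : ℤ)) e₀).k = i := h.escaping i
  rw [step_zpow_mirror _ fun j _ => h.regular.notMem_stepCut j, neg_neg, Edge.mirror,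
    exit_k_of_neg (by rw [reflect_k]; omega), reflect_k, hk, sub_add_cancel]

end IsSoleEscape

lemma IsTypical.frequently_direct_edgeAt_iff {θ : ℝ} (hc : 0 < Real.cos θ) (hT : B.IsTypical θ) :
    ∃ᶠ N : ℕ in atTop, ∃ α β : ℝ, ∀ y : ℝ,
      Direct (Real.tan θ) N (B.edgeAt 0 y) ↔ ∃ m : ℤ, y + 2 * m ∈ Ico α β := by
  refine hT.singleInterval.mono ?_
  rintro N ⟨α, β, -, hS⟩
  refine ⟨α, β, fun y => ?_⟩
  have hreach : Direct (Real.tan θ) N (B.edgeAt 0 y) ↔ (B.edgeAt 0 y).toPhase ∈ B.reach θ N := by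
    rw [mem_reach_iff hc, edgeAt_k, and_iff_right rfl]
  obtain ⟨l, hl⟩ := B.wrap_eq_sub 0 y
  rw [hreach, hS, mem_ofPred_eq, toPhase_mem_section0_iff, edgeAt_k, and_iff_right rfl, toPhase_Y,
    edgeAt_y, hl, h_zero]
  refine (Equiv.subRight l).exists_congr fun m => ?_
  rw [Equiv.subRight_apply, Int.cast_sub, show y - l * (2 * 1) + 2 * m = y + 2 * (m - l) by ring]

-- Close to the escape point on either side there are points which do not move directly to some
-- aperture; as the points which do form a single interval, they are confined between these two.
lemma IsTypical.exists_forall_direct_abs_sub_lt {θ : ℝ} (hc : 0 < Real.cos θ)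
    (hT : B.IsTypical θ) {e₀ : B.Edge} (h : B.IsSoleEscape (Real.tan θ) e₀) {ε : ℝ} (hε : 0 < ε) :
    ∃ N, ∀ f : B.Edge, f.k = 0 → Direct (Real.tan θ) N f → |f.y - e₀.y| < ε := by
  have hy₀ := h.mem_Ioo
  set r := min ε (1 - |e₀.y|)
  have hr : 0 < r := lt_min hε (sub_pos.2 (abs_lt.2 hy₀))
  have hr₁ : r ≤ 1 - |e₀.y| := min_le_right _ _
  have hr₂ : |r| < 2 := by
    rw [abs_of_pos hr]
    linarith [abs_nonneg e₀.y]
  obtain ⟨n₁, hn₁⟩ := h.exists_not_direct_edgeAt_add hr.ne' hr₂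
  obtain ⟨n₂, hn₂⟩ := h.exists_not_direct_edgeAt_add (neg_ne_zero.2 hr.ne') (by rwa [abs_neg])
  obtain ⟨N, hN, α, β, hαβ⟩ :=
    frequently_atTop.1 (hT.frequently_direct_edgeAt_iff hc) (max n₁ n₂)
  obtain ⟨m₀, hm₀⟩ := (hαβ e₀.y).1 (by
    rw [h.edgeAt_zero_y]
    exact h.escaping.direct_step_zpow 0 N)
  refine ⟨N, fun f hf hd => ?_⟩
  obtain ⟨m, hm⟩ := (hαβ f.y).1 (by rwa [← hf, edgeAt_k_y])
  have hnotMem {n : ℕ} {s : ℝ} (hn : n ≤ N) (hs : ¬ Direct (Real.tan θ) n (B.edgeAt 0 (e₀.y + s))) :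
      e₀.y + 2 * m₀ + s ∉ Ico α β := fun hmem =>
    hs (((hαβ _).2 ⟨m₀, by rwa [add_right_comm]⟩).mono hn)
  have hclose : |f.y + 2 * m - (e₀.y + 2 * m₀)| < r :=
    abs_sub_lt_of_add_sub_notMem_Ico hr.le hm hm₀ (hnotMem (le_of_max_le_left hN) hn₁)
      (by simpa only [sub_eq_add_neg] using hnotMem (le_of_max_le_right hN) hn₂)
  have hmm : m = m₀ := by
    have hfy := f.mem
    rw [hf, h_zero] at hfy
    have hbound := abs_lt.1 (hclose.trans_le hr₁)
    have hlo : ((m₀ - 1 : ℤ) : ℝ) < m := by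
      push_cast
      linarith [hfy.2, neg_abs_le e₀.y]
    have hhi : (m : ℝ) < (m₀ + 1 : ℤ) := by
      push_cast
      linarith [hfy.1, le_abs_self e₀.y]
    have hlo := Int.cast_lt.1 hlo
    have hhi := Int.cast_lt.1 hhi
    omega
  rw [hmm, add_sub_add_right_eq_sub] at hclose
  exact hclose.trans_le (min_le_left _ _)

lemma IsTypical.eq_mirror_of_pastEscaping {θ : ℝ} (hc : 0 < Real.cos θ) (hT : B.IsTypical θ)
    {e₀ g : B.Edge} (h : B.IsSoleEscape (Real.tan θ) e₀) (hg : B.PastEscaping (Real.tan θ) g) :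
    g = e₀.mirror := by
  have hy : -g.y = e₀.y := by
    refine eq_of_forall_dist_le fun ε hε => ?_
    obtain ⟨N, hN⟩ := hT.exists_forall_direct_abs_sub_lt hc h (half_pos hε)
    obtain ⟨t, ⟨hty, hd⟩, ht₀, htε⟩ := ((hg.eventually_direct N).and
      (Ioo_mem_nhdsGT (half_pos hε))).exists
    have hclose := abs_lt.1 (hN _ rfl hd)
    rw [hty] at hclose
    exact abs_le.2 ⟨by linarith, by linarith⟩
  rw [h.mirror_eq, ← hy, neg_neg, ← show g.k = 0 from hg 0, edgeAt_k_y]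

lemma flow_eq_toPhase {θ : ℝ} (hc : Real.cos θ ≠ 0) (n : ℤ) (z : B.Phase) :
    B.flow θ ((n - Int.fract z.X) / Real.cos θ) z =
      ((B.step (Real.tan θ) ^ n) (B.base (Real.tan θ) z)).toPhase := by
  conv_lhs => rw [← flow_base hc z]
  rw [flow_flow, flow_base hc z, ← flow_int_toPhase hc]
  congr 1
  ring

/-! ### Escape in the past -/

lemma PastEscaping.step_zpow_k {a : ℝ} {g : B.Edge} (hg : B.PastEscaping a g) {l : ℤ}
    (hl : l ≤ 0) : ((B.step a ^ l) g).k = l := by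
  obtain ⟨i, rfl⟩ := Int.exists_eq_neg_ofNat hl
  exact hg i

lemma PastEscaping.escapesInPast {θ : ℝ} (hc : 0 < Real.cos θ) {z : B.Phase} {n : ℤ}
    (h : B.PastEscaping (Real.tan θ) ((B.step (Real.tan θ) ^ n) (B.base (Real.tan θ) z))) :
    B.EscapesInPast θ z := by
  have hlim : Tendsto (fun t => -(Real.cos θ * t) + (n - 2)) atBot atTop :=
    tendsto_atTop_add_const_right _ _
      (tendsto_neg_atBot_atTop.comp (tendsto_id.const_mul_atBot hc))
  refine tendsto_atTop_mono' _ ?_ hlim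
  filter_upwards [eventually_le_atBot ((n - 1) / Real.cos θ)] with t ht
  rw [le_div_iff₀ hc] at ht
  have hfloor := Int.floor_le (Int.fract z.X + t * Real.cos θ)
  have hfract := Int.fract_lt_one z.X
  have hX := abs_X_sub_base_k_le (Real.tan θ) (B.flow θ t z)
  rw [base_flow] at hX
  set j := ⌊Int.fract z.X + t * Real.cos θ⌋
  have hjn : j ≤ n := by
    rw [← Int.cast_le (R := ℝ)]
    linarith
  have hk := h.step_zpow_k (sub_nonpos.2 hjn)
  rw [perm_zpow_zpow_apply, sub_add_cancel] at hk
  rw [hk, Int.cast_sub] at hX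
  linarith [(abs_le.1 hX).2, neg_abs_le (B.flow θ t z).X]

lemma exists_pastEscaping_of_escapesInPast {θ : ℝ} (hc : 0 < Real.cos θ) {z : B.Phase}
    (hz : B.EscapesInPast θ z) :
    ∃ m : ℤ, B.PastEscaping (Real.tan θ) ((B.step (Real.tan θ) ^ m) (B.base (Real.tan θ) z)) := by
  refine (frequently_k_eq_zero_or_exists_pastEscaping _ _).resolve_left fun hret => ?_
  have hlim : Tendsto (fun i : ℕ => ((-(i : ℤ) : ℤ) : ℝ) / Real.cos θ) atTop atBot :=
    (tendsto_intCast_atBot_iff.2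
      (tendsto_neg_atTop_atBot.comp tendsto_natCast_atTop_atTop)).atBot_div_const hc
  obtain ⟨i, hk, hfar⟩ :=
    (hret.and_eventually (hlim.eventually (hz.eventually (eventually_ge_atTop 2)))).exists
  have hX := abs_X_sub_base_k_le (Real.tan θ) (B.flow θ (((-(i : ℤ) : ℤ) : ℝ) / Real.cos θ) z)
  rw [base_flow_int hc.ne', hk, Int.cast_zero, sub_zero] at hX
  linarith

lemma IsTypical.escapesInPast_iff {θ : ℝ} (hc : 0 < Real.cos θ) (hT : B.IsTypical θ) {e₀ : B.Edge}
    (h : B.IsSoleEscape (Real.tan θ) e₀) {z : B.Phase} :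
    B.EscapesInPast θ z ↔ z ∈ B.orbit θ e₀.mirror.toPhase := by
  rw [mem_orbit_toPhase_iff hc.ne', Equiv.Perm.sameCycle_comm]
  constructor
  · intro hz
    obtain ⟨m, hm⟩ := exists_pastEscaping_of_escapesInPast hc hz
    exact ⟨m, hT.eq_mirror_of_pastEscaping hc h hm⟩
  · rintro ⟨n, hn⟩
    exact PastEscaping.escapesInPast hc (hn ▸ h.pastEscaping_mirror)

lemma IsTypical.oscillatesInPast {θ : ℝ} (hc : 0 < Real.cos θ) (hT : B.IsTypical θ)
    {e₀ : B.Edge} (h : B.IsSoleEscape (Real.tan θ) e₀) {z : B.Phase}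
    (hz : z ∈ B.orbit θ e₀.toPhase) : B.OscillatesInPast θ z := by
  refine ⟨hT.unboundedInPast z, fun hesc => h.regular.not_sameCycle_mirror ?_⟩
  rw [hT.escapesInPast_iff hc h, mem_orbit_toPhase_iff hc.ne'] at hesc
  exact ((mem_orbit_toPhase_iff hc.ne').1 hz).trans hesc.symm

/-! ### Approaching the escape orbit -/

lemma lt_abs_step_zpow_k {θ t M : ℝ} {e : B.Edge} (h : M + 1 < |(B.flow θ t e.toPhase).X|) :
    M < |(((B.step (Real.tan θ) ^ ⌊t * Real.cos θ⌋) e).k : ℝ)| := by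
  have hX := abs_X_sub_base_k_le (Real.tan θ) (B.flow θ t e.toPhase)
  rw [base_flow, base_toPhase, toPhase_X, Int.fract_intCast, zero_add] at hX
  linarith [abs_sub_abs_le_abs_sub (B.flow θ t e.toPhase).X
    ((B.step (Real.tan θ) ^ ⌊t * Real.cos θ⌋) e).k]

lemma IsTypical.exists_lt_abs_step_zpow_k {θ : ℝ} (hc : 0 < Real.cos θ) (hT : B.IsTypical θ)
    (e : B.Edge) (n : ℕ) : ∃ i : ℕ, (n : ℤ) < |((B.step (Real.tan θ) ^ (i : ℤ)) e).k| := by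
  obtain ⟨t, ht, hfar⟩ := hT.unboundedInFuture e.toPhase (n + 1)
  obtain ⟨i, hi⟩ := Int.eq_ofNat_of_zero_le (Int.floor_nonneg.2 (mul_nonneg ht hc.le))
  have hk := lt_abs_step_zpow_k hfar
  rw [hi] at hk
  exact ⟨i, by exact_mod_cast hk⟩

lemma IsTypical.exists_lt_abs_step_zpow_neg_k {θ : ℝ} (hc : 0 < Real.cos θ) (hT : B.IsTypical θ)
    (e : B.Edge) (n : ℕ) : ∃ i : ℕ, (n : ℤ) < |((B.step (Real.tan θ) ^ (-(i : ℤ))) e).k| := by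
  obtain ⟨t, ht, hfar⟩ := hT.unboundedInPast e.toPhase (n + 1)
  obtain ⟨i, hi⟩ := Int.exists_eq_neg_ofNat
    (Int.floor_nonpos (mul_nonpos_of_nonpos_of_nonneg ht hc.le))
  have hk := lt_abs_step_zpow_k hfar
  rw [hi] at hk
  exact ⟨i, by exact_mod_cast hk⟩

-- Between two visits to the section an unbounded orbit goes arbitrarily far out, hence the last
-- visit before it gets there is close to the escape point.
lemma IsTypical.frequently_future_near {θ : ℝ} (hc : 0 < Real.cos θ) (hT : B.IsTypical θ)
    {e₀ : B.Edge} (h : B.IsSoleEscape (Real.tan θ) e₀) {e : B.Edge}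
    (he : ¬ (B.step (Real.tan θ)).SameCycle e₀ e) {ε : ℝ} (hε : 0 < ε) :
    ∃ᶠ i : ℕ in atTop, ((B.step (Real.tan θ) ^ (i : ℤ)) e).k = 0 ∧
      |((B.step (Real.tan θ) ^ (i : ℤ)) e).y - e₀.y| < ε := by
  obtain ⟨N, hN⟩ := hT.exists_forall_direct_abs_sub_lt hc h hε
  rcases frequently_k_eq_zero_or_exists_escaping (Real.tan θ) e with hret | ⟨m, hm⟩
  · refine frequently_atTop.2 fun I => ?_
    obtain ⟨i, hi, hk₀⟩ := frequently_atTop.1 hret I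
    obtain ⟨j, hj⟩ := hT.exists_lt_abs_step_zpow_k hc ((B.step (Real.tan θ) ^ (i : ℤ)) e) N
    obtain ⟨l, hl, hk, hd⟩ := exists_direct_of_lt_abs_k (j := j) hj (by
      rwa [perm_zpow_neg_zpow_apply])
    rw [perm_zpow_zpow_apply, perm_zpow_zpow_apply,
      show -(l : ℤ) + j + i = ((i + (j - l) : ℕ) : ℤ) by omega] at hk hd
    exact ⟨_, by omega, hk, hN _ hk hd⟩
  · exact absurd (Equiv.Perm.SameCycle.symm ⟨m, h.unique _ hm⟩) he

lemma IsTypical.frequently_past_near {θ : ℝ} (hc : 0 < Real.cos θ) (hT : B.IsTypical θ)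
    {e₀ : B.Edge} (h : B.IsSoleEscape (Real.tan θ) e₀) {e : B.Edge}
    (he : ¬ (B.step (Real.tan θ)).SameCycle e₀.mirror e) {ε : ℝ} (hε : 0 < ε) :
    ∃ᶠ i : ℕ in atTop, ((B.step (Real.tan θ) ^ (-(i : ℤ))) e).k = 0 ∧
      |((B.step (Real.tan θ) ^ (-(i : ℤ))) e).y - e₀.y| < ε := by
  obtain ⟨N, hN⟩ := hT.exists_forall_direct_abs_sub_lt hc h hε
  rcases frequently_k_eq_zero_or_exists_pastEscaping (Real.tan θ) e with hret | ⟨m, hm⟩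
  · refine frequently_atTop.2 fun I => ?_
    obtain ⟨j, hj⟩ := hT.exists_lt_abs_step_zpow_neg_k hc ((B.step (Real.tan θ) ^ (-(I : ℤ))) e) N
    obtain ⟨i, hi, hk₀⟩ := frequently_atTop.1 hret (I + j)
    rw [perm_zpow_zpow_apply] at hj
    obtain ⟨l, -, hk, hd⟩ := exists_direct_of_lt_abs_k (j := i - I - j) hj (by
      rwa [perm_zpow_zpow_apply, show -((i - I - j : ℕ) : ℤ) + (-j + -I) = -i by omega])
    rw [perm_zpow_zpow_apply, show -(l : ℤ) + (-j + -I) = -((I + j + l : ℕ) : ℤ) by omega] at hk hd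
    exact ⟨_, by omega, hk, hN _ hk hd⟩
  · exact absurd (Equiv.Perm.SameCycle.symm ⟨m, hT.eq_mirror_of_pastEscaping hc h hm⟩) he

variable (B) in
/-- The orbit of `z` crosses the section `k = 0` arbitrarily close to the height `y₀`, frequently
along `l`. -/
def Approaches (θ : ℝ) (l : Filter ℝ) (y₀ : ℝ) (z : B.Phase) : Prop :=
  ∀ U ∈ 𝓝 y₀, ∃ᶠ t in l, ∃ y ∈ U, B.flow θ t z = (B.edgeAt 0 y).toPhase

lemma approaches_of_frequently {θ : ℝ} (hc : Real.cos θ ≠ 0) {l : Filter ℝ} {y₀ : ℝ} {z : B.Phase}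
    {n : ℕ → ℤ} (hn : Tendsto (fun i => ((n i : ℝ) - Int.fract z.X) / Real.cos θ) atTop l)
    (h : ∀ ε > 0, ∃ᶠ i in atTop, ((B.step (Real.tan θ) ^ n i) (B.base (Real.tan θ) z)).k = 0 ∧
      |((B.step (Real.tan θ) ^ n i) (B.base (Real.tan θ) z)).y - y₀| < ε) :
    B.Approaches θ l y₀ z := by
  intro U hU
  obtain ⟨ε, hε, hball⟩ := Metric.mem_nhds_iff.1 hU
  refine hn.frequently ((h ε hε).mono ?_)
  rintro i ⟨hk, hy⟩
  refine ⟨_, hball hy, ?_⟩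
  rw [flow_eq_toPhase hc, ← hk, edgeAt_k_y]

lemma IsTypical.approaches_future {θ : ℝ} (hc : 0 < Real.cos θ) (hT : B.IsTypical θ)
    {e₀ : B.Edge} (h : B.IsSoleEscape (Real.tan θ) e₀) {z : B.Phase}
    (hz : z ∉ B.orbit θ e₀.toPhase) : B.Approaches θ atTop e₀.y z := by
  rw [mem_orbit_toPhase_iff hc.ne'] at hz
  refine approaches_of_frequently hc.ne' (Tendsto.atTop_div_const hc
    (tendsto_atTop_add_const_right _ _ ?_)) fun ε hε => hT.frequently_future_near hc h hz hε
  exact tendsto_intCast_atTop_atTop.comp tendsto_natCast_atTop_atTop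

lemma IsTypical.approaches_past {θ : ℝ} (hc : 0 < Real.cos θ) (hT : B.IsTypical θ)
    {e₀ : B.Edge} (h : B.IsSoleEscape (Real.tan θ) e₀) {z : B.Phase}
    (hz : ¬ B.EscapesInPast θ z) : B.Approaches θ atBot e₀.y z := by
  rw [hT.escapesInPast_iff hc h, mem_orbit_toPhase_iff hc.ne'] at hz
  refine approaches_of_frequently hc.ne' (Tendsto.atBot_div_const hc
    (tendsto_atBot_add_const_right _ _ ?_)) fun ε hε => hT.frequently_past_near hc h hz hε
  exact tendsto_intCast_atBot_iff.2 (tendsto_neg_atTop_atBot.comp tendsto_natCast_atTop_atTop)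

lemma IsSoleEscape.continuousAt_proj_flow {θ : ℝ} {e₀ : B.Edge}
    (h : B.IsSoleEscape (Real.tan θ) e₀) (s : ℝ) :
    ContinuousAt (fun q : ℝ × ℝ => B.proj (B.flow θ q.2 (B.edgeAt 0 q.1).toPhase)) (e₀.y, s) := by
  refine StepBilliard.continuousAt_proj_flow (fun n => ?_) s
  have hlim : Tendsto (fun y => y - e₀.y) (𝓝 e₀.y) (𝓝 0) := tendsto_sub_nhds_zero_iff.2 tendsto_id
  filter_upwards [hlim.eventually (h.regular.eventually_step_zpow_translate n)] with y hy
  rw [h.edgeAt_zero_y, ← hy, Edge.translate, h.k_eq_zero, add_sub_cancel]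

lemma IsSoleEscape.eventually_forall_mem {θ : ℝ} {e₀ : B.Edge}
    (h : B.IsSoleEscape (Real.tan θ) e₀) {W : Set (B.Surface × B.Surface)} (hW : IsOpen W)
    (hdiag : ∀ x, (x, x) ∈ W) {K : Set ℝ} (hK : IsCompact K) :
    ∀ᶠ y in 𝓝 e₀.y, ∀ s ∈ K,
      (B.proj (B.flow θ s (B.edgeAt 0 y).toPhase), B.proj (B.flow θ s e₀.toPhase)) ∈ W := by
  refine hK.eventually_forall_of_forall_eventually fun s _ => ?_
  have hflow := h.continuousAt_proj_flow s
  have hescape : ContinuousAt (fun q : ℝ × ℝ => B.proj (B.flow θ q.2 e₀.toPhase)) (e₀.y, s) := by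
    have hconst : ContinuousAt (fun q : ℝ × ℝ => (e₀.y, q.2)) (e₀.y, s) := by fun_prop
    simpa only [Function.comp_def, h.edgeAt_zero_y] using hflow.comp_of_eq hconst rfl
  refine (hflow.prodMk hescape).eventually (hW.mem_nhds ?_)
  simp only [h.edgeAt_zero_y]
  exact hdiag _

lemma Approaches.shadow {θ : ℝ} {l : Filter ℝ} {e₀ : B.Edge} (h : B.IsSoleEscape (Real.tan θ) e₀)
    {z w : B.Phase} (hz : B.Approaches θ l e₀.y z) (hw : w ∈ B.orbit θ e₀.toPhase)
    {W : Set (B.Surface × B.Surface)} (hW : IsOpen W) (hdiag : ∀ x, (x, x) ∈ W)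
    (hl : ∀ u : ℝ, Tendsto (· + u) l l) (T : ℝ) :
    ∃ᶠ t in l, ∀ s ∈ Icc (-T) T,
      (B.proj (B.flow θ (t + s) z), B.proj (B.flow θ s w)) ∈ W := by
  obtain ⟨u, rfl⟩ := hw
  refine (hl u).frequently
    ((hz _ (h.eventually_forall_mem hW hdiag (isCompact_Icc (a := u - T) (b := u + T)))).mono ?_)
  rintro t ⟨y, hy, ht⟩ s hs
  have hmem := hy (u + s) ⟨by linarith [hs.1], by linarith [hs.2]⟩
  rwa [← ht, flow_flow, ← add_assoc, ← flow_flow θ s u e₀.toPhase] at hmem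

lemma Approaches.subset_omegaLimit {θ : ℝ} {l : Filter ℝ} {e₀ : B.Edge}
    (h : B.IsSoleEscape (Real.tan θ) e₀) {z : B.Phase} (hz : B.Approaches θ l e₀.y z)
    (hl : ∀ u : ℝ, Tendsto (· + u) l l) :
    B.proj '' B.orbit θ e₀.toPhase ⊆ omegaLimit l (fun t w => B.proj (B.flow θ t w)) {z} := by
  rintro _ ⟨_, ⟨u, rfl⟩, rfl⟩
  rw [mem_omegaLimit_singleton_iff_mapClusterPt, mapClusterPt_iff_frequently]
  intro U hU
  have hcont : ContinuousAt (fun y => B.proj (B.flow θ u (B.edgeAt 0 y).toPhase)) e₀.y :=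
    ContinuousAt.comp (g := fun q : ℝ × ℝ => B.proj (B.flow θ q.2 (B.edgeAt 0 q.1).toPhase))
      (f := fun y => (y, u)) (h.continuousAt_proj_flow u) (by fun_prop)
  have hU' : U ∈ 𝓝 (B.proj (B.flow θ u (B.edgeAt 0 e₀.y).toPhase)) := by rwa [h.edgeAt_zero_y]
  refine (hl u).frequently ((hz _ (hcont hU')).mono ?_)
  rintro t ⟨y, hy, ht⟩
  rwa [mem_preimage, ← ht, flow_flow] at hy

lemma omegaLim_subset_closure (θ : ℝ) (z : B.Phase) :
    B.omegaLim θ z ⊆ closure (B.proj '' B.orbit θ z) := by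
  refine (omegaLimit_subset_closure_image2 _ _ _ univ_mem).trans (closure_mono ?_)
  rintro _ ⟨t, -, w, rfl, rfl⟩
  exact ⟨_, ⟨t, rfl⟩, rfl⟩

lemma IsTypical.subset_omegaLim {θ : ℝ} (hc : 0 < Real.cos θ) (hT : B.IsTypical θ)
    {e₀ : B.Edge} (h : B.IsSoleEscape (Real.tan θ) e₀) {z : B.Phase}
    (hz : z ∉ B.orbit θ e₀.toPhase) : B.proj '' B.orbit θ e₀.toPhase ⊆ B.omegaLim θ z :=
  (hT.approaches_future hc h hz).subset_omegaLimit h fun _ =>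
    tendsto_atTop_add_const_right _ _ tendsto_id

lemma IsTypical.subset_alphaLim {θ : ℝ} (hc : 0 < Real.cos θ) (hT : B.IsTypical θ)
    {e₀ : B.Edge} (h : B.IsSoleEscape (Real.tan θ) e₀) {z : B.Phase}
    (hz : ¬ B.EscapesInPast θ z) : B.proj '' B.orbit θ e₀.toPhase ⊆ B.alphaLim θ z :=
  (hT.approaches_past hc h hz).subset_omegaLimit h fun _ =>
    tendsto_atBot_add_const_right _ _ tendsto_id

lemma IsTypical.exists_shadow_future {θ : ℝ} (hc : 0 < Real.cos θ) (hT : B.IsTypical θ)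
    {e₀ : B.Edge} (h : B.IsSoleEscape (Real.tan θ) e₀) {z w : B.Phase}
    (hz : z ∉ B.orbit θ e₀.toPhase) (hw : w ∈ B.orbit θ e₀.toPhase)
    {W : Set (B.Surface × B.Surface)} (hW : IsOpen W) (hdiag : ∀ x, (x, x) ∈ W) (T : ℝ) :
    ∃ t₀ ≥ T, ∀ s ∈ Icc (-T) T, (B.proj (B.flow θ (t₀ + s) z), B.proj (B.flow θ s w)) ∈ W :=
  frequently_atTop.1 ((hT.approaches_future hc h hz).shadow h hw hW hdiag
    (fun _ => tendsto_atTop_add_const_right _ _ tendsto_id) T) T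

lemma IsTypical.exists_shadow_past {θ : ℝ} (hc : 0 < Real.cos θ) (hT : B.IsTypical θ)
    {e₀ : B.Edge} (h : B.IsSoleEscape (Real.tan θ) e₀) {z w : B.Phase}
    (hz : ¬ B.EscapesInPast θ z) (hw : w ∈ B.orbit θ e₀.toPhase)
    {W : Set (B.Surface × B.Surface)} (hW : IsOpen W) (hdiag : ∀ x, (x, x) ∈ W) (T : ℝ) :
    ∃ t₀ ≤ -T, ∀ s ∈ Icc (-T) T, (B.proj (B.flow θ (t₀ + s) z), B.proj (B.flow θ s w)) ∈ W :=
  frequently_atBot.1 ((hT.approaches_past hc h hz).shadow h hw hW hdiag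
    (fun _ => tendsto_atBot_add_const_right _ _ tendsto_id) T) (-T)

lemma IsTypical.subset_closure_orbit {θ : ℝ} (hc : 0 < Real.cos θ) (hT : B.IsTypical θ)
    {e₀ : B.Edge} (h : B.IsSoleEscape (Real.tan θ) e₀) (z : B.Phase) :
    B.proj '' B.orbit θ e₀.toPhase ⊆ closure (B.proj '' B.orbit θ z) := by
  by_cases hz : z ∈ B.orbit θ e₀.toPhase
  · rw [orbit_eq_of_mem hz]
    exact subset_closure
  · exact (hT.subset_omegaLim hc h hz).trans (omegaLim_subset_closure θ z)

lemma IsTypical.eq_const_of_invariant {θ : ℝ} (hc : 0 < Real.cos θ) (hT : B.IsTypical θ)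
    {e₀ : B.Edge} (h : B.IsSoleEscape (Real.tan θ) e₀) {f : B.Surface → ℝ} (hf : Continuous f)
    (hinv : ∀ t z, f (B.proj (B.flow θ t z)) = f (B.proj z)) : ∃ c, ∀ x, f x = c := by
  refine ⟨f (B.proj e₀.toPhase), fun x => ?_⟩
  obtain ⟨z, rfl⟩ := proj_surjective x
  have hclosure : closure (B.proj '' B.orbit θ z) ⊆ {x | f x = f (B.proj z)} := by
    refine closure_minimal ?_ (isClosed_eq hf continuous_const)
    rintro _ ⟨_, ⟨t, rfl⟩, rfl⟩
    exact hinv t z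
  exact (hclosure (hT.subset_closure_orbit hc h z ⟨_, mem_orbit_self θ _, rfl⟩)).symm

lemma IsTypical.isMinimalFlow_iff {θ : ℝ} (hc : 0 < Real.cos θ) (hT : B.IsTypical θ)
    {e₀ : B.Edge} (h : B.IsSoleEscape (Real.tan θ) e₀) :
    B.IsMinimalFlow θ ↔ Dense (B.proj '' B.orbit θ e₀.toPhase) :=
  ⟨fun hm => hm _, fun hd z => dense_closure.1 (hd.mono (hT.subset_closure_orbit hc h z))⟩

/-! ### The trace of the escape orbit on `L` -/

variable (B) in
/-- The trace on `L` of the orbit of `e`, as a subset of the surface. -/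
def sectionTrace (θ : ℝ) (e : B.Edge) : Set B.Surface :=
  B.proj '' (B.orbit θ e.toPhase ∩ B.section0)

variable (B) in
/-- The heights at which the orbit of `e` crosses the section `k = 0`. Heights are taken modulo `2`,
so this is the lift of `sectionTrace` to the universal covering `sectionCurve` of `L`. -/
def crossings (a : ℝ) (e : B.Edge) : Set ℝ := {y | (B.step a).SameCycle e (B.edgeAt 0 y)}

lemma mem_crossings_iff_of_step_zpow {a x y : ℝ} {e : B.Edge} {n : ℤ}
    (h : (B.step a ^ n) (B.edgeAt 0 x) = B.edgeAt 0 y) :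
    x ∈ B.crossings a e ↔ y ∈ B.crossings a e := by
  rw [crossings, mem_ofPred_eq, mem_ofPred_eq, ← h, Equiv.Perm.sameCycle_zpow_right]

lemma preimage_sectionTrace {θ : ℝ} (hc : Real.cos θ ≠ 0) (e : B.Edge) :
    B.sectionCurve ⁻¹' B.sectionTrace θ e = B.crossings (Real.tan θ) e := by
  ext y
  rw [crossings, mem_ofPred_eq, ← toPhase_mem_orbit_iff hc]
  constructor
  · rintro ⟨z, ⟨hz, hz₀⟩, hzy⟩
    rw [mem_section0_iff] at hz₀
    rw [hz₀] at hz hzy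
    obtain ⟨m, rfl⟩ := sectionCurve_eq_sectionCurve_iff.1 hzy
    have hedge : B.edgeAt 0 (z.Y + 2 * m) = B.edgeAt 0 z.Y :=
      edgeAt_eq_edgeAt_iff.2 ⟨m, by rw [h_zero, mul_one, mul_comm]⟩
    rwa [hedge]
  · exact fun h => ⟨_, ⟨h, toPhase_mem_section0_iff.2 rfl⟩, rfl⟩

lemma sectionTrace_subset_range_sectionCurve (θ : ℝ) (e : B.Edge) :
    B.sectionTrace θ e ⊆ range B.sectionCurve := by
  rw [← image_section0]
  exact image_mono inter_subset_right

namespace IsSoleEscape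

variable {a : ℝ} {e₀ : B.Edge}

lemma y_mem_crossings (h : B.IsSoleEscape a e₀) : e₀.y ∈ B.crossings a e₀ := by
  rw [crossings, mem_ofPred_eq, h.edgeAt_zero_y]

lemma eventually_mem_crossings_iff (h : B.IsSoleEscape a e₀) {y : ℝ} (hy : y ∈ B.crossings a e₀) :
    ∀ᶠ t in 𝓝 0, e₀.y + t ∈ B.crossings a e₀ ↔ y + t ∈ B.crossings a e₀ := by
  obtain ⟨n, hn⟩ := hy
  filter_upwards [h.regular.eventually_step_zpow_translate n] with t ht
  refine mem_crossings_iff_of_step_zpow (n := n) ?_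
  rw [← translate_edgeAt, h.edgeAt_zero_y, ht, hn, translate_edgeAt]

end IsSoleEscape

/-! ### The closure of the trace is perfect -/

lemma IsTypical.frequently_add_mem_crossings {θ : ℝ} (hc : 0 < Real.cos θ) (hT : B.IsTypical θ)
    {e₀ : B.Edge} (h : B.IsSoleEscape (Real.tan θ) e₀) :
    ∃ᶠ t in 𝓝[≠] 0, e₀.y + t ∈ B.crossings (Real.tan θ) e₀ := by
  rw [(nhdsWithin_hasBasis Metric.nhds_basis_ball _).frequently_iff]
  intro ε hε
  obtain ⟨i, ⟨hk, hy⟩, hi⟩ := ((hT.frequently_past_near hc h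
    (fun hs => h.regular.not_sameCycle_mirror hs.symm) hε).and_eventually
      (eventually_ge_atTop 1)).exists
  set f := (B.step (Real.tan θ) ^ (-(i : ℤ))) e₀ with hf
  have hedge : B.edgeAt 0 (e₀.y + (f.y - e₀.y)) = f := by rw [add_sub_cancel, ← hk, edgeAt_k_y]
  refine ⟨f.y - e₀.y, ⟨by rwa [mem_ball_zero_iff], fun hzero => ?_⟩, -i, hf.symm.trans hedge.symm⟩
  have hfe : f = e₀ := by rw [← hedge, hzero, add_zero, h.edgeAt_zero_y]
  have hback : (B.step (Real.tan θ) ^ (i : ℤ)) f = e₀ := by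
    rw [hf, perm_zpow_zpow_apply, add_neg_cancel, zpow_zero, Equiv.Perm.one_apply]
  have hki := h.escaping i
  rw [← hfe, hback, h.k_eq_zero] at hki
  omega

lemma tendsto_sectionCurve_add_nhdsNE (y : ℝ) :
    Tendsto (fun t => B.sectionCurve (y + t)) (𝓝[≠] 0) (𝓝[≠] (B.sectionCurve y)) := by
  have hcont : Continuous fun t => B.sectionCurve (y + t) :=
    continuous_sectionCurve.comp (by fun_prop)
  refine tendsto_nhdsWithin_iff.2
    ⟨((hcont.tendsto' 0 _ (by rw [add_zero])).mono_left nhdsWithin_le_nhds), ?_⟩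
  filter_upwards [self_mem_nhdsWithin,
    nhdsWithin_le_nhds (Ioo_mem_nhds (neg_lt_zero.2 two_pos) two_pos)] with t hne ht heq
  obtain ⟨m, hm⟩ := sectionCurve_eq_sectionCurve_iff.1 heq
  have hlo : ((-1 : ℤ) : ℝ) < m := by
    push_cast
    linarith [ht.2]
  have hhi : (m : ℝ) < (1 : ℤ) := by
    push_cast
    linarith [ht.1]
  have hm₀ : m = 0 := by
    have := Int.cast_lt.1 hlo
    have := Int.cast_lt.1 hhi
    omega
  rw [hm₀, Int.cast_zero, mul_zero, add_zero, add_eq_left] at hm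
  exact hne hm

lemma IsTypical.preperfect_sectionTrace {θ : ℝ} (hc : 0 < Real.cos θ) (hT : B.IsTypical θ)
    {e₀ : B.Edge} (h : B.IsSoleEscape (Real.tan θ) e₀) : Preperfect (B.sectionTrace θ e₀) := by
  intro x hx
  obtain ⟨y, rfl⟩ := sectionTrace_subset_range_sectionCurve θ e₀ hx
  rw [← mem_preimage, preimage_sectionTrace hc.ne'] at hx
  refine accPt_iff_frequently_nhdsNE.2 ((tendsto_sectionCurve_add_nhdsNE y).frequently
    (((hT.frequently_add_mem_crossings hc h).and_eventually
      (nhdsWithin_le_nhds (h.eventually_mem_crossings_iff hx))).mono ?_))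
  rintro t ⟨ht, hiff⟩
  rw [← mem_preimage, preimage_sectionTrace hc.ne']
  exact hiff.1 ht

/-! ### The closure of the trace is nowhere dense or everything -/

lemma mem_closure_crossings_of_step_zpow {a x y : ℝ} {e : B.Edge} {n : ℤ}
    (h : (B.step a ^ n) (B.edgeAt 0 x) = B.edgeAt 0 y) (hy : closure (B.crossings a e) ∈ 𝓝 y) :
    x ∈ closure (B.crossings a e) := by
  obtain ⟨ε, hε, htranslate⟩ := exists_step_zpow_translate a n (B.edgeAt 0 x)
  have hlim : Tendsto (x + ·) (𝓝[>] 0) (𝓝 x) :=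
    ((continuous_const_add x).tendsto' 0 x (add_zero x)).mono_left nhdsWithin_le_nhds
  refine mem_closure_iff_frequently.2 (hlim.frequently
    (((frequently_add_mem_of_closure_mem_nhds hy).and_eventually (Ioo_mem_nhdsGT hε)).mono ?_))
  rintro t ⟨ht, htε⟩
  refine (mem_crossings_iff_of_step_zpow (n := n) ?_).2 ht
  rw [← translate_edgeAt, htranslate t (Ioo_subset_Ico_self htε), h, translate_edgeAt]

lemma IsSoleEscape.closure_crossings_mem_nhds {a : ℝ} {e₀ : B.Edge} (h : B.IsSoleEscape a e₀)
    (hint : (interior (closure (B.crossings a e₀))).Nonempty) :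
    closure (B.crossings a e₀) ∈ 𝓝 e₀.y := by
  obtain ⟨w, hw⟩ := hint
  obtain ⟨y, hyint, hy⟩ := mem_closure_iff.1 (interior_subset hw) _ isOpen_interior hw
  exact closure_mem_nhds_of_eventually_add_mem
    ((h.eventually_mem_crossings_iff hy).mono fun _ => Iff.mpr) (mem_interior_iff_mem_nhds.1 hyint)

-- A point of `L` off the escape orbit comes back close to the escape point, hence into the interior
-- of the closure, and the iterated step map carries the approximation back.
lemma IsTypical.closure_crossings_eq_univ {θ : ℝ} (hc : 0 < Real.cos θ) (hT : B.IsTypical θ)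
    {e₀ : B.Edge} (h : B.IsSoleEscape (Real.tan θ) e₀)
    (hint : (interior (closure (B.crossings (Real.tan θ) e₀))).Nonempty) :
    closure (B.crossings (Real.tan θ) e₀) = univ := by
  refine eq_univ_of_forall fun w => ?_
  by_cases hw : w ∈ B.crossings (Real.tan θ) e₀
  · exact subset_closure hw
  obtain ⟨ε, hε, hball⟩ := Metric.eventually_nhds_iff.1
    (eventually_mem_nhds_iff.2 (h.closure_crossings_mem_nhds hint))
  obtain ⟨i, hk, hy⟩ := (hT.frequently_future_near hc h hw hε).exists
  have hedge := edgeAt_k_y ((B.step (Real.tan θ) ^ (i : ℤ)) (B.edgeAt 0 w))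
  rw [hk] at hedge
  exact mem_closure_crossings_of_step_zpow hedge.symm (hball hy)

/-! ### Totally disconnected subsets of `L` -/

lemma range_sectionCurve_subset_union (u v : ℝ) :
    range B.sectionCurve ⊆ B.sectionCurve '' Icc u v ∪ B.sectionCurve '' Icc v (u + 2) := by
  rintro _ ⟨w, rfl⟩
  obtain ⟨x, hx, hxw⟩ := B.exists_mem_Ico_sectionCurve_eq w u
  rcases le_total x v with hle | hle
  · exact Or.inl ⟨x, ⟨hx.1, hle⟩, hxw⟩
  · exact Or.inr ⟨x, ⟨hle, hx.2.le⟩, hxw⟩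

lemma image_sectionCurve_Icc_inter_subset (u v : ℝ) :
    B.sectionCurve '' Icc u v ∩ B.sectionCurve '' Icc v (u + 2) ⊆
      {B.sectionCurve u, B.sectionCurve v} := by
  rintro _ ⟨⟨x, hx, rfl⟩, y, hy, hyx⟩
  obtain ⟨m, hm⟩ := sectionCurve_eq_sectionCurve_iff.1 hyx.symm
  have hlo : ((-1 : ℤ) : ℝ) < m := by
    push_cast
    linarith [hx.2, hy.1]
  have hhi : (m : ℝ) < (2 : ℤ) := by
    push_cast
    linarith [hx.1, hy.2]
  have hlo := Int.cast_lt.1 hlo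
  have hhi := Int.cast_lt.1 hhi
  obtain rfl | rfl : m = 0 ∨ m = 1 := by omega
  · rw [Int.cast_zero, mul_zero, add_zero] at hm
    exact Or.inr (congrArg _ (hx.2.antisymm (hy.1.trans_eq hm.symm)))
  · rw [Int.cast_one, mul_one] at hm
    exact Or.inl (congrArg _ (le_antisymm (by linarith [hy.2]) hx.1))

lemma isTotallyDisconnected_of_forall_exists_notMem {C : Set B.Surface}
    (hC : C ⊆ range B.sectionCurve)
    (h : ∀ u v : ℝ, u < v → ∃ x ∈ Ioo u v, B.sectionCurve x ∉ C) : IsTotallyDisconnected C := by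
  intro S hS hpre x₁ hx₁ x₂ hx₂
  by_contra hne
  obtain ⟨y₁, rfl⟩ := hC (hS hx₁)
  obtain ⟨y, rfl⟩ := hC (hS hx₂)
  obtain ⟨y₂, hy₂, heq⟩ := B.exists_mem_Ico_sectionCurve_eq y y₁
  rw [← heq] at hx₂ hne
  have hlt : y₁ < y₂ := hy₂.1.lt_of_ne (ne_of_apply_ne _ hne)
  obtain ⟨u, hu, huC⟩ := h y₁ y₂ hlt
  obtain ⟨v, hv, hvC⟩ := h y₂ (y₁ + 2) hy₂.2
  obtain ⟨x, hxS, hx⟩ := isPreconnected_closed_iff.1 hpre _ _ (isClosed_image_sectionCurve_Icc u v)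
    (isClosed_image_sectionCurve_Icc v (u + 2))
    ((hS.trans hC).trans (range_sectionCurve_subset_union u v))
    ⟨_, hx₂, mem_image_of_mem _ ⟨hu.2.le, hv.1.le⟩⟩
    ⟨_, hx₁, y₁ + 2, ⟨hv.2.le, by linarith [hu.1]⟩, by
      simpa only [Int.cast_one, mul_one] using sectionCurve_add_intCast y₁ 1⟩
  rcases image_sectionCurve_Icc_inter_subset u v hx with rfl | rfl
  · exact huC (hS hxS)
  · exact hvC (hS hxS)

lemma IsTypical.closure_sectionTrace {θ : ℝ} (hc : 0 < Real.cos θ) (hT : B.IsTypical θ)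
    {e₀ : B.Edge} (h : B.IsSoleEscape (Real.tan θ) e₀) :
    closure (B.sectionTrace θ e₀) = B.proj '' B.section0 ∨
      IsCantorSet (closure (B.sectionTrace θ e₀)) := by
  have hrange := sectionTrace_subset_range_sectionCurve θ e₀
  have hclosure : closure (B.sectionTrace θ e₀) ⊆ range B.sectionCurve :=
    closure_minimal hrange isClosed_range_sectionCurve
  have hmem (y : ℝ) : B.sectionCurve y ∈ closure (B.sectionTrace θ e₀) ↔
      y ∈ closure (B.crossings (Real.tan θ) e₀) := by
    rw [sectionCurve_mem_closure_iff hrange, preimage_sectionTrace hc.ne']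
  rcases (interior (closure (B.crossings (Real.tan θ) e₀))).eq_empty_or_nonempty with hint | hint
  · right
    refine ⟨⟨_, (hmem e₀.y).2 (subset_closure h.y_mem_crossings)⟩,
      isCompact_range_sectionCurve.of_isClosed_subset isClosed_closure hclosure,
      (hT.preperfect_sectionTrace hc h).perfect_closure,
      isTotallyDisconnected_of_forall_exists_notMem hclosure fun u v huv => ?_⟩
    by_contra! hsub
    have hIoo : Ioo u v ⊆ interior (closure (B.crossings (Real.tan θ) e₀)) :=
      interior_maximal (fun x hx => (hmem x).1 (hsub x hx)) isOpen_Ioo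
    rw [hint, subset_empty_iff, Ioo_eq_empty_iff] at hIoo
    exact hIoo huv
  · left
    rw [image_section0]
    refine hclosure.antisymm ?_
    rintro _ ⟨w, rfl⟩
    rw [hmem, hT.closure_crossings_eq_univ hc h hint]
    exact mem_univ w

end StepBilliard

end

theorem mainTheorem4_general (B : StepBilliard) :
    (∀ lam < (1 / 3 : ℝ), (∀ n, B.p (n + 1) ≤ lam * B.p n) →
      ∀ᵐ θ : ℝ, 0 < Real.cos θ → B.IsTypical θ) ∧
    ∀ θ, 0 < Real.cos θ → B.IsTypical θ → ∀ η : Set B.Phase, B.IsEscapeOrbit θ η →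
      (∀ z ∈ η, B.OscillatesInPast θ z) ∧
      (∀ z, z ∉ η → B.proj '' η ⊆ B.omegaLim θ z) ∧
      ((∃ z₀, {z | B.EscapesInPast θ z} = B.orbit θ z₀) ∧
        ∀ z, ¬ B.EscapesInPast θ z → B.proj '' η ⊆ B.alphaLim θ z) ∧
      (∀ W : Set (B.Surface × B.Surface), IsOpen W → (∀ x, (x, x) ∈ W) → ∀ w ∈ η, ∀ T > 0,
        (∀ z, z ∉ η → ∃ t₀ ≥ T, ∀ s ∈ Icc (-T) T,
          (B.proj (B.flow θ (t₀ + s) z), B.proj (B.flow θ s w)) ∈ W) ∧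
        (∀ z, ¬ B.EscapesInPast θ z → ∃ t₀ ≤ -T, ∀ s ∈ Icc (-T) T,
          (B.proj (B.flow θ (t₀ + s) z), B.proj (B.flow θ s w)) ∈ W)) ∧
      (∀ f : B.Surface → ℝ, Continuous f →
        (∀ t z, f (B.proj (B.flow θ t z)) = f (B.proj z)) → ∃ c, ∀ x, f x = c) ∧
      (B.IsMinimalFlow θ ↔ Dense (B.proj '' η)) ∧
      (closure (B.proj '' (η ∩ B.section0)) = B.proj '' B.section0 ∨
        IsCantorSet (closure (B.proj '' (η ∩ B.section0)))) := by
  refine ⟨fun lam hlam hp => StepBilliard.ae_isTypical hlam hp, fun θ hc hT η hη => ?_⟩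
  obtain ⟨e₀, h, hsole⟩ := hT.exists_isSoleEscape hc
  obtain rfl := hsole η hη
  exact ⟨fun z hz => hT.oscillatesInPast hc h hz,
    fun z hz => hT.subset_omegaLim hc h hz,
    ⟨⟨_, Set.ext fun z => hT.escapesInPast_iff hc h⟩, fun z hz => hT.subset_alphaLim hc h hz⟩,
    fun W hW hd w hw T _ =>
      ⟨fun z hz => hT.exists_shadow_future hc h hz hw hW hd T,
        fun z hz => hT.exists_shadow_past hc h hz hw hW hd T⟩,
    fun f hf hinv => hT.eq_const_of_invariant hc h hf hinv,
    hT.isMinimalFlow_iff hc h,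
    hT.closure_sectionTrace hc h⟩

theorem mainTheorem4 (B : StepBilliard) (lam : ℝ) (hlam₀ : 0 < lam)
    (hlam₁ : lam < (Real.sqrt 6 - 1) / 5) (hp : ∀ n, B.p (n + 1) ≤ lam * B.p n) :
    -- almost every direction is typical
    (∀ᵐ θ ∂(volume.restrict (Ioo 0 (Real.pi / 2))), B.IsTypical θ) ∧
    -- for every typical direction, with `η` the unique escape orbit:
    ∀ θ ∈ Ioo 0 (Real.pi / 2), B.IsTypical θ → ∀ η : Set B.Phase, B.IsEscapeOrbit θ η →
      -- (i)
      (∀ z ∈ η, B.OscillatesInPast θ z) ∧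
      -- (ii)
      (∀ z, z ∉ η → B.proj '' η ⊆ B.omegaLim θ z) ∧
      -- (iii)
      ((∃ z₀, {z | B.EscapesInPast θ z} = B.orbit θ z₀) ∧
        ∀ z, ¬ B.EscapesInPast θ z → B.proj '' η ⊆ B.alphaLim θ z) ∧
      -- (iv), forward and backward semi-orbits
      (∀ W : Set (B.Surface × B.Surface), IsOpen W → (∀ x, (x, x) ∈ W) → ∀ w ∈ η, ∀ T > 0,
        (∀ z, z ∉ η → ∃ t₀ ≥ T, ∀ s ∈ Icc (-T) T,
          (B.proj (B.flow θ (t₀ + s) z), B.proj (B.flow θ s w)) ∈ W) ∧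
        (∀ z, ¬ B.EscapesInPast θ z → ∃ t₀ ≤ -T, ∀ s ∈ Icc (-T) T,
          (B.proj (B.flow θ (t₀ + s) z), B.proj (B.flow θ s w)) ∈ W)) ∧
      -- (v)
      (∀ f : B.Surface → ℝ, Continuous f →
        (∀ t z, f (B.proj (B.flow θ t z)) = f (B.proj z)) → ∃ c, ∀ x, f x = c) ∧
      -- (vi)
      (B.IsMinimalFlow θ ↔ Dense (B.proj '' η)) ∧
      -- (vii)
      (closure (B.proj '' (η ∩ B.section0)) = B.proj '' B.section0 ∨
        IsCantorSet (closure (B.proj '' (η ∩ B.section0)))) := by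
  obtain ⟨htypical, hprops⟩ := mainTheorem4_general B
  have hsqrt : Real.sqrt 6 < 8 / 3 := (Real.sqrt_lt' (by norm_num)).2 (by norm_num)
  have hcos {θ : ℝ} (hθ : θ ∈ Ioo 0 (Real.pi / 2)) : 0 < Real.cos θ :=
    Real.cos_pos_of_mem_Ioo ⟨by linarith [hθ.1, Real.pi_pos], hθ.2⟩
  exact ⟨(ae_restrict_iff' measurableSet_Ioo).2
    ((htypical lam (by linarith) hp).mono fun θ h hθ => h (hcos hθ)),
    fun θ hθ => hprops θ (hcos hθ)⟩
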